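/- **Proposition.** QCETH implies QETH, where the notions are as follows. *Boolean circuits.* A Boolean circuit is built from gates of fan-in one and two (small gates) and AND and OR gates of unbounded fan-in (large gates), with unbounded fan-out. Its weft is the maximal number of large gates on a path to the output. Its total description size is $n$ if $n$ is the maximum of the number of inputs and the number of gates. *Quantum circuits.* A quantum circuit acts on witness (input) qubits and on ancilla qubits initialised to $|0\rangle$. It consists of one- and two-qubit gates from the universal set $\{X,H,T,\mathrm{CNOT}\}$, generalised Toffoli gates with any number of controls, and classical fanout gates: the targets of a fanout gate are ancillas on which no earlier gate acts and which later gates use only as controls. It accepts if measuring its output qubit in the computational basis gives $1$. Its weft is the maximal number of Toffoli gates on a path to the output qubit; its total description size $n$ is the maximum of the number of input (witness) qubits and the number of gates (ancillas are not counted). A weft-$1$ circuit is one of weft at most $1$. *Quantum algorithms.* A quantum algorithm is a deterministic Turing machine which, on the description of an instance, writes the description of a quantum circuit without witness, made of gates from $\{X,H,T,\mathrm{CNOT}\}$, which is then run on $|0\cdots0\rangle$ and measured. It decides a (promise) problem if this circuit accepts with probability at least $2/3$ on yes-instances and at most $1/3$ on no-instances. It runs in time $2^{o(n)}$ if there is a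 function $f$ with $f(n)=o(n)$ such that the machine halts after at most $2^{f(n)}$ steps on each instance of total description size $n$. *QCETH.* There is no quantum algorithm running in time $2^{o(n)}$ that decides, for a weft-$1$ Boolean circuit $C$ of total description size $n$, whether there is an input vector $x$ with $C(x)=1$. *QETH.* There are functions $c,s:\mathbb N\to[0,1]$, with rational values whose numerators and denominators are computable in time polynomial in $n$, and polynomials $p,q$ with $p(n)>0$ and $c(n)-s(n)>1/p(n)$ for all $n$, such that no quantum algorithm running in time $2^{o(n)}$ decides, for a weft-$1$ quantum circuit $Q$ of total description size $n$ with at most $q(n)$ ancilla qubits, whether (i) there is a witness state $|\psi\rangle$ with $\Pr(Q(|\psi\rangle)\text{ accepts})\ge c(n)$, or (ii) $\Pr(Q(|\psi\rangle)\text{ accepts})\le s(n)$ for all witness states $|\psi\rangle$, given that one of the two holds. -/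

import Mathlib

namespace WeftETH

noncomputable section

/-! ## Alphabet used to write circuits as words -/

/-- The finite alphabet in which circuits are written. -/
inductive Sym
  | tick | sep | close
  | bit (b : Bool)
  | notG | binG | andG | orG
  | xG | hG | tG | cnotG | toffoliG | fanoutG
  deriving DecidableEq, Fintype

/-- Unary notation for a natural number, terminated by a separator. -/
def encodeNum (i : ℕ) : List Sym := List.replicate i Sym.tick ++ [Sym.sep]

/-- A list of natural numbers, terminated by a closing symbol. -/
def encodeNums (l : List ℕ) : List Sym := l.flatMap encodeNum ++ [Sym.close]

/-! ## Boolean circuits -/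

/-- Gates of a Boolean circuit.  A gate reads wires, which are given by their numbers.  The small
gates are negation and all gates of fan-in two; the large gates are AND and OR of arbitrary
fan-in.  (A generalised Toffoli gate `t ⊕ ⋀ cs` is a large AND followed by a fan-in two gate.) -/
inductive BGate
  | not (a : ℕ)
  | bin (f : Bool → Bool → Bool) (a b : ℕ)
  | and (l : List ℕ)
  | or (l : List ℕ)

namespace BGate

/-- The wires that a gate reads. -/
def inputs : BGate → List ℕ
  | not a => [a]
  | bin _ a b => [a, b]
  | and l => l
  | or l => l

/-- The gates that count towards the weft. -/
def isLarge : BGate → Bool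
  | not _ => false
  | bin _ _ _ => false
  | and _ => true
  | or _ => true

/-- The value of a gate, given the values of all wires. -/
def eval (v : ℕ → Bool) : BGate → Bool
  | not a => !(v a)
  | bin f a b => f (v a) (v b)
  | and l => l.all v
  | or l => l.any v

/-- The number of large gates on a worst path ending with this gate, given the same data for all
wires. -/
def level (d : ℕ → ℕ) (g : BGate) : ℕ :=
  g.inputs.toFinset.sup d + if g.isLarge then 1 else 0

/-- The word describing a gate. -/
def encode : BGate → List Sym
  | not a => Sym.notG :: encodeNum a
  | bin f a b =>
      [Sym.binG, Sym.bit (f false false), Sym.bit (f false true), Sym.bit (f true false),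
        Sym.bit (f true true)] ++ encodeNum a ++ encodeNum b
  | and l => Sym.andG :: encodeNums l
  | or l => Sym.orG :: encodeNums l

end BGate

/-- A Boolean circuit.  The wires `0, …, numInputs - 1` are the input bits and the wire
`numInputs + j` is the output of the `j`-th gate; fan-out is unbounded. -/
structure BCircuit where
  /-- number of input bits -/
  numInputs : ℕ
  /-- the gates, in topological order -/
  gates : List BGate
  /-- the output wire -/
  out : ℕ

namespace BCircuit

/-- Every gate reads input bits and earlier gates only, a large gate reads each wire at most once,
and the output wire exists. -/
def WF (C : BCircuit) : Prop :=
  (∀ (j : ℕ) (h : j < C.gates.length), ∀ i ∈ (C.gates[j]).inputs, i < C.numInputs + j) ∧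
  (∀ g ∈ C.gates, g.isLarge = true → g.inputs.Nodup) ∧
  C.out < C.numInputs + C.gates.length

/-- The values of all wires on the input `x`. -/
def values (C : BCircuit) (x : Fin C.numInputs → Bool) : List Bool :=
  C.gates.foldl (fun vals g => vals ++ [g.eval fun i => vals.getD i false]) (List.ofFn x)

/-- The output bit `C(x)`. -/
def eval (C : BCircuit) (x : Fin C.numInputs → Bool) : Bool :=
  (C.values x).getD C.out false

/-- For every wire, the maximal number of large gates on a path ending in that wire. -/
def levels (C : BCircuit) : List ℕ :=
  C.gates.foldl (fun lev g => lev ++ [g.level fun i => lev.getD i 0])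
    (List.replicate C.numInputs 0)

/-- The weft: the maximal number of large gates on a path to the output wire. -/
def weft (C : BCircuit) : ℕ := C.levels.getD C.out 0

/-- Total description size: the least bound on the number of inputs and the number of gates. -/
def size (C : BCircuit) : ℕ := max C.numInputs C.gates.length

/-- The word describing a circuit. -/
def encode (C : BCircuit) : List Sym :=
  encodeNum C.numInputs ++ encodeNum C.out ++ C.gates.flatMap BGate.encode

/-- There is an input vector `x` with `C(x) = 1`. -/
def Satisfiable (C : BCircuit) : Prop := ∃ x : Fin C.numInputs → Bool, C.eval x = true

end BCircuit

/-! ## Quantum circuits -/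

/-- Computational basis states of `N` qubits. -/
abbrev Bits (N : ℕ) : Type := Fin N → Bool

/-- Vectors of amplitudes of `N` qubits. -/
abbrev QState (N : ℕ) : Type := Bits N → ℂ

/-- Negate bit `t`. -/
def flip {N : ℕ} (t : Fin N) (x : Bits N) : Bits N := Function.update x t (!(x t))

/-- Gates of a quantum circuit on `N` qubits: the one- and two-qubit gates of the universal set
`X, H, T, CNOT`, generalised Toffoli gates with any number of controls, and fanout. -/
inductive QGate (N : ℕ)
  | x (t : Fin N)
  | h (t : Fin N)
  | t (t : Fin N)
  | cnot (c t : Fin N)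
  | toffoli (cs : List (Fin N)) (t : Fin N)
  | fanout (c : Fin N) (ts : List (Fin N))

namespace QGate

variable {N : ℕ}

/-- The qubits that a gate uses as controls. -/
def controls : QGate N → List (Fin N)
  | x _ => []
  | h _ => []
  | t _ => []
  | cnot c _ => [c]
  | toffoli cs _ => cs
  | fanout c _ => [c]

/-- The qubits on which a gate acts otherwise than by using them as controls. -/
def targets : QGate N → List (Fin N)
  | x q => [q]
  | h q => [q]
  | t q => [q]
  | cnot _ q => [q]
  | toffoli _ q => [q]
  | fanout _ ts => ts

/-- All qubits that a gate touches. -/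
def qubits (g : QGate N) : List (Fin N) := g.controls ++ g.targets

/-- The qubits of a gate are pairwise different. -/
def WF (g : QGate N) : Prop := g.qubits.Nodup

/-- The gates that count towards the weft. -/
def isToffoli : QGate N → Bool
  | toffoli _ _ => true
  | _ => false

/-- The one- and two-qubit gates. -/
def isElementary : QGate N → Bool
  | toffoli _ _ => false
  | fanout _ _ => false
  | _ => true

/-- The action of a gate on amplitudes.  `X`, `CNOT`, Toffoli and fanout are involutive
permutations `π` of the basis states, so that `|x⟩ ↦ |π x⟩` sends `ψ` to `ψ ∘ π`. -/
def apply (g : QGate N) (ψ : QState N) : QState N :=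
  match g with
  | x q => fun y => ψ (flip q y)
  | h q => fun y =>
      (ψ (Function.update y q false) + (if y q then -1 else 1) * ψ (Function.update y q true)) /
        (Real.sqrt 2 : ℂ)
  | t q => fun y => (if y q then Complex.exp (Complex.I * Real.pi / 4) else 1) * ψ y
  | cnot c q => fun y => ψ (if y c then flip q y else y)
  | toffoli cs q => fun y => ψ (if cs.all y then flip q y else y)
  | fanout c ts => fun y => ψ (fun q => if q ∈ ts then xor (y q) (y c) else y q)

/-- How a gate changes, for every qubit, the maximal number of Toffoli gates on a path ending in
that qubit.  A path may enter a gate at any of its qubits and leave it at any of its qubits. -/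
def level (g : QGate N) (d : Fin N → ℕ) : Fin N → ℕ := fun q =>
  if q ∈ g.qubits then g.qubits.toFinset.sup d + (if g.isToffoli then 1 else 0) else d q

/-- The word describing a gate. -/
def encode : QGate N → List Sym
  | x q => Sym.xG :: encodeNum q
  | h q => Sym.hG :: encodeNum q
  | t q => Sym.tG :: encodeNum q
  | cnot c q => Sym.cnotG :: (encodeNum c ++ encodeNum q)
  | toffoli cs q => Sym.toffoliG :: (encodeNums (cs.map Fin.val) ++ encodeNum q)
  | fanout c ts => Sym.fanoutG :: (encodeNum c ++ encodeNums (ts.map Fin.val))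

end QGate

/-- A quantum circuit.  The first `numInputs` qubits hold the witness, the other `numAncilla`
qubits start in `|0⟩`; at the end the qubit `out` is measured in the computational basis and the
circuit accepts if the outcome is `1`. -/
structure QCircuit where
  /-- number of input (witness) qubits -/
  numInputs : ℕ
  /-- number of ancilla qubits -/
  numAncilla : ℕ
  /-- the gates, in the order in which they are applied -/
  gates : List (QGate (numInputs + numAncilla))
  /-- the measured output qubit -/
  out : Fin (numInputs + numAncilla)

namespace QCircuit

/-- All fanout gates are classical: every target is an ancilla that no earlier gate touches, and
later gates use it only as a control. -/
def ClassicalFanout (Q : QCircuit) : Prop :=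
  ∀ pre post c ts, Q.gates = pre ++ QGate.fanout c ts :: post →
    ∀ q ∈ ts, Q.numInputs ≤ q.val ∧ (∀ g ∈ pre, q ∉ g.qubits) ∧ (∀ g ∈ post, q ∉ g.targets)

/-- The circuit is well formed. -/
def WF (Q : QCircuit) : Prop := (∀ g ∈ Q.gates, g.WF) ∧ Q.ClassicalFanout

/-- The maximal number of Toffoli gates on a path to the output qubit. -/
def weft (Q : QCircuit) : ℕ := Q.gates.foldl (fun d g => g.level d) (fun _ => 0) Q.out

/-- Total description size: the least bound on the number of inputs and the number of gates. -/
def size (Q : QCircuit) : ℕ := max Q.numInputs Q.gates.length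

/-- The word describing a circuit. -/
def encode (Q : QCircuit) : List Sym :=
  encodeNum Q.numInputs ++ encodeNum Q.numAncilla ++ encodeNum Q.out ++
    Q.gates.flatMap QGate.encode

/-- The initial state `|ψ⟩ ⊗ |0…0⟩`. -/
def initState (Q : QCircuit) (ψ : QState Q.numInputs) : QState (Q.numInputs + Q.numAncilla) :=
  fun y => if ∀ i : Fin Q.numAncilla, y (Fin.natAdd Q.numInputs i) = false then
    ψ (fun i => y (Fin.castAdd Q.numAncilla i)) else 0

/-- The state after all gates have been applied. -/
def finalState (Q : QCircuit) (ψ : QState Q.numInputs) : QState (Q.numInputs + Q.numAncilla) :=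
  Q.gates.foldl (fun φ g => g.apply φ) (Q.initState ψ)

/-- The probability that the circuit accepts `|ψ⟩`. -/
def acceptProb (Q : QCircuit) (ψ : QState Q.numInputs) : ℝ :=
  ∑ y : Bits (Q.numInputs + Q.numAncilla), if y Q.out then ‖Q.finalState ψ y‖ ^ 2 else 0

end QCircuit

/-- Unit vectors. -/
def IsUnitState {N : ℕ} (ψ : QState N) : Prop := ∑ y : Bits N, ‖ψ y‖ ^ 2 = 1

/-! ## Quantum algorithms and running times -/

/-- `M` on input `u` halts with output `v` after at most `t` steps. -/
def OutputsIn (M : Turing.TM2ComputableAux Sym Sym) (u v : List Sym) (t : ℕ) : Prop :=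
  Nonempty (Turing.TM2OutputsInTime M.tm (u.map M.inputAlphabet.symm)
    (some (v.map M.outputAlphabet.symm)) t)

/-- A quantum algorithm is a Turing machine `M` that, given an instance, writes down a quantum
circuit of one- and two-qubit gates without input, which is then run on `|0…0⟩` and measured.
It solves the promise problem `(yes, no)` on the given instances in time `T` if `M` runs in time
`T (size a)` on each instance `a` and the circuit accepts with probability at least `2/3` if
`yes a` and at most `1/3` if `no a`.  (The circuit has no more gates than symbols in its
description, so that its execution adds to the time at most polynomially.) -/
def QuantumSolves {α : Type} (M : Turing.TM2ComputableAux Sym Sym) (encode : α → List Sym)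
    (size : α → ℕ) (inst yes no : α → Prop) (T : ℕ → ℕ) : Prop :=
  ∀ a, inst a → ∃ D : QCircuit, D.WF ∧ D.numInputs = 0 ∧
    (∀ g ∈ D.gates, g.isElementary = true) ∧
    OutputsIn M (encode a) D.encode (T (size a)) ∧
    (yes a → 2 / 3 ≤ D.acceptProb fun _ => 1) ∧
    (no a → D.acceptProb (fun _ => 1) ≤ 1 / 3)

/-- `T(n) = 2^{o(n)}`. -/
def Subexponential (T : ℕ → ℕ) : Prop :=
  ∃ f : ℕ → ℝ, f =o[Filter.atTop] (fun n : ℕ => (n : ℝ)) ∧ ∀ n, (T n : ℝ) ≤ (2 : ℝ) ^ f n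

/-- There is a quantum algorithm running in time `2^{o(n)}` for the given promise problem. -/
def HasSubexpQuantumAlgorithm {α : Type} (encode : α → List Sym) (size : α → ℕ)
    (inst yes no : α → Prop) : Prop :=
  ∃ (M : Turing.TM2ComputableAux Sym Sym) (T : ℕ → ℕ), Subexponential T ∧
    QuantumSolves M encode size inst yes no T

/-- A function whose values are rational numbers with numerator and denominator computable in time
polynomial in `n`. -/
def PolyTimeFun (c : ℕ → ℝ) : Prop :=
  ∃ a b : ℕ → ℕ,
    Nonempty (Turing.TM2ComputableInPolyTime Computability.unaryEncodeNat
      Computability.encodeNat a) ∧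
    Nonempty (Turing.TM2ComputableInPolyTime Computability.unaryEncodeNat
      Computability.encodeNat b) ∧
    ∀ n, 0 < b n ∧ c n = (a n : ℝ) / (b n : ℝ)

/-! ## The hypotheses -/

/-- Quantum-Classical Exponential Time Hypothesis: no quantum algorithm running in time `2^{o(n)}`
decides satisfiability of weft-1 Boolean circuits of total description size `n`. -/
def QCETH : Prop :=
  ¬ HasSubexpQuantumAlgorithm BCircuit.encode BCircuit.size
    (fun C => C.WF ∧ C.weft ≤ 1)
    (fun C => C.Satisfiable)
    (fun C => ¬ C.Satisfiable)

/-- Quantum Exponential Time Hypothesis: for some completeness `c` and soundness `s` with an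
inverse polynomial gap (and some polynomial bound `q` on the number of ancilla qubits), no quantum
algorithm running in time `2^{o(n)}` decides for weft-1 quantum circuits of total description
size `n` whether some witness is accepted with probability at least `c n` or all witnesses are
accepted with probability at most `s n`. -/
def QETH : Prop :=
  ∃ c s : ℕ → ℝ, PolyTimeFun c ∧ PolyTimeFun s ∧
    (∀ n, c n ∈ Set.Icc (0 : ℝ) 1 ∧ s n ∈ Set.Icc (0 : ℝ) 1) ∧
    (∃ p : Polynomial ℕ, ∀ n, 0 < p.eval n ∧ 1 / ((p.eval n : ℕ) : ℝ) < c n - s n) ∧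
    ∃ q : Polynomial ℕ,
      ¬ HasSubexpQuantumAlgorithm QCircuit.encode QCircuit.size
        (fun Q => Q.WF ∧ Q.weft ≤ 1 ∧ Q.numAncilla ≤ q.eval Q.size)
        (fun Q => ∃ ψ, IsUnitState ψ ∧ c Q.size ≤ Q.acceptProb ψ)
        (fun Q => ∀ ψ, IsUnitState ψ → Q.acceptProb ψ ≤ s Q.size)

end

end WeftETH

/-! The proof is by contraposition: a Boolean circuit C is translated in polynomial time into a
quantum circuit that computes C on the computational basis, has linear size, polynomially many
ancillas and no larger weft. A subexponential algorithm for the quantum problem with completeness 1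
and soundness 0 then decides satisfiability of C.

The delicate point is the weft. A path in a quantum circuit may enter a gate at one control and
leave it at another, so two Toffoli gates sharing a control lie on a common path, although two
Boolean gates reading the same wire need not. Therefore no qubit is read by two gates of C. With n
inputs, m gates and W = n + m wires, qubit a + W * k is the place of wire a in block k: block 0
holds the value, block 1 its negation, and blocks 2(j+1) and 2(j+1)+1 hold a copy and a negated copy
reserved for gate j. Two classical fanouts produce all copies of a wire as soon as it is computed. A
fanout counts as one gate and ancillas are not counted, so the size stays linear while the number of
ancillas is quadratic. A large gate becomes one Toffoli gate (with De Morgan and the negated copies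
for OR); a gate of fan-in two must not use any, and is built from `X`, `H`, `T`, `CNOT` by a
conjunction that is correct up to a phase depending on the inputs.

Such phases are harmless. Each basis input is sent to a basis state times a unit scalar
(`WF.sends_toQ`). A satisfying assignment is thus a witness accepted with probability 1, and if
there is none, linearity makes every accepting amplitude of every witness vanish. Weft and
well-formedness are `weft_toQ_le` and `WF.toQ`.

The translation has to be carried out by a Turing machine placed in front of the given one. It is
written in a small structured language with a time-bounded semantics, compiled to stack machine code
(`Exec.runs`) and composed with the given machine (`outputsIn_prepend`); `exec_translate` and
`encode_toQ` say that it writes the intended circuit. The running time is a polynomial plus T at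
some argument at most 38 times the size of C. This is again 2^{o(n)}, because being 2^{o(n)} means
being O(b^n) for every b > 1. -/

namespace WeftETH

/-! ## A structured language for stack machines -/

/-- Stack contents; the head of a list is the top of the stack. -/
abbrev Stacks (K : Type) : Type := K → List Sym

/-- Instructions of a stack machine with jump targets `L`. -/
inductive Instr (K L : Type)
  | push (k : K) (a : Sym) (next : L)
  | pop (k : K) (next : Option Sym → L)

namespace Instr

variable {K L L' : Type}

/-- Rename the jump targets. -/
def map (f : L → L') : Instr K L → Instr K L'
  | push k a l => push k a (f l)
  | pop k next => pop k fun o => f (next o)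

/-- Execute an instruction. -/
def run [DecidableEq K] : Instr K L → Stacks K → L × Stacks K
  | push k a l, s => (l, Function.update s k (a :: s k))
  | pop k next, s => (next (s k).head?, Function.update s k (s k).tail)

theorem run_map [DecidableEq K] (f : L → L') (i : Instr K L) (s : Stacks K) :
    (i.map f).run s = (f (i.run s).1, (i.run s).2) := by
  cases i <;> rfl

end Instr

/-- `Runs c l s l' s' t`: the program `c` gets from label `l` and stacks `s` to label `l'` and
stacks `s'` in `t` steps; the label `none` is the exit. -/
inductive Runs {K L : Type} [DecidableEq K] (c : L → Instr K (Option L)) :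
    Option L → Stacks K → Option L → Stacks K → ℕ → Prop
  | refl (l s) : Runs c l s l s 0
  | step (l s) {l' s' t} : Runs c ((c l).run s).1 ((c l).run s).2 l' s' t →
      Runs c (some l) s l' s' (t + 1)

namespace Runs

variable {K L L' : Type} [DecidableEq K] {c : L → Instr K (Option L)}
  {c' : L' → Instr K (Option L')}

theorem trans {l₁ l₂ l₃ : Option L} {s₁ s₂ s₃ : Stacks K} {t₁ t₂ : ℕ}
    (h₁ : Runs c l₁ s₁ l₂ s₂ t₁) (h₂ : Runs c l₂ s₂ l₃ s₃ t₂) :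
    Runs c l₁ s₁ l₃ s₃ (t₁ + t₂) := by
  induction h₁ with
  | refl => simpa using h₂
  | step l s _ ih => rw [Nat.add_right_comm]; exact .step l s (ih h₂)

/-- The exit gets no special treatment: `f none` may be any label, so the lemma also redirects a
finished subprogram to its continuation. -/
theorem lift (f : Option L → Option L') (g : L → L') (hf : ∀ l, f (some l) = some (g l))
    (hc : ∀ l, c' (g l) = (c l).map f) {l₁ l₂ : Option L} {s₁ s₂ : Stacks K} {t : ℕ}
    (h : Runs c l₁ s₁ l₂ s₂ t) : Runs c' (f l₁) s₁ (f l₂) s₂ t := by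
  induction h with
  | refl => exact .refl _ _
  | step l s _ ih =>
    rw [hf]
    refine .step _ _ ?_
    rw [hc, Instr.run_map]
    exact ih

end Runs

/-- Structured programs: `sw k again body` pops stack `k` and executes `body o` for the symbol
`o` found; then it starts again if `again o`. -/
inductive Prog (K : Type)
  | skip
  | push (k : K) (a : Sym)
  | seq (p q : Prog K)
  | sw (k : K) (again : Option Sym → Bool) (body : Option Sym → Prog K)

/-- `Exec p s s' t`: the program `p` turns the stacks `s` into `s'` in at most `t` steps. -/
inductive Exec {K : Type} [DecidableEq K] : Prog K → Stacks K → Stacks K → ℕ → Prop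
  | skip (s) : Exec .skip s s 0
  | push (k a s) : Exec (.push k a) s (Function.update s k (a :: s k)) 1
  | seq {p q s₁ s₂ s₃ t₁ t₂} : Exec p s₁ s₂ t₁ → Exec q s₂ s₃ t₂ →
      Exec (.seq p q) s₁ s₃ (t₁ + t₂)
  | done {k again body s s' t} : again (s k).head? = false →
      Exec (body (s k).head?) (Function.update s k (s k).tail) s' t →
      Exec (.sw k again body) s s' (t + 1)
  | again {k again body s s₁ s' t t'} : again (s k).head? = true →
      Exec (body (s k).head?) (Function.update s k (s k).tail) s₁ t →
      Exec (.sw k again body) s₁ s' t' →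
      Exec (.sw k again body) s s' (t + t' + 1)
  | mono {p s s' t t'} : Exec p s s' t → t ≤ t' → Exec p s s' t'

namespace Prog

variable {K : Type}

/-- The labels of the machine for a program. -/
def Label : Prog K → Type
  | skip => Empty
  | push _ _ => Unit
  | seq p q => p.Label ⊕ q.Label
  | sw _ _ body => Option (Σ o, (body o).Label)

noncomputable instance fintypeLabel : (p : Prog K) → Fintype p.Label
  | skip => inferInstanceAs (Fintype Empty)
  | push _ _ => inferInstanceAs (Fintype Unit)
  | seq p q =>
    haveI := fintypeLabel p
    haveI := fintypeLabel q
    inferInstanceAs (Fintype (p.Label ⊕ q.Label))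
  | sw _ _ body =>
    haveI := fun o => fintypeLabel (body o)
    inferInstanceAs (Fintype (Option (Σ o, (body o).Label)))

/-- Where the machine for `p` starts. -/
def entry : (p : Prog K) → Option p.Label
  | skip => none
  | push _ _ => some ()
  | seq p q => (p.entry).elim (q.entry.map Sum.inr) (fun l => some (Sum.inl l))
  | sw _ _ _ => some none

/-- The machine for a program. -/
def code : (p : Prog K) → p.Label → Instr K (Option p.Label)
  | skip => fun l => l.elim
  | push k a => fun _ => .push k a none
  | seq p q => fun l =>
    match l with
    | Sum.inl l => (p.code l).map
        fun x => x.elim (q.entry.map Sum.inr) (fun l => some (Sum.inl l))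
    | Sum.inr l => (q.code l).map fun x => x.elim none (fun l => some (Sum.inr l))
  | sw k again body => fun l =>
    match l with
    | none => .pop k fun o => (body o).entry.elim
        (if again o then some none else none) (fun l => some (some ⟨o, l⟩))
    | some ⟨o, l⟩ => ((body o).code l).map fun x => x.elim
        (if again o then some none else none) (fun l => some (some ⟨o, l⟩))

theorem run_code_sw [DecidableEq K] (k : K) (again : Option Sym → Bool)
    (body : Option Sym → Prog K) (s : Stacks K) :
    ((sw k again body).code none).run s = ((body (s k).head?).entry.elim
      (if again (s k).head? then some none else none) (fun l => some (some ⟨(s k).head?, l⟩)),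
      Function.update s k (s k).tail) := by
  simp only [code, Instr.run]
  rfl

end Prog

/-- The code of a subprogram embeds into the larger code by `Runs.lift`, with its exit sent to the
entry of what follows. A subprogram without instructions has entry `none`, and control passes
straight on. The exact number of steps is existential because `Exec` records only upper bounds. -/
theorem Exec.runs {K : Type} [DecidableEq K] {p : Prog K} {s s' : Stacks K} {t : ℕ}
    (h : Exec p s s' t) : ∃ n ≤ t, Runs p.code p.entry s none s' n := by
  induction h with
  | skip s => exact ⟨0, le_rfl, .refl _ _⟩
  | push k a s => exact ⟨1, le_rfl, .step (c := (Prog.push k a).code) () s (.refl _ _)⟩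
  | @seq p q s₁ s₂ s₃ t₁ t₂ _ _ ih₁ ih₂ =>
    obtain ⟨n₁, hn₁, h₁⟩ := ih₁
    obtain ⟨n₂, hn₂, h₂⟩ := ih₂
    refine ⟨n₁ + n₂, add_le_add hn₁ hn₂, ?_⟩
    have e₁ := h₁.lift (c' := (Prog.seq p q).code)
      (fun x => x.elim (q.entry.map Sum.inr) (fun l => some (Sum.inl l))) Sum.inl
      (fun _ => rfl) (fun _ => rfl)
    have e₂ := h₂.lift (c' := (Prog.seq p q).code)
      (fun x => x.elim none (fun l => some (Sum.inr l))) Sum.inr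
      (fun _ => rfl) (fun _ => rfl)
    refine e₁.trans ?_
    convert e₂ using 1
    · simp only [Option.elim]
      cases q.entry <;> rfl
    · rfl
  | @done k again body s s' t ha _ ih =>
    obtain ⟨n, hn, h⟩ := ih
    refine ⟨n + 1, by omega, .step (c := (Prog.sw k again body).code) none s ?_⟩
    have e := h.lift (c' := (Prog.sw k again body).code)
      (fun x => x.elim (if again (s k).head? then some none else none)
        (fun l => some (some ⟨(s k).head?, l⟩))) (fun l => some ⟨_, l⟩)
      (fun _ => rfl) (fun _ => by simp only [Prog.code])
    rw [Prog.run_code_sw]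
    rw [ha] at e ⊢
    exact e
  | @again k again body s s₁ s' t t' ha _ _ ih ih' =>
    obtain ⟨n, hn, h⟩ := ih
    obtain ⟨n', hn', h'⟩ := ih'
    refine ⟨n + n' + 1, by omega, .step (c := (Prog.sw k again body).code) none s ?_⟩
    have e := h.lift (c' := (Prog.sw k again body).code)
      (fun x => x.elim (if again (s k).head? then some none else none)
        (fun l => some (some ⟨(s k).head?, l⟩))) (fun l => some ⟨_, l⟩)
      (fun _ => rfl) (fun _ => by simp only [Prog.code])
    rw [Prog.run_code_sw]
    rw [ha] at e ⊢
    exact e.trans h'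
  | mono _ hle ih =>
    obtain ⟨n, hn, h⟩ := ih
    exact ⟨n, hn.trans hle, h⟩

/-! ## Running a structured program in front of a Turing machine -/

section Prepend

open Turing

variable {K : Type}

/-- The stack alphabets of a combined machine. -/
abbrev sumAlphabet (K : Type) (M : FinTM2) : K ⊕ M.K → Type
  | .inl _ => Sym
  | .inr k => M.Γ k

/-- Let a statement of the second machine act within the combined machine. -/
def liftStmt (K A : Type) (M : FinTM2) : TM2.Stmt M.Γ M.Λ M.σ →
    TM2.Stmt (sumAlphabet K M) (A ⊕ M.Λ) (Option Sym × M.σ)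
  | .push k f q => .push (Sum.inr k) (fun v => f v.2) (liftStmt K A M q)
  | .peek k f q => .peek (Sum.inr k) (fun v o => (v.1, f v.2 o)) (liftStmt K A M q)
  | .pop k f q => .pop (Sum.inr k) (fun v o => (v.1, f v.2 o)) (liftStmt K A M q)
  | .load f q => .load (fun v => (v.1, f v.2)) (liftStmt K A M q)
  | .branch f q₁ q₂ => .branch (fun v => f v.2) (liftStmt K A M q₁) (liftStmt K A M q₂)
  | .goto f => .goto fun v => Sum.inr (f v.2)
  | .halt => .halt

/-- Let an instruction act within the combined machine. -/
def liftInstr (M : FinTM2) {A : Type} : Instr K A →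
    TM2.Stmt (sumAlphabet K M) (A ⊕ M.Λ) (Option Sym × M.σ)
  | .push k a l => .push (Sum.inl k) (fun _ => a) (.goto fun _ => Sum.inl l)
  | .pop k next => .pop (Sum.inl k) (fun v o => (o, v.2)) (.goto fun v => Sum.inl (next v.1))

/-- Move a symbol from stack `out` to the input stack of `M`, which is started in the end. -/
def transferStmt (A : Type) (out : K) (M : TM2ComputableAux Sym Sym) :
    TM2.Stmt (sumAlphabet K M.tm) (Option A ⊕ M.tm.Λ) (Option Sym × M.tm.σ) :=
  .pop (Sum.inl out) (fun v o => (o, v.2)) <|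
    .branch (fun v => v.1.isSome)
      (.push (Sum.inr M.tm.k₀) (fun v => M.inputAlphabet.symm (v.1.getD Sym.tick))
        (.goto fun _ => Sum.inl none))
      (.goto fun _ => Sum.inr M.tm.main)

/-- The machine that executes `p`, moves the contents of stack `out` to the input stack of `M` and
then behaves like `M`. -/
noncomputable def prepend [DecidableEq K] [Fintype K] (p : Prog K) (inp out : K)
    (M : TM2ComputableAux Sym Sym) : FinTM2 where
  K := K ⊕ M.tm.K
  kDecidableEq := inferInstance
  kFin := haveI := M.tm.kFin; inferInstance
  k₀ := Sum.inl inp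
  k₁ := Sum.inr M.tm.k₁
  Γ := sumAlphabet K M.tm
  Λ := Option p.Label ⊕ M.tm.Λ
  main := Sum.inl p.entry
  ΛFin := haveI := M.tm.ΛFin; inferInstance
  σ := Option Sym × M.tm.σ
  initialState := (none, M.tm.initialState)
  σFin := haveI := M.tm.σFin; inferInstance
  Γk₀Fin := inferInstanceAs (Fintype Sym)
  m
    | .inl (some l) => liftInstr M.tm (p.code l)
    | .inl none => transferStmt p.Label out M
    | .inr l => liftStmt K (Option p.Label) M.tm (M.tm.m l)

/-- Stacks of the combined machine. -/
def sumStacks (M : FinTM2) (s : Stacks K) (S : ∀ k, List (M.Γ k)) :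
    ∀ k, List (sumAlphabet K M k)
  | .inl k => s k
  | .inr k => S k

theorem sumStacks_nil (M : FinTM2) :
    sumStacks M (fun _ : K => []) (fun _ => []) = fun _ => [] := by
  funext k; cases k <;> rfl

variable [DecidableEq K]

theorem update_sumStacks_inl (M : FinTM2) (s : Stacks K) (S : ∀ k, List (M.Γ k)) (k : K)
    (l : List Sym) : Function.update (sumStacks M s S) (Sum.inl k) l =
      sumStacks M (Function.update s k l) S := by
  funext k'
  rcases k' with k' | k'
  · by_cases h : k' = k
    · subst h; simp [sumStacks]
    · rw [Function.update_of_ne (by simpa using h)]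
      simp [sumStacks, h]
  · rw [Function.update_of_ne (by simp)]; rfl

theorem update_sumStacks_inr (M : FinTM2) (s : Stacks K) (S : ∀ k, List (M.Γ k)) (k : M.K)
    (l : List (M.Γ k)) : Function.update (sumStacks M s S) (Sum.inr k) l =
      sumStacks M s (Function.update S k l) := by
  funext k'
  rcases k' with k' | k'
  · rw [Function.update_of_ne (by simp)]; rfl
  · by_cases h : k' = k
    · subst h; simp [sumStacks]
    · rw [Function.update_of_ne (by simpa using h)]
      simp [sumStacks, h]

/-- A configuration of the second machine within the combined machine. -/
def liftCfg (A : Type) (M : FinTM2) (s : Stacks K) (v : Option Sym)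
    (c : TM2.Cfg M.Γ M.Λ M.σ) : TM2.Cfg (sumAlphabet K M) (A ⊕ M.Λ) (Option Sym × M.σ) :=
  ⟨c.l.map Sum.inr, (v, c.var), sumStacks M s c.stk⟩

theorem stepAux_liftStmt (A : Type) (M : FinTM2) (s : Stacks K) (v : Option Sym)
    (q : TM2.Stmt M.Γ M.Λ M.σ) : ∀ (x : M.σ) (S : ∀ k, List (M.Γ k)),
    TM2.stepAux (liftStmt K A M q) (v, x) (sumStacks M s S) =
      liftCfg A M s v (TM2.stepAux q x S) := by
  induction q with
  | push k f q ih =>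
    intro x S
    simp only [liftStmt, TM2.stepAux, update_sumStacks_inr, ← ih]
    rfl
  | peek k f q ih =>
    intro x S
    simp only [liftStmt, TM2.stepAux, ← ih]
    rfl
  | pop k f q ih =>
    intro x S
    simp only [liftStmt, TM2.stepAux, update_sumStacks_inr, ← ih]
    rfl
  | load f q ih => intro x S; simp only [liftStmt, TM2.stepAux, ← ih]
  | branch f q₁ q₂ ih₁ ih₂ =>
    intro x S
    simp only [liftStmt, TM2.stepAux]
    cases f x
    · exact ih₂ x S
    · exact ih₁ x S
  | goto f => intro x S; rfl
  | halt => intro x S; rfl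

variable [Fintype K] (p : Prog K) (inp out : K) (M : TM2ComputableAux Sym Sym)

/-- Iterated steps. -/
def StepsTo (tm : FinTM2) (n : ℕ) (a b : tm.Cfg) : Prop :=
  (_root_.flip bind tm.step)^[n] (some a) = some b

theorem StepsTo.refl {tm : FinTM2} (a : tm.Cfg) : StepsTo tm 0 a a := rfl

theorem StepsTo.trans {tm : FinTM2} {m n : ℕ} {a b c : tm.Cfg} (h : StepsTo tm m a b)
    (h' : StepsTo tm n b c) : StepsTo tm (m + n) a c := by
  unfold StepsTo at *
  rw [Nat.add_comm, Function.iterate_add_apply, h, h']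

theorem StepsTo.head {tm : FinTM2} {n : ℕ} {a b c : tm.Cfg} (h : tm.step a = some b)
    (h' : StepsTo tm n b c) : StepsTo tm (n + 1) a c := by
  unfold StepsTo at *
  rw [Function.iterate_succ_apply]
  have e : _root_.flip bind tm.step (some a) = some b := h
  rw [e]
  exact h'

theorem iterate_none {α : Type} (f : α → Option α) (n : ℕ) :
    (_root_.flip bind f)^[n] none = none := by
  induction n with
  | zero => rfl
  | succ n ih => rw [Function.iterate_succ_apply]; exact ih

theorem step_liftCfg (s : Stacks K) (v : Option Sym) (c : M.tm.Cfg) :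
    (prepend p inp out M).step (liftCfg (Option p.Label) M.tm s v c) =
      (M.tm.step c).map (liftCfg (Option p.Label) M.tm s v) := by
  obtain ⟨l, x, S⟩ := c
  cases l with
  | none => rfl
  | some l => exact congrArg some (stepAux_liftStmt _ _ _ _ _ _ _)

theorem StepsTo.liftCfg (s : Stacks K) (v : Option Sym) {n : ℕ} : ∀ {a b : M.tm.Cfg},
    StepsTo M.tm n a b → StepsTo (prepend p inp out M) n
      (WeftETH.liftCfg (Option p.Label) M.tm s v a)
      (WeftETH.liftCfg (Option p.Label) M.tm s v b) := by
  induction n with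
  | zero =>
    intro a b h
    have : a = b := Option.some.inj (show some a = some b from h)
    subst this
    exact StepsTo.refl _
  | succ n ih =>
    intro a b h
    unfold StepsTo at h
    rw [Function.iterate_succ_apply] at h
    cases hs : M.tm.step a with
    | none =>
      have : _root_.flip bind M.tm.step (some a) = none := hs
      rw [this, iterate_none] at h
      cases h
    | some a' =>
      have : _root_.flip bind M.tm.step (some a) = some a' := hs
      rw [this] at h
      refine StepsTo.head (tm := prepend p inp out M)
        (b := WeftETH.liftCfg (Option p.Label) M.tm s v a') ?_ (ih h)
      rw [step_liftCfg, hs]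
      rfl

/-- Every pop overwrites the scratch symbol held in the finite state, so its final value is left
unspecified. -/
theorem Runs.stepsTo {l l' : Option p.Label} {s s' : Stacks K} {t : ℕ}
    (h : Runs p.code l s l' s' t) (x : M.tm.σ) (S : ∀ k, List (M.tm.Γ k)) (v : Option Sym) :
    ∃ v', StepsTo (prepend p inp out M) t
      ⟨some (Sum.inl l), (v, x), sumStacks M.tm s S⟩
      ⟨some (Sum.inl l'), (v', x), sumStacks M.tm s' S⟩ := by
  induction h generalizing v with
  | refl => exact ⟨v, StepsTo.refl _⟩
  | step l s _ ih =>
    cases hc : p.code l with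
    | push k a l' =>
      obtain ⟨v', h'⟩ := ih v
      refine ⟨v', .head ?_ h'⟩
      change some (TM2.stepAux (liftInstr M.tm (p.code l)) _ _) = _
      rw [hc]
      simp only [liftInstr, TM2.stepAux, update_sumStacks_inl, Instr.run]
      rfl
    | pop k next =>
      obtain ⟨v', h'⟩ := ih ((s k).head?)
      refine ⟨v', .head ?_ h'⟩
      change some (TM2.stepAux (liftInstr M.tm (p.code l)) _ _) = _
      rw [hc]
      simp only [liftInstr, TM2.stepAux, update_sumStacks_inl, Instr.run]
      rfl

/-- Moving symbols one by one reverses the stack. The last pop finds the stack empty and so resets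
the scratch symbol to `none`, as the final halting configuration requires. -/
theorem stepsTo_transfer (x : M.tm.σ) (w : List Sym) : ∀ (s : Stacks K)
    (S : ∀ k, List (M.tm.Γ k)) (v : Option Sym), s out = w →
    StepsTo (prepend p inp out M) (w.length + 1)
      ⟨some (Sum.inl none), (v, x), sumStacks M.tm s S⟩
      ⟨some (Sum.inr M.tm.main), (none, x), sumStacks M.tm (Function.update s out [])
        (Function.update S M.tm.k₀ ((w.map M.inputAlphabet.symm).reverse ++ S M.tm.k₀))⟩ := by
  induction w with
  | nil =>
    intro s S v hs
    refine StepsTo.head ?_ (StepsTo.refl _)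
    change some (TM2.stepAux (transferStmt p.Label out M) (v, x) (sumStacks M.tm s S)) = _
    simp only [transferStmt, TM2.stepAux, update_sumStacks_inl]
    have e : sumStacks M.tm s S (Sum.inl out) = [] := hs
    simp only [e, List.head?_nil, List.tail_nil, Option.isSome_none, cond_false]
    simp only [List.map_nil, List.reverse_nil, List.nil_append, Function.update_eq_self]
    rfl
  | cons a w ih =>
    intro s S v hs
    have := ih (Function.update s out w)
      (Function.update S M.tm.k₀ (M.inputAlphabet.symm a :: S M.tm.k₀)) (some a) (by simp)
    simp only [Function.update_idem, Function.update_self] at this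
    refine StepsTo.head ?_ (by simpa using this)
    change some (TM2.stepAux (transferStmt p.Label out M) (v, x) (sumStacks M.tm s S)) = _
    simp only [transferStmt, TM2.stepAux, update_sumStacks_inl]
    have e : sumStacks M.tm s S (Sum.inl out) = a :: w := hs
    simp only [e, List.head?_cons, List.tail_cons, Option.isSome_some, cond_true,
      Option.getD_some, update_sumStacks_inr]
    rfl

/-- The combined machine as a machine from words to words. -/
noncomputable def prependAux : TM2ComputableAux Sym Sym where
  tm := prepend p inp out M
  inputAlphabet := Equiv.refl Sym
  outputAlphabet := M.outputAlphabet

theorem initList_stk (tm : FinTM2) (w : List (tm.Γ tm.k₀)) :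
    (initList tm w).stk = Function.update (fun _ => []) tm.k₀ w := by
  funext k
  by_cases h : k = tm.k₀
  · subst h; simp [initList]
  · simp [initList, h]

theorem haltList_stk (tm : FinTM2) (w : List (tm.Γ tm.k₁)) :
    (haltList tm w).stk = Function.update (fun _ => []) tm.k₁ w := by
  funext k
  by_cases h : k = tm.k₁
  · subst h; simp [haltList]
  · simp [haltList, h]

/-- A halting configuration must have the initial internal state and empty stacks except for the
output. Hence `p` has to leave nothing but its result on `out`; the transfer empties `out` and
resets the scratch symbol, and `M` touches neither afterwards. The result is assumed reversed on
`out`, so that the transfer delivers `w` the right way round. -/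
theorem outputsIn_prepend {u w v : List Sym} {t T : ℕ}
    (hp : Exec p (Function.update (fun _ => []) inp u)
      (Function.update (fun _ => []) out w.reverse) t)
    (hM : OutputsIn M w v T) :
    OutputsIn (prependAux p inp out M) u v (t + w.length + 1 + T) := by
  obtain ⟨n, hn, hr⟩ := hp.runs
  obtain ⟨⟨⟨k, hk⟩, hkT⟩⟩ := hM
  obtain ⟨v', h₁⟩ := Runs.stepsTo p inp out M hr M.tm.initialState (fun _ => []) none
  have h₂ := stepsTo_transfer p inp out M M.tm.initialState w.reverse
    (Function.update (fun _ => []) out w.reverse) (fun _ => []) v' (by simp)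
  have h₃ := StepsTo.liftCfg p inp out M (fun _ => []) none
    (show StepsTo M.tm k _ (haltList M.tm (v.map M.outputAlphabet.symm)) from hk)
  have e₁ : initList (prepend p inp out M) u =
      ⟨some (Sum.inl p.entry), (none, M.tm.initialState),
        sumStacks M.tm (Function.update (fun _ => []) inp u) (fun _ => [])⟩ := by
    have : (initList (prepend p inp out M) u).stk =
        sumStacks M.tm (Function.update (fun _ => []) inp u) (fun _ => []) := by
      rw [← update_sumStacks_inl, sumStacks_nil]
      exact initList_stk (prepend p inp out M) u
    rw [← this]
    rfl
  have e₂ : WeftETH.liftCfg (Option p.Label) M.tm (fun _ : K => []) none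
      (haltList M.tm (v.map M.outputAlphabet.symm)) =
      haltList (prepend p inp out M) (v.map M.outputAlphabet.symm) := by
    have : (haltList (prepend p inp out M) (v.map M.outputAlphabet.symm)).stk =
        sumStacks M.tm (fun _ => []) (haltList M.tm (v.map M.outputAlphabet.symm)).stk := by
      rw [haltList_stk, haltList_stk, ← update_sumStacks_inr, sumStacks_nil]
      rfl
    unfold WeftETH.liftCfg
    rw [← this]
    rfl
  have e₃ : WeftETH.liftCfg (Option p.Label) M.tm (fun _ : K => []) none
      (initList M.tm (w.map M.inputAlphabet.symm)) =
      ⟨some (Sum.inr M.tm.main), (none, M.tm.initialState), sumStacks M.tm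
        (Function.update (Function.update (fun _ => []) out w.reverse) out [])
        (Function.update (fun _ => []) M.tm.k₀
          ((w.reverse.map M.inputAlphabet.symm).reverse ++ []))⟩ := by
    unfold WeftETH.liftCfg
    rw [initList_stk]
    simp [initList]
  rw [e₂, e₃] at h₃
  have h := (h₁.trans h₂).trans h₃
  refine ⟨⟨⟨n + (w.reverse.length + 1) + k, ?_⟩, ?_⟩⟩
  · change _ = some (haltList (prepend p inp out M) (v.map M.outputAlphabet.symm))
    rw [← h]
    -- The input alphabet of the combined machine is `Sym` itself, so the input word is mapped by
    -- the identity.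
    exact congrArg _ ((congrArg (fun z => some (initList (prepend p inp out M) z))
      (List.map_id u)).trans (congrArg some e₁))
  · simp only [List.length_reverse]
    change k ≤ T at hkT
    omega

end Prepend

/-! ## Register programs -/

/-- Registers, which hold numbers in unary notation. -/
inductive Reg
  | n | W | w | off | u | v | m | cnt | acc
  deriving DecidableEq

instance : Fintype Reg :=
  ⟨{.n, .W, .w, .off, .u, .v, .m, .cnt, .acc}, fun x => by cases x <;> simp⟩

/-- The stacks of the translating machine. -/
inductive Stk
  | inp | out | tmp
  | reg (r : Reg)
  deriving DecidableEq, Fintype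

/-- The stacks when `i` remains to be read, `o` has been written and the registers hold `R`. -/
def st (i o : List Sym) (R : Reg → ℕ) : Stacks Stk
  | .inp => i
  | .out => o.reverse
  | .tmp => []
  | .reg r => List.replicate (R r) Sym.tick

/-- While stack `k` is nonempty, pop a symbol `a` and execute `body a`. -/
def drain (k : Stk) (body : Sym → Prog Stk) : Prog Stk :=
  .sw k Option.isSome fun o => o.elim .skip body

theorem exec_drain_nil {k : Stk} {body : Sym → Prog Stk} {s : Stacks Stk} (h : s k = []) :
    Exec (drain k body) s s 1 := by
  refine Exec.done (t := 0) (by simp [h]) ?_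
  have : Function.update s k (s k).tail = s := by rw [h, List.tail_nil, ← h]; simp
  rw [this, h]
  exact .skip s

theorem exec_drain_cons {k : Stk} {body : Sym → Prog Stk} {s s₁ s' : Stacks Stk} {a : Sym}
    {l : List Sym} {t t' : ℕ} (h : s k = a :: l) (h₁ : Exec (body a) (Function.update s k l) s₁ t)
    (h₂ : Exec (drain k body) s₁ s' t') : Exec (drain k body) s s' (t + t' + 1) := by
  refine Exec.again (s₁ := s₁) (by simp [h]) ?_ h₂
  rw [h]
  exact h₁

theorem update_st_inp (i o : List Sym) (R : Reg → ℕ) (l : List Sym) :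
    Function.update (st i o R) .inp l = st l o R := by
  funext k; cases k <;> simp [st]

theorem update_st_out (i o : List Sym) (R : Reg → ℕ) (l : List Sym) :
    Function.update (st i o R) .out l = st i l.reverse R := by
  funext k; cases k <;> simp [st]

theorem update_st_reg (i o : List Sym) (R : Reg → ℕ) (r : Reg) (x : ℕ) :
    Function.update (st i o R) (.reg r) (List.replicate x Sym.tick) =
      st i o (Function.update R r x) := by
  funext k
  rcases k with _ | _ | _ | r'
  · simp [st]
  · simp [st]
  · simp [st]
  · by_cases h : r' = r
    · subst h; simp [st]
    · simp [st, h]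

theorem exec_emit (i o : List Sym) (R : Reg → ℕ) (a : Sym) :
    Exec (.push .out a) (st i o R) (st i (o ++ [a]) R) 1 := by
  convert Exec.push Stk.out a (st i o R) using 1
  rw [update_st_out]
  simp [st]

theorem exec_incr (i o : List Sym) (R : Reg → ℕ) (r : Reg) :
    Exec (.push (.reg r) Sym.tick) (st i o R) (st i o (Function.update R r (R r + 1))) 1 := by
  convert Exec.push (Stk.reg r) Sym.tick (st i o R) using 1
  rw [← update_st_reg]
  simp [st, List.replicate_succ]

/-- Put as many ticks on stack `k` as there are in register `r`. -/
def copy (r : Reg) (k : Stk) : Prog Stk :=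
  .seq (drain (.reg r) fun _ => .seq (.push k .tick) (.push .tmp .tick))
    (drain .tmp fun _ => .push (.reg r) .tick)

/-- Arbitrary stacks are allowed because `tmp` is nonempty during the loop, so the intermediate
contents are not of the form `st`. -/
theorem exec_copy_fst {r : Reg} {k : Stk} (hk : k ≠ .reg r) (hk' : k ≠ .tmp) (x : ℕ) :
    ∀ s : Stacks Stk, s (.reg r) = List.replicate x Sym.tick →
    Exec (drain (.reg r) fun _ => .seq (.push k .tick) (.push .tmp .tick)) s
      (Function.update (Function.update (Function.update s (.reg r) [])
        k (List.replicate x Sym.tick ++ s k)) .tmp (List.replicate x Sym.tick ++ s .tmp))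
      (3 * x + 1) := by
  induction x with
  | zero =>
    intro s hs
    convert exec_drain_nil hs using 1
    simp only [List.replicate_zero] at hs
    rw [← hs]
    simp
  | succ x ih =>
    intro s hs
    have e := exec_drain_cons (k := .reg r)
      (body := fun _ => .seq (.push k .tick) (.push .tmp .tick)) hs
      (Exec.seq (Exec.push k Sym.tick _) (Exec.push Stk.tmp Sym.tick _)) (ih _ (by simp [Ne.symm hk]))
    refine Exec.mono (t := 1 + 1 + (3 * x + 1) + 1) ?_ (by omega)
    -- The tick pushed first ends up below the remaining `x` ones, so one tick has to be split off
    -- at the far end.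
    have hr := List.replicate_succ' (a := Sym.tick) (n := x)
    convert e using 1
    funext k'
    by_cases h₁ : k' = Stk.tmp
    · subst h₁; simp [hr, Ne.symm hk']
    by_cases h₂ : k' = k
    · subst h₂; simp [hr, h₁, hk]
    by_cases h₃ : k' = Stk.reg r
    · subst h₃; simp [Ne.symm hk]
    · simp [h₁, h₂, h₃]

theorem exec_copy_snd {r : Reg} (x : ℕ) :
    ∀ s : Stacks Stk, s .tmp = List.replicate x Sym.tick →
    Exec (drain .tmp fun _ => .push (.reg r) .tick) s
      (Function.update (Function.update s (.reg r) (List.replicate x Sym.tick ++ s (.reg r)))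
        .tmp []) (2 * x + 1) := by
  induction x with
  | zero =>
    intro s hs
    convert exec_drain_nil hs using 1
    simp only [List.replicate_zero] at hs
    rw [← hs]
    simp
  | succ x ih =>
    intro s hs
    have e := exec_drain_cons (k := .tmp) (body := fun _ => .push (.reg r) .tick) hs
      (Exec.push (Stk.reg r) Sym.tick _) (ih _ (by simp))
    refine Exec.mono (t := 1 + (2 * x + 1) + 1) ?_ (by omega)
    have hr := List.replicate_succ' (a := Sym.tick) (n := x)
    convert e using 1
    funext k'
    by_cases h₁ : k' = Stk.tmp
    · subst h₁; simp
    by_cases h₃ : k' = Stk.reg r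
    · subst h₃; simp [hr]
    · simp [h₁, h₃]

/-- Each tick costs three steps on the way to `tmp` and two on the way back; each loop ends with one
more pop. -/
theorem exec_copy {r : Reg} {k : Stk} (hk : k ≠ .reg r) (hk' : k ≠ .tmp) (i o : List Sym)
    (R : Reg → ℕ) :
    Exec (copy r k) (st i o R) (Function.update (st i o R) k
      (List.replicate (R r) Sym.tick ++ st i o R k)) (5 * R r + 2) := by
  have e₁ := exec_copy_fst hk hk' (R r) (st i o R) rfl
  have e₂ := exec_copy_snd (r := r) (R r) _
    (show (Function.update (Function.update (Function.update (st i o R) (.reg r) [])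
        k (List.replicate (R r) Sym.tick ++ st i o R k)) .tmp
        (List.replicate (R r) Sym.tick ++ st i o R .tmp)) .tmp = _ by simp [st])
  refine (Exec.mono (t := 3 * R r + 1 + (2 * R r + 1)) ?_ (by omega))
  unfold copy
  convert Exec.seq e₁ e₂ using 1
  funext k'
  by_cases h₁ : k' = Stk.tmp
  · subst h₁; simp [Ne.symm hk', st]
  by_cases h₂ : k' = k
  · subst h₂; simp [h₁, hk]
  by_cases h₃ : k' = Stk.reg r
  · subst h₃; simp [Ne.symm hk, st]
  · simp [h₁, h₂, h₃]

/-- Elementary commands on output and registers. -/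
inductive Cmd
  | emit (a : Sym)
  | put (r : Reg)
  | add (r r' : Reg)
  | incr (r : Reg)
  | clear (r : Reg)

namespace Cmd

/-- The program for a command. -/
def prog : Cmd → Prog Stk
  | emit a => .push .out a
  | put r => copy r .out
  | add r r' => copy r (.reg r')
  | incr r => .push (.reg r) .tick
  | clear r => drain (.reg r) fun _ => .skip

/-- The source and the target of an addition are different. -/
def Valid : Cmd → Prop
  | add r r' => r ≠ r'
  | _ => True

/-- The word written by a command. -/
def word (R : Reg → ℕ) : Cmd → List Sym
  | emit a => [a]
  | put r => List.replicate (R r) Sym.tick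
  | _ => []

/-- The registers after a command. -/
def regs (R : Reg → ℕ) : Cmd → Reg → ℕ
  | add r r' => Function.update R r' (R r' + R r)
  | incr r => Function.update R r (R r + 1)
  | clear r => Function.update R r 0
  | _ => R

/-- A time bound for a command. -/
def cost (R : Reg → ℕ) : Cmd → ℕ
  | emit _ => 1
  | put r => 5 * R r + 2
  | add r _ => 5 * R r + 2
  | incr _ => 1
  | clear r => R r + 1

end Cmd

theorem exec_clear (r : Reg) (x : ℕ) : ∀ s : Stacks Stk, s (.reg r) = List.replicate x Sym.tick →
    Exec (drain (.reg r) fun _ => .skip) s (Function.update s (.reg r) []) (x + 1) := by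
  induction x with
  | zero =>
    intro s hs
    convert exec_drain_nil hs using 1
    rw [show ([] : List Sym) = s (.reg r) from hs.symm]
    simp
  | succ x ih =>
    intro s hs
    have e := exec_drain_cons (k := .reg r) (body := fun _ => .skip) hs (.skip _)
      (ih _ (by simp))
    refine Exec.mono (t := 0 + (x + 1) + 1) ?_ (by omega)
    simpa using e

theorem Cmd.exec {c : Cmd} (hc : c.Valid) (i o : List Sym) (R : Reg → ℕ) :
    Exec c.prog (st i o R) (st i (o ++ c.word R) (c.regs R)) (c.cost R) := by
  cases c with
  | emit a => exact exec_emit i o R a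
  | put r =>
    rw [prog, cost]
    convert exec_copy (r := r) (k := .out) (by simp) (by simp) i o R using 1
    rw [update_st_out]
    simp [st, word, regs]
  | add r r' =>
    rw [prog, cost]
    convert exec_copy (r := r) (k := .reg r') (by simpa using Ne.symm hc) (by simp) i o R using 1
    simp only [st, List.replicate_append_replicate]
    rw [update_st_reg]
    simp [word, regs, Nat.add_comm]
  | incr r =>
    rw [prog, cost]
    convert exec_incr i o R r using 1
    simp [word, regs]
  | clear r =>
    rw [prog, cost]
    convert exec_clear r (R r) (st i o R) rfl using 1
    rw [← List.replicate_zero (a := Sym.tick), update_st_reg]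
    simp [word, regs]

/-- Execute a list of commands. -/
def cmds : List Cmd → Prog Stk
  | [] => .skip
  | c :: cs => .seq c.prog (cmds cs)

/-- The word written by a list of commands. -/
def cmdsWord (R : Reg → ℕ) : List Cmd → List Sym
  | [] => []
  | c :: cs => c.word R ++ cmdsWord (c.regs R) cs

/-- The registers after a list of commands. -/
def cmdsRegs (R : Reg → ℕ) : List Cmd → Reg → ℕ
  | [] => R
  | c :: cs => cmdsRegs (c.regs R) cs

/-- A time bound for a list of commands. -/
def cmdsCost (R : Reg → ℕ) : List Cmd → ℕ
  | [] => 0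
  | c :: cs => c.cost R + cmdsCost (c.regs R) cs

theorem exec_cmds {cs : List Cmd} (h : ∀ c ∈ cs, c.Valid) : ∀ (i o : List Sym) (R : Reg → ℕ),
    Exec (cmds cs) (st i o R) (st i (o ++ cmdsWord R cs) (cmdsRegs R cs)) (cmdsCost R cs) := by
  induction cs with
  | nil =>
    intro i o R
    simpa [cmdsWord, cmdsRegs, cmdsCost, cmds] using Exec.skip (st i o R)
  | cons c cs ih =>
    intro i o R
    have e₁ := Cmd.exec (h c (by simp)) i o R
    have e₂ := ih (fun c hc => h c (by simp [hc])) i (o ++ c.word R) (c.regs R)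
    rw [List.append_assoc] at e₂
    exact .seq e₁ e₂

theorem exec_drain_reg_zero {r : Reg} {body : Sym → Prog Stk} {R : Reg → ℕ} (h : R r = 0)
    (i o : List Sym) : Exec (drain (.reg r) body) (st i o R) (st i o R) 1 :=
  exec_drain_nil (by simp [st, h])

/-- A loop that is executed as often as the register `r` tells; `f k` and `w k` are the registers
and the word written when `k` iterations remain to be done. -/
theorem exec_drain_reg {r : Reg} {body : Sym → Prog Stk} {i : List Sym} (f : ℕ → Reg → ℕ)
    (w : ℕ → List Sym) {N t : ℕ} (h₀ : ∀ k ≤ N, f k r = k)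
    (h : ∀ k < N, Exec (body .tick) (st i (w (k + 1)) (Function.update (f (k + 1)) r k))
      (st i (w k) (f k)) t) :
    Exec (drain (.reg r) body) (st i (w N) (f N)) (st i (w 0) (f 0)) ((t + 1) * N + 1) := by
  induction N with
  | zero => simpa using exec_drain_reg_zero (h₀ 0 le_rfl) i (w 0)
  | succ N ih =>
    have e := exec_drain_cons (k := .reg r) (s := st i (w (N + 1)) (f (N + 1)))
      (l := List.replicate N .tick) (a := .tick)
      (by simp [st, h₀ (N + 1) le_rfl, List.replicate_succ])
      (by rw [update_st_reg]; exact h N (by omega))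
      (ih (fun k hk => h₀ k (by omega)) (fun k hk => h k (by omega)))
    exact e.mono (by ring_nf; omega)

/-! ## The translating program -/

theorem Exec.cast {K : Type} [DecidableEq K] {p : Prog K} {s s' s'' : Stacks K} {t t' : ℕ}
    (h : Exec p s s' t) (hs : s' = s'') (ht : t ≤ t') : Exec p s s'' t' :=
  hs ▸ h.mono ht

/-- Registers with given contents. -/
def regs (n W w off u v m cnt acc : ℕ) : Reg → ℕ
  | .n => n
  | .W => W
  | .w => w
  | .off => off
  | .u => u
  | .v => v
  | .m => m
  | .cnt => cnt
  | .acc => acc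

section regs

variable (n W w off u v m cnt acc x : ℕ)

@[simp] theorem update_regs_n : Function.update (regs n W w off u v m cnt acc) .n x =
    regs x W w off u v m cnt acc := by funext r; cases r <;> rfl
@[simp] theorem update_regs_W : Function.update (regs n W w off u v m cnt acc) .W x =
    regs n x w off u v m cnt acc := by funext r; cases r <;> rfl
@[simp] theorem update_regs_w : Function.update (regs n W w off u v m cnt acc) .w x =
    regs n W x off u v m cnt acc := by funext r; cases r <;> rfl
@[simp] theorem update_regs_off : Function.update (regs n W w off u v m cnt acc) .off x =
    regs n W w x u v m cnt acc := by funext r; cases r <;> rfl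
@[simp] theorem update_regs_u : Function.update (regs n W w off u v m cnt acc) .u x =
    regs n W w off x v m cnt acc := by funext r; cases r <;> rfl
@[simp] theorem update_regs_v : Function.update (regs n W w off u v m cnt acc) .v x =
    regs n W w off u x m cnt acc := by funext r; cases r <;> rfl
@[simp] theorem update_regs_m : Function.update (regs n W w off u v m cnt acc) .m x =
    regs n W w off u v x cnt acc := by funext r; cases r <;> rfl
@[simp] theorem update_regs_cnt : Function.update (regs n W w off u v m cnt acc) .cnt x =
    regs n W w off u v m x acc := by funext r; cases r <;> rfl
@[simp] theorem update_regs_acc : Function.update (regs n W w off u v m cnt acc) .acc x =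
    regs n W w off u v m cnt x := by funext r; cases r <;> rfl

@[simp] theorem regs_n : regs n W w off u v m cnt acc .n = n := rfl
@[simp] theorem regs_W : regs n W w off u v m cnt acc .W = W := rfl
@[simp] theorem regs_w : regs n W w off u v m cnt acc .w = w := rfl
@[simp] theorem regs_off : regs n W w off u v m cnt acc .off = off := rfl
@[simp] theorem regs_u : regs n W w off u v m cnt acc .u = u := rfl
@[simp] theorem regs_v : regs n W w off u v m cnt acc .v = v := rfl
@[simp] theorem regs_m : regs n W w off u v m cnt acc .m = m := rfl
@[simp] theorem regs_cnt : regs n W w off u v m cnt acc .cnt = cnt := rfl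
@[simp] theorem regs_acc : regs n W w off u v m cnt acc .acc = acc := rfl

end regs

theorem cmdsRegs_append (R : Reg → ℕ) (cs cs' : List Cmd) :
    cmdsRegs R (cs ++ cs') = cmdsRegs (cmdsRegs R cs) cs' := by
  induction cs generalizing R with
  | nil => rfl
  | cons c cs ih => exact ih _

theorem cmdsWord_append (R : Reg → ℕ) (cs cs' : List Cmd) :
    cmdsWord R (cs ++ cs') = cmdsWord R cs ++ cmdsWord (cmdsRegs R cs) cs' := by
  induction cs generalizing R with
  | nil => rfl
  | cons c cs ih => simp [cmdsWord, cmdsRegs, ih]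

theorem cmdsCost_append (R : Reg → ℕ) (cs cs' : List Cmd) :
    cmdsCost R (cs ++ cs') = cmdsCost R cs + cmdsCost (cmdsRegs R cs) cs' := by
  induction cs generalizing R with
  | nil => simp [cmdsCost, cmdsRegs]
  | cons c cs ih => simp [cmdsCost, cmdsRegs, ih, Nat.add_assoc]

theorem encodeNum_add (a b : ℕ) :
    encodeNum (a + b) = List.replicate a Sym.tick ++ encodeNum b := by
  rw [encodeNum, encodeNum, ← List.append_assoc, List.replicate_append_replicate]

/-- Commands that write the sum of some registers. -/
def num : List Reg → List Cmd
  | [] => [.emit .sep]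
  | r :: rs => .put r :: num rs

theorem cmdsWord_num (R : Reg → ℕ) (rs : List Reg) :
    cmdsWord R (num rs) = encodeNum (rs.map R).sum := by
  induction rs with
  | nil => rfl
  | cons r rs ih => simp [num, cmdsWord, Cmd.word, Cmd.regs, ih, encodeNum_add]

theorem cmdsRegs_num (R : Reg → ℕ) (rs : List Reg) : cmdsRegs R (num rs) = R := by
  induction rs with
  | nil => rfl
  | cons r rs ih => exact ih

theorem cmdsCost_num (R : Reg → ℕ) (rs : List Reg) :
    cmdsCost R (num rs) = 5 * (rs.map R).sum + 2 * rs.length + 1 := by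
  induction rs with
  | nil => rfl
  | cons r rs ih => simp [num, cmdsCost, Cmd.cost, Cmd.regs, ih]; ring

theorem valid_num {rs : List Reg} {c : Cmd} (h : c ∈ num rs) : c.Valid := by
  induction rs with
  | nil => simp only [num, List.mem_singleton] at h; subst h; trivial
  | cons r rs ih =>
    simp only [num, List.mem_cons] at h
    rcases h with rfl | h
    · trivial
    · exact ih h

/-! ### Reading numbers -/

/-- Copy numbers to the output, increasing each by the sum of the given registers, up to the
symbol `last`. -/
def readNums (last : Sym) (rs : List Reg) : Prog Stk :=
  .sw .inp (fun o => o != some last) fun o => o.elim .skip fun a =>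
    if a = .sep then cmds (num rs) else .push .out a

theorem readNums_again {last : Sym} {rs : List Reg} {a : Sym} {i i' o o' : List Sym}
    {R R' : Reg → ℕ} {s' : Stacks Stk} {t t' : ℕ} (ha : a ≠ last)
    (h : Exec (if a = .sep then cmds (num rs) else .push .out a) (st i o R) (st i' o' R') t)
    (h' : Exec (readNums last rs) (st i' o' R') s' t') :
    Exec (readNums last rs) (st (a :: i) o R) s' (t + t' + 1) := by
  refine Exec.again (by simp [st, ha]) ?_ h'
  rw [update_st_inp]
  exact h

theorem readNums_done {last : Sym} {rs : List Reg} {i i' o o' : List Sym} {R R' : Reg → ℕ}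
    {t : ℕ}
    (h : Exec (if last = .sep then cmds (num rs) else .push .out last)
      (st i o R) (st i' o' R') t) :
    Exec (readNums last rs) (st (last :: i) o R) (st i' o' R') (t + 1) := by
  refine Exec.done (by simp [st]) ?_
  rw [update_st_inp]
  exact h

theorem readNums_ticks {last : Sym} {rs : List Reg} {i : List Sym} {R : Reg → ℕ}
    {s' : Stacks Stk} {t : ℕ} (hl : Sym.tick ≠ last) (a : ℕ) : ∀ o : List Sym,
    Exec (readNums last rs) (st i (o ++ List.replicate a .tick) R) s' t →
    Exec (readNums last rs) (st (List.replicate a .tick ++ i) o R) s' (t + 2 * a) := by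
  induction a with
  | zero => intro o h; simpa using h
  | succ a ih =>
    intro o h
    have e := readNums_again (rs := rs) hl
      (show Exec (if Sym.tick = .sep then cmds (num rs) else .push .out Sym.tick)
        (st (List.replicate a .tick ++ i) o R) _ _ from exec_emit _ _ _ _)
      (ih (o ++ [.tick]) (by simpa [List.replicate_succ] using h))
    exact e.mono (by omega)

theorem exec_num (i o : List Sym) (R : Reg → ℕ) (rs : List Reg) :
    Exec (cmds (num rs)) (st i o R) (st i (o ++ encodeNum (rs.map R).sum) R)
      (5 * (rs.map R).sum + 2 * rs.length + 1) := by
  have := exec_cmds (cs := num rs) (fun c => valid_num) i o R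
  rwa [cmdsWord_num, cmdsRegs_num, cmdsCost_num] at this

/-- The shift is inserted at the separator: the copied ticks are followed by those of the registers
and only then by the new separator. -/
theorem exec_readNum (i o : List Sym) (R : Reg → ℕ) (rs : List Reg) (a : ℕ) :
    Exec (readNums .sep rs) (st (encodeNum a ++ i) o R)
      (st i (o ++ encodeNum (a + (rs.map R).sum)) R)
      (5 * (rs.map R).sum + 2 * rs.length + 2 + 2 * a) := by
  rw [encodeNum, List.append_assoc]
  refine readNums_ticks (by simp) a o ?_
  rw [encodeNum_add, ← List.append_assoc]
  exact readNums_done (exec_num _ _ _ _)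

/-- The bound charges every symbol as much as a separator, the only symbol at which registers are
copied. -/
theorem exec_readList (i : List Sym) (R : Reg → ℕ) (rs : List Reg) (l : List ℕ) :
    ∀ o : List Sym, Exec (readNums .close rs) (st (encodeNums l ++ i) o R)
      (st i (o ++ encodeNums (l.map fun a => a + (rs.map R).sum)) R)
      ((5 * (rs.map R).sum + 2 * rs.length + 2) * (encodeNums l).length) := by
  induction l with
  | nil =>
    intro o
    have e := readNums_done (rs := rs) (i := i) (o := o) (R := R) (last := .close)
      (by simpa using exec_emit i o R .close)
    exact e.mono (by simp [encodeNums])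
  | cons a l ih =>
    intro o
    have h₁ := ih (o ++ List.replicate a .tick ++ encodeNum (rs.map R).sum)
    have h₂ := readNums_again (last := .close) (a := .sep) (i := encodeNums l ++ i)
      (by simp) (show Exec (cmds (num rs)) _ _ _ from
        exec_num _ (o ++ List.replicate a .tick) R rs) h₁
    have h₃ := readNums_ticks (by simp) a o h₂
    have e₁ : encodeNums (a :: l) ++ i =
        List.replicate a .tick ++ .sep :: (encodeNums l ++ i) := by
      simp [encodeNums, encodeNum]
    have e₂ : o ++ encodeNums ((a :: l).map fun a => a + (rs.map R).sum) =
        o ++ List.replicate a .tick ++ encodeNum (rs.map R).sum ++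
          encodeNums (l.map fun a => a + (rs.map R).sum) := by
      simp [encodeNums, encodeNum_add]
    rw [e₁, e₂]
    refine h₃.mono ?_
    have e₃ : (encodeNums (a :: l)).length = a + 1 + (encodeNums l).length := by
      simp [encodeNums, encodeNum]; omega
    rw [e₃]
    generalize (rs.map R).sum = d
    generalize (encodeNums l).length = y
    generalize rs.length = z
    have : 2 * a ≤ (5 * d + 2 * z + 2) * a := Nat.mul_le_mul_right _ (by omega)
    have h : (5 * d + 2 * z + 2) * (a + 1 + y) =
      (5 * d + 2 * z + 2) * a + (5 * d + 2 * z + 2) + (5 * d + 2 * z + 2) * y := by ring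
    omega

/-- Read a number and add it to register `r`. -/
def readInto (rs : List Reg) : Prog Stk :=
  .sw .inp (fun o => o == some .tick) fun o =>
    if o = some .tick then cmds (rs.map .incr) else .skip

theorem valid_incr {rs : List Reg} {c : Cmd} (h : c ∈ rs.map Cmd.incr) : c.Valid := by
  obtain ⟨r, -, rfl⟩ := List.mem_map.1 h
  trivial

theorem cmdsWord_incr (R : Reg → ℕ) (rs : List Reg) : cmdsWord R (rs.map .incr) = [] := by
  induction rs generalizing R with
  | nil => rfl
  | cons r rs ih => simp [cmdsWord, Cmd.word, ih]

theorem cmdsCost_incr (R : Reg → ℕ) (rs : List Reg) :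
    cmdsCost R (rs.map .incr) = rs.length := by
  induction rs generalizing R with
  | nil => rfl
  | cons r rs ih => simp [cmdsCost, Cmd.cost, ih, Nat.add_comm]

/-- The function `f` gives the registers after each number of ticks; reading one tick shifts `f`, so
the induction generalizes over it. -/
theorem exec_readInto (rs : List Reg) (i o : List Sym) (a : ℕ) (f : ℕ → Reg → ℕ)
    (hf : ∀ k < a, cmdsRegs (f k) (rs.map .incr) = f (k + 1)) :
    Exec (readInto rs) (st (encodeNum a ++ i) o (f 0)) (st i o (f a))
      ((rs.length + 1) * a + 1) := by
  induction a generalizing f with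
  | zero =>
    have : Exec (readInto rs) (st (.sep :: i) o (f 0)) (st i o (f 0)) (0 + 1) := by
      refine Exec.done (by simp [st]) ?_
      rw [update_st_inp]
      exact Exec.skip _
    simpa [encodeNum] using this
  | succ a ih =>
    have h := exec_cmds (cs := rs.map .incr) (fun c => valid_incr)
      (encodeNum a ++ i) o (f 0)
    rw [hf 0 (by omega), cmdsWord_incr, cmdsCost_incr, List.append_nil] at h
    have e : Exec (readInto rs) (st (.tick :: (encodeNum a ++ i)) o (f 0)) (st i o (f (a + 1)))
        (rs.length + ((rs.length + 1) * a + 1) + 1) := by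
      refine Exec.again (s₁ := st (encodeNum a ++ i) o (f 1)) (by simp [st]) ?_
        (ih (fun k => f (k + 1)) fun k hk => hf (k + 1) (by omega))
      rw [update_st_inp]
      exact h
    refine Exec.mono (t := rs.length + ((rs.length + 1) * a + 1) + 1) ?_ (by ring_nf; omega)
    simpa [encodeNum, List.replicate_succ] using e

/-! ### Fanout -/

/-- Write a fanout gate whose control is held by register `acc`. -/
def fan : Prog Stk :=
  .seq (cmds (.emit .fanoutG :: num [.acc] ++ [.add .m .cnt])) <|
    .seq (drain (.reg .cnt) fun _ => cmds (.add .W .acc :: .add .W .acc :: num [.acc]))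
      (cmds [.emit .close, .clear .acc])

/-- The description of a fanout gate. -/
def fanWord (W m a : ℕ) : List Sym :=
  .fanoutG :: (encodeNum a ++ encodeNums ((List.range m).map fun j => a + 2 * W * (j + 1)))

/-- Register `acc` runs through the addresses of the targets in steps of 2W, since copies of equal
sign occupy every second block. All addresses are at most `B`, so there are at most `B` rounds of
cost linear in `B`. -/
theorem exec_fan (n W w off u v m a B : ℕ) (i o : List Sym) (hB : a + W + m + 2 * W * m ≤ B) :
    Exec fan (st i o (regs n W w off u v m 0 a))
      (st i (o ++ fanWord W m a) (regs n W w off u v m 0 0)) (40 * (B + 1) ^ 2) := by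
  have h₁ := exec_cmds (cs := .emit .fanoutG :: num [.acc] ++ [.add .m .cnt])
    (by simp [num, Cmd.Valid]) i o (regs n W w off u v m 0 a)
  have h₂ := exec_drain_reg (r := .cnt) (i := i)
    (body := fun _ => cmds (.add .W .acc :: .add .W .acc :: num [.acc])) (N := m)
    (t := 20 * B + 7)
    -- With `k` rounds left, `m - k` targets have been written.
    (fun k => regs n W w off u v m k (a + 2 * W * (m - k)))
    (fun k => o ++ .fanoutG :: encodeNum a ++
      (List.range (m - k)).flatMap fun j => encodeNum (a + 2 * W * (j + 1)))
    (fun k _ => rfl) (fun k hk => by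
      have h := exec_cmds (cs := .add .W .acc :: .add .W .acc :: num [.acc])
        (by simp [num, Cmd.Valid]) i (o ++ .fanoutG :: encodeNum a ++
          (List.range (m - (k + 1))).flatMap fun j => encodeNum (a + 2 * W * (j + 1)))
          (regs n W w off u v m k (a + 2 * W * (m - (k + 1))))
      obtain ⟨l, hl⟩ : ∃ l, m - k = l + 1 := ⟨m - k - 1, by omega⟩
      have hl' : m - (k + 1) = l := by omega
      have e : a + 2 * W * l + W + W = a + 2 * W * (l + 1) := by ring
      have hle : 2 * W * (l + 1) ≤ 2 * W * m := Nat.mul_le_mul_left _ (by omega)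
      simp only [hl', hl, update_regs_cnt] at h ⊢
      simp only [cmdsWord, cmdsRegs, cmdsCost, Cmd.regs, Cmd.word, Cmd.cost, cmdsWord_num,
        cmdsRegs_num, cmdsCost_num, update_regs_acc, regs_acc, regs_W, List.map_cons,
        List.map_nil, List.sum_cons, List.sum_nil, List.nil_append, e, Nat.add_zero] at h
      rw [List.range_succ, List.flatMap_append]
      refine h.cast (by simp) ?_
      · simp only [List.length_cons, List.length_nil]; omega)
  have h₃ := exec_cmds (cs := [.emit .close, .clear .acc])
    (by simp [Cmd.Valid]) i (o ++ .fanoutG :: encodeNum a ++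
      (List.range m).flatMap fun j => encodeNum (a + 2 * W * (j + 1)))
      (regs n W w off u v m 0 (a + 2 * W * m))
  simp only [List.cons_append, cmdsWord, cmdsRegs, cmdsCost, Cmd.regs, Cmd.word, Cmd.cost,
    cmdsWord_append, cmdsRegs_append, cmdsCost_append, cmdsWord_num, cmdsRegs_num, cmdsCost_num,
    update_regs_acc, update_regs_cnt, regs_acc, regs_m, regs_cnt, List.map_cons,
    List.map_nil, List.sum_cons, List.sum_nil, List.nil_append, List.append_nil, Nat.add_zero,
    Nat.zero_add, List.length_cons, List.length_nil] at h₁ h₃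
  simp only [Nat.sub_self, Nat.sub_zero, List.range_zero, List.flatMap_nil, List.append_nil,
    Nat.mul_zero, Nat.add_zero] at h₂
  refine (h₁.seq (h₂.seq h₃)).cast ?_ ?_
  · congr 1
    simp [fanWord, encodeNums, List.flatMap_map]
  · have : (20 * B + 7 + 1) * m ≤ (20 * B + 7 + 1) * B := Nat.mul_le_mul_left _ (by omega)
    have e : 40 * (B + 1) ^ 2 = (20 * B + 7 + 1) * B + 20 * (B * B) + 72 * B + 40 := by ring
    omega

/-! ### Words of single gates -/

/-- Commands that write an `X` gate. -/
def xCmds (rs : List Reg) : List Cmd := .emit .xG :: num rs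
/-- Commands that write an `H` gate. -/
def hCmds (rs : List Reg) : List Cmd := .emit .hG :: num rs
/-- Commands that write a `T` gate. -/
def tCmds (rs : List Reg) : List Cmd := .emit .tG :: num rs
/-- Commands that write a `CNOT` gate. -/
def cnotCmds (rs rs' : List Reg) : List Cmd := .emit .cnotG :: (num rs ++ num rs')

/-- The description of an `X` gate. -/
def xWord (a : ℕ) : List Sym := .xG :: encodeNum a
/-- The description of an `H` gate. -/
def hWord (a : ℕ) : List Sym := .hG :: encodeNum a
/-- The description of a `T` gate. -/
def tWord (a : ℕ) : List Sym := .tG :: encodeNum a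
/-- The description of a `CNOT` gate. -/
def cnotWord (a b : ℕ) : List Sym := .cnotG :: (encodeNum a ++ encodeNum b)

section

variable (R : Reg → ℕ) (rs rs' : List Reg)

theorem cmdsWord_xCmds : cmdsWord R (xCmds rs) = xWord (rs.map R).sum :=
  congrArg _ (cmdsWord_num R rs)
theorem cmdsWord_hCmds : cmdsWord R (hCmds rs) = hWord (rs.map R).sum :=
  congrArg _ (cmdsWord_num R rs)
theorem cmdsWord_tCmds : cmdsWord R (tCmds rs) = tWord (rs.map R).sum :=
  congrArg _ (cmdsWord_num R rs)
theorem cmdsWord_cnotCmds :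
    cmdsWord R (cnotCmds rs rs') = cnotWord (rs.map R).sum (rs'.map R).sum := by
  simp [cnotCmds, cnotWord, cmdsWord, Cmd.word, Cmd.regs, cmdsWord_append, cmdsRegs_num,
    cmdsWord_num]

theorem cmdsRegs_xCmds : cmdsRegs R (xCmds rs) = R := cmdsRegs_num R rs
theorem cmdsRegs_hCmds : cmdsRegs R (hCmds rs) = R := cmdsRegs_num R rs
theorem cmdsRegs_tCmds : cmdsRegs R (tCmds rs) = R := cmdsRegs_num R rs
theorem cmdsRegs_cnotCmds : cmdsRegs R (cnotCmds rs rs') = R := by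
  simp [cnotCmds, cmdsRegs, Cmd.regs, cmdsRegs_append, cmdsRegs_num]

theorem cmdsCost_xCmds : cmdsCost R (xCmds rs) = 1 + (5 * (rs.map R).sum + 2 * rs.length + 1) :=
  congrArg _ (cmdsCost_num R rs)
theorem cmdsCost_hCmds : cmdsCost R (hCmds rs) = 1 + (5 * (rs.map R).sum + 2 * rs.length + 1) :=
  congrArg _ (cmdsCost_num R rs)
theorem cmdsCost_tCmds : cmdsCost R (tCmds rs) = 1 + (5 * (rs.map R).sum + 2 * rs.length + 1) :=
  congrArg _ (cmdsCost_num R rs)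
theorem cmdsCost_cnotCmds : cmdsCost R (cnotCmds rs rs') =
    1 + (5 * (rs.map R).sum + 2 * rs.length + 1 + (5 * (rs'.map R).sum + 2 * rs'.length + 1)) := by
  simp [cnotCmds, cmdsCost, Cmd.cost, Cmd.regs, cmdsCost_append, cmdsRegs_num, cmdsCost_num]

theorem valid_xCmds {c : Cmd} (h : c ∈ xCmds rs) : c.Valid := by
  rcases List.mem_cons.1 h with rfl | h
  · trivial
  · exact valid_num h
theorem valid_hCmds {c : Cmd} (h : c ∈ hCmds rs) : c.Valid := by
  rcases List.mem_cons.1 h with rfl | h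
  · trivial
  · exact valid_num h
theorem valid_tCmds {c : Cmd} (h : c ∈ tCmds rs) : c.Valid := by
  rcases List.mem_cons.1 h with rfl | h
  · trivial
  · exact valid_num h
theorem valid_cnotCmds {c : Cmd} (h : c ∈ cnotCmds rs rs') : c.Valid := by
  rcases List.mem_cons.1 h with rfl | h
  · trivial
  · rcases List.mem_append.1 h with h | h <;> exact valid_num h

end

/-! ### Completing a wire -/

/-- Write the gates that negate and copy the wire `w`. -/
def finish : Prog Stk :=
  .seq (cmds (cnotCmds [.w] [.w, .W] ++ xCmds [.w, .W] ++ [.add .w .acc])) <|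
    .seq fan <| .seq (cmds [.add .w .acc, .add .W .acc]) <| .seq fan (cmds [.incr .w])

/-- The description of the gates that negate and copy the wire `w`. -/
def finishWord (W m w : ℕ) : List Sym :=
  cnotWord w (w + W) ++ xWord (w + W) ++ fanWord W m w ++ fanWord W m (w + W)

theorem exec_finish (n W w off v m B : ℕ) (i o : List Sym)
    (hB : w + W + W + m + 2 * W * m ≤ B) :
    Exec finish (st i o (regs n W w off 0 v m 0 0))
      (st i (o ++ finishWord W m w) (regs n W (w + 1) off 0 v m 0 0)) (120 * (B + 1) ^ 2) := by
  have h₁ := exec_cmds (cs := cnotCmds [.w] [.w, .W] ++ xCmds [.w, .W] ++ [.add .w .acc])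
    (by
      intro c hc
      simp only [List.mem_append, List.mem_singleton] at hc
      rcases hc with (hc | hc) | rfl
      · exact valid_cnotCmds _ _ hc
      · exact valid_xCmds _ hc
      · simp [Cmd.Valid]) i o (regs n W w off 0 v m 0 0)
  have h₂ := exec_fan n W w off 0 v m w B i (o ++ (cnotWord w (w + W) ++ xWord (w + W)))
    (by omega)
  have h₃ := exec_cmds (cs := [.add .w .acc, .add .W .acc]) (by simp [Cmd.Valid]) i
    (o ++ (cnotWord w (w + W) ++ xWord (w + W)) ++ fanWord W m w) (regs n W w off 0 v m 0 0)
  have h₄ := exec_fan n W w off 0 v m (w + W) B i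
    (o ++ (cnotWord w (w + W) ++ xWord (w + W)) ++ fanWord W m w) (by omega)
  have h₅ := exec_cmds (cs := [.incr .w]) (by simp [Cmd.Valid]) i
    (o ++ (cnotWord w (w + W) ++ xWord (w + W)) ++ fanWord W m w ++ fanWord W m (w + W))
    (regs n W w off 0 v m 0 0)
  simp only [cmdsWord_append, cmdsRegs_append, cmdsCost_append, cmdsWord_xCmds,
    cmdsWord_cnotCmds, cmdsRegs_xCmds, cmdsRegs_cnotCmds, cmdsCost_xCmds, cmdsCost_cnotCmds,
    cmdsWord, cmdsRegs, cmdsCost, Cmd.word, Cmd.regs, Cmd.cost, List.map_cons, List.map_nil,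
    List.sum_cons, List.sum_nil, regs_w, regs_W, regs_acc, update_regs_acc, update_regs_w,
    Nat.add_zero, Nat.zero_add, List.append_nil, List.length_cons, List.length_nil]
    at h₁ h₃ h₅
  refine (h₁.seq (h₂.seq (h₃.seq (h₄.seq h₅)))).cast ?_ ?_
  · congr 1
    simp [finishWord]
  · have e : 120 * (B + 1) ^ 2 = 40 * (B + 1) ^ 2 + 40 * (B + 1) ^ 2 + 40 * (B * B) +
      80 * B + 40 := by ring
    omega

/-! ### Gates -/

/-- Commands that compute `⟨u⟩ ∧ ⟨v⟩` on the wire `w`. -/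
def andCmds : List Cmd :=
  hCmds [.w] ++ tCmds [.w] ++ cnotCmds [.v] [.w] ++ xCmds [.w] ++ tCmds [.w] ++
    cnotCmds [.u] [.w] ++ xCmds [.w] ++ tCmds [.w] ++ xCmds [.w] ++ cnotCmds [.v] [.w] ++
    tCmds [.w] ++ hCmds [.w]

/-- The gates that compute `u ∧ v` on the wire `w`. -/
def andWord (u v w : ℕ) : List Sym :=
  hWord w ++ tWord w ++ cnotWord v w ++ xWord w ++ tWord w ++
    cnotWord u w ++ xWord w ++ tWord w ++ xWord w ++ cnotWord v w ++ tWord w ++ hWord w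

/-- Write the gates for a gate of fan-in two with values `f₀₀`, `f₀₁`, `f₁₀`, `f₁₁`; the negation
of the second input is held by the qubit `v`. -/
def binCmds (f₀₀ f₀₁ f₁₀ f₁₁ : Bool) : List Cmd :=
  (if xor (xor f₀₀ f₀₁) (xor f₁₀ f₁₁) then andCmds else []) ++
  (if xor f₁₁ f₀₁ then cnotCmds [.u] [.w] else []) ++
  (if xor f₀₀ f₀₁ then cnotCmds [.v] [.w] else []) ++
  (if f₀₁ then xCmds [.w] else [])

/-- The description of the gates for a gate of fan-in two. -/
def binWord (f₀₀ f₀₁ f₁₀ f₁₁ : Bool) (u v w : ℕ) : List Sym :=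
  (if xor (xor f₀₀ f₀₁) (xor f₁₀ f₁₁) then andWord u v w else []) ++
  (if xor f₁₁ f₀₁ then cnotWord u w else []) ++
  (if xor f₀₀ f₀₁ then cnotWord v w else []) ++
  (if f₀₁ then xWord w else [])

theorem valid_binCmds (a b c d : Bool) {x : Cmd} (h : x ∈ binCmds a b c d) : x.Valid := by
  have hx : x ∈ andCmds ++ cnotCmds [.u] [.w] ++ cnotCmds [.v] [.w] ++ xCmds [.w] := by
    simp only [binCmds, List.mem_append] at h ⊢
    rcases h with ((h | h) | h) | h <;> split_ifs at h <;> simp_all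
  simp only [andCmds, List.mem_append, or_assoc] at hx
  have h₁ (rs) (h : x ∈ xCmds rs) := valid_xCmds rs h
  have h₂ (rs) (h : x ∈ hCmds rs) := valid_hCmds rs h
  have h₃ (rs) (h : x ∈ tCmds rs) := valid_tCmds rs h
  have h₄ (rs rs') (h : x ∈ cnotCmds rs rs') := valid_cnotCmds rs rs' h
  rcases hx with h | h | h | h | h | h | h | h | h | h | h | h | h | h | h <;>
    first | exact h₁ _ h | exact h₂ _ h | exact h₃ _ h | exact h₄ _ _ h

theorem cmdsRegs_andCmds (R : Reg → ℕ) : cmdsRegs R andCmds = R := by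
  simp only [andCmds, cmdsRegs_append, cmdsRegs_xCmds, cmdsRegs_hCmds, cmdsRegs_tCmds,
    cmdsRegs_cnotCmds]

theorem cmdsRegs_binCmds (a b c d : Bool) (R : Reg → ℕ) : cmdsRegs R (binCmds a b c d) = R := by
  simp only [binCmds, cmdsRegs_append]
  split_ifs <;> simp only [cmdsRegs_andCmds, cmdsRegs_cnotCmds, cmdsRegs_xCmds, cmdsRegs]

theorem cmdsWord_andCmds (R : Reg → ℕ) :
    cmdsWord R andCmds = andWord (R .u) (R .v) (R .w) := by
  simp only [andCmds, cmdsWord_append, cmdsRegs_append, cmdsRegs_xCmds, cmdsRegs_hCmds,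
    cmdsRegs_tCmds, cmdsRegs_cnotCmds, cmdsWord_xCmds, cmdsWord_hCmds, cmdsWord_tCmds,
    cmdsWord_cnotCmds, List.map_cons, List.map_nil, List.sum_cons, List.sum_nil, Nat.add_zero,
    andWord]

theorem cmdsWord_binCmds (a b c d : Bool) (R : Reg → ℕ) :
    cmdsWord R (binCmds a b c d) = binWord a b c d (R .u) (R .v) (R .w) := by
  simp only [binCmds, binWord, cmdsWord_append]
  congr 1
  · congr 1
    · congr 1
      · split_ifs
        · exact cmdsWord_andCmds R
        · rfl
      · split_ifs <;> simp [cmdsRegs_andCmds, cmdsRegs, cmdsWord_cnotCmds, cmdsWord]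
    · split_ifs <;> simp [cmdsRegs_append, cmdsRegs_andCmds, cmdsRegs, cmdsWord_cnotCmds,
        cmdsWord, cmdsRegs_cnotCmds]
  · split_ifs <;> simp [cmdsRegs_append, cmdsRegs_andCmds, cmdsRegs, cmdsWord_xCmds,
        cmdsWord, cmdsRegs_cnotCmds]

theorem cmdsCost_andCmds (R : Reg → ℕ) :
    cmdsCost R andCmds ≤ 80 * (R .u + R .v + R .w) + 100 := by
  simp only [andCmds, cmdsCost_append, cmdsRegs_append, cmdsRegs_xCmds, cmdsRegs_hCmds,
    cmdsRegs_tCmds, cmdsRegs_cnotCmds, cmdsCost_xCmds, cmdsCost_hCmds, cmdsCost_tCmds,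
    cmdsCost_cnotCmds, List.map_cons, List.map_nil, List.sum_cons, List.sum_nil, Nat.add_zero,
    List.length_cons, List.length_nil]
  omega

theorem cmdsCost_binCmds (a b c d : Bool) (R : Reg → ℕ) :
    cmdsCost R (binCmds a b c d) ≤ 100 * (R .u + R .v + R .w) + 200 := by
  have h := cmdsCost_andCmds R
  have h₁ := cmdsCost_cnotCmds R [.u] [.w]
  have h₂ := cmdsCost_cnotCmds R [.v] [.w]
  have h₃ := cmdsCost_xCmds R [.w]
  simp only [List.map_cons, List.map_nil, List.sum_cons, List.sum_nil, Nat.add_zero,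
    List.length_cons, List.length_nil] at h₁ h₂ h₃
  simp only [binCmds, cmdsCost_append, cmdsRegs_append]
  split_ifs <;> simp only [cmdsRegs_andCmds, cmdsRegs_cnotCmds, cmdsRegs, cmdsCost] <;> omega

/-- Pop a symbol from the input. -/
def popInp (body : Option Sym → Prog Stk) : Prog Stk := .sw .inp (fun _ => false) body

theorem exec_popInp {body : Option Sym → Prog Stk} {a : Sym} {i o : List Sym} {R : Reg → ℕ}
    {s' : Stacks Stk} {t : ℕ} (h : Exec (body (some a)) (st i o R) s' t) :
    Exec (popInp body) (st (a :: i) o R) s' (t + 1) := by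
  refine Exec.done rfl ?_
  rw [update_st_inp]
  exact h

/-- The bit written in a symbol. -/
def symBit : Option Sym → Bool
  | some (.bit b) => b
  | _ => false

/-- Translate a gate, except for its first symbol. -/
def gateProg : Sym → Prog Stk
  | .notG => .seq (cmds [.emit .cnotG]) <| .seq (readNums .sep [.off, .W]) (cmds (num [.w]))
  | .andG => .seq (cmds [.emit .toffoliG]) <| .seq (readNums .close [.off]) (cmds (num [.w]))
  | .orG => .seq (cmds [.emit .toffoliG]) <| .seq (readNums .close [.off, .W])
      (cmds (num [.w] ++ xCmds [.w]))
  | .binG => popInp fun b₁ => popInp fun b₂ => popInp fun b₃ => popInp fun b₄ =>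
      .seq (readInto [.u]) <| .seq (readInto [.v]) <|
        cmds ([.add .off .u, .add .off .v, .add .W .v] ++
          binCmds (symBit b₁) (symBit b₂) (symBit b₃) (symBit b₄) ++ [.clear .u, .clear .v])
  | _ => .skip

/-- The description of the gates that compute a gate of a Boolean circuit on the wire `w`. -/
def gateWord (W off w : ℕ) : BGate → List Sym
  | .not a => cnotWord (a + (off + W)) w
  | .bin f a b => binWord (f false false) (f false true) (f true false) (f true true)
      (a + off) (b + off + W) w
  | .and l => .toffoliG :: (encodeNums (l.map fun a => a + off) ++ encodeNum w)
  | .or l => .toffoliG :: (encodeNums (l.map fun a => a + (off + W)) ++ encodeNum w) ++ xWord w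

/-- The first symbol of a gate. -/
def headSym : BGate → Sym
  | .not _ => .notG
  | .bin _ _ _ => .binG
  | .and _ => .andG
  | .or _ => .orG

theorem length_encodeNum (a : ℕ) : (encodeNum a).length = a + 1 := by simp [encodeNum]

theorem encode_eq_headSym_cons (g : BGate) : g.encode = headSym g :: g.encode.tail := by
  cases g <;> simp [BGate.encode, headSym]

/-- The head symbol has already been popped by the main loop, which selects the program by it. For a
gate of fan-in two, `u` and `v` must be empty on entry, since reading adds to them, and are cleared
again at the end. -/
theorem exec_gateProg (g : BGate) (n W w off m B : ℕ) (i o : List Sym)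
    (hB : w + W + off + g.encode.length ≤ B) :
    Exec (gateProg (headSym g)) (st (g.encode.tail ++ i) o (regs n W w off 0 0 m 0 0))
      (st i (o ++ gateWord W off w g) (regs n W w off 0 0 m 0 0)) (1000 * (B + 1) ^ 2) := by
  have e : 1000 * (B + 1) ^ 2 = 1000 * (B * B) + 2000 * B + 1000 := by ring
  have hB' : B ≤ B * B := Nat.le_mul_self B
  cases g with
  | not a =>
    have h₁ := exec_cmds (cs := [.emit .cnotG]) (by simp [Cmd.Valid])
      (encodeNum a ++ i) o (regs n W w off 0 0 m 0 0)
    have h₂ := exec_readNum i (o ++ [.cnotG]) (regs n W w off 0 0 m 0 0) [.off, .W] a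
    have h₃ := exec_num i (o ++ [.cnotG] ++ encodeNum (a + (off + W)))
      (regs n W w off 0 0 m 0 0) [.w]
    simp only [BGate.encode, List.length_cons, length_encodeNum] at hB
    simp only [cmdsWord, cmdsRegs, cmdsCost, Cmd.word, Cmd.regs, Cmd.cost, List.map_cons,
      List.map_nil, List.sum_cons, List.sum_nil, regs_w, regs_W, regs_off, Nat.add_zero,
      List.append_nil, List.length_cons, List.length_nil] at h₁ h₂ h₃
    refine (h₁.seq (h₂.seq h₃)).cast ?_ ?_
    · congr 1
      simp [gateWord, cnotWord]
    · omega
  | and l =>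
    have h₁ := exec_cmds (cs := [.emit .toffoliG]) (by simp [Cmd.Valid])
      (encodeNums l ++ i) o (regs n W w off 0 0 m 0 0)
    have h₂ := exec_readList i (regs n W w off 0 0 m 0 0) [.off] l (o ++ [.toffoliG])
    have h₃ := exec_num i (o ++ [.toffoliG] ++ encodeNums (l.map fun a => a + off))
      (regs n W w off 0 0 m 0 0) [.w]
    simp only [BGate.encode, List.length_cons] at hB
    simp only [cmdsWord, cmdsRegs, cmdsCost, Cmd.word, Cmd.regs, Cmd.cost, List.map_cons,
      List.map_nil, List.sum_cons, List.sum_nil, regs_w, regs_off, Nat.add_zero,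
      List.append_nil, List.length_cons, List.length_nil] at h₁ h₂ h₃
    refine (h₁.seq (h₂.seq h₃)).cast ?_ ?_
    · congr 1
      simp [gateWord]
    · have := Nat.mul_le_mul (show 5 * off + 2 * (0 + 1) + 2 ≤ 5 * B + 4 by omega)
        (show (encodeNums l).length ≤ B by omega)
      have e' : (5 * B + 4) * B = 5 * (B * B) + 4 * B := by ring
      omega
  | or l =>
    have h₁ := exec_cmds (cs := [.emit .toffoliG]) (by simp [Cmd.Valid])
      (encodeNums l ++ i) o (regs n W w off 0 0 m 0 0)
    have h₂ := exec_readList i (regs n W w off 0 0 m 0 0) [.off, .W] l (o ++ [.toffoliG])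
    have h₃ := exec_cmds (cs := num [.w] ++ xCmds [.w]) (fun c hc => by
        rcases List.mem_append.1 hc with h | h
        exacts [valid_num h, valid_xCmds _ h])
      i (o ++ [.toffoliG] ++ encodeNums (l.map fun a => a + (off + W)))
      (regs n W w off 0 0 m 0 0)
    simp only [BGate.encode, List.length_cons] at hB
    simp only [cmdsWord, cmdsRegs, cmdsCost, Cmd.word, Cmd.regs, Cmd.cost, List.map_cons,
      List.map_nil, List.sum_cons, List.sum_nil, regs_w, regs_W, regs_off, Nat.add_zero,
      List.append_nil, List.length_cons, List.length_nil, cmdsWord_append, cmdsRegs_append,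
      cmdsCost_append, cmdsWord_num, cmdsRegs_num, cmdsCost_num, cmdsWord_xCmds,
      cmdsRegs_xCmds, cmdsCost_xCmds] at h₁ h₂ h₃
    refine (h₁.seq (h₂.seq h₃)).cast ?_ ?_
    · congr 1
      simp [gateWord]
    · have := Nat.mul_le_mul (show 5 * (off + W) + 2 * (0 + 1 + 1) + 2 ≤ 5 * B + 6 by omega)
        (show (encodeNums l).length ≤ B by omega)
      have e' : (5 * B + 6) * B = 5 * (B * B) + 6 * B := by ring
      omega
  | bin f a b =>
    have h₁ := exec_readInto [.u] (encodeNum b ++ i) o a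
      (fun k => regs n W w off k 0 m 0 0) (fun k _ => by simp [cmdsRegs, Cmd.regs])
    have h₂ := exec_readInto [.v] i o b
      (fun k => regs n W w off a k m 0 0) (fun k _ => by simp [cmdsRegs, Cmd.regs])
    have h₃ := exec_cmds (cs := [.add .off .u, .add .off .v, .add .W .v] ++
        binCmds (f false false) (f false true) (f true false) (f true true) ++
          [.clear .u, .clear .v]) (fun c hc => by
        simp only [List.mem_append, or_assoc] at hc
        rcases hc with h | h | h
        · simp only [List.mem_cons, List.not_mem_nil, or_false] at h
          rcases h with rfl | rfl | rfl <;> simp [Cmd.Valid]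
        · exact valid_binCmds _ _ _ _ h
        · simp only [List.mem_cons, List.not_mem_nil, or_false] at h
          rcases h with rfl | rfl <;> trivial) i o (regs n W w off a b m 0 0)
    have hc := cmdsCost_binCmds (f false false) (f false true) (f true false) (f true true)
      (regs n W w off (a + off) (b + off + W) m 0 0)
    simp only [BGate.encode, List.length_cons, List.length_append, length_encodeNum] at hB
    simp only [cmdsWord, cmdsRegs, cmdsCost, Cmd.word, Cmd.regs, Cmd.cost, regs_w, regs_W,
      regs_off, regs_u, regs_v, update_regs_u, update_regs_v, Nat.add_zero, List.append_nil,
      List.nil_append, cmdsWord_append, cmdsRegs_append, cmdsCost_append, cmdsWord_binCmds,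
      cmdsRegs_binCmds, List.length_cons, List.length_nil] at h₁ h₂ h₃ hc
    have h := exec_popInp (body := fun b₁ => popInp fun b₂ => popInp fun b₃ => popInp fun b₄ =>
      .seq (readInto [.u]) <| .seq (readInto [.v]) <|
        cmds ([.add .off .u, .add .off .v, .add .W .v] ++
          binCmds (symBit b₁) (symBit b₂) (symBit b₃) (symBit b₄) ++ [.clear .u, .clear .v]))
      (a := .bit (f false false)) <| exec_popInp (a := .bit (f false true)) <|
        exec_popInp (a := .bit (f true false)) <| exec_popInp (a := .bit (f true true)) <|
        h₁.seq (h₂.seq h₃)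
    have e' : (BGate.bin f a b).encode.tail ++ i = .bit (f false false) :: .bit (f false true) ::
        .bit (f true false) :: .bit (f true true) :: (encodeNum a ++ (encodeNum b ++ i)) := by
      simp [BGate.encode]
    rw [e']
    refine h.cast ?_ ?_
    · rfl
    · omega

/-! ### The whole translation -/

/-- The first symbols of gates of Boolean circuits. -/
def isHead : Sym → Bool
  | .notG | .binG | .andG | .orG => true
  | _ => false

/-- Count the gates. -/
def countProg : Prog Stk :=
  .seq (drain .inp fun a => if isHead a then .seq (.push .out a) (cmds [.incr .m, .incr .W])
    else .push .out a) (drain .out fun a => .push .inp a)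

theorem exec_countProg_fst (l : List Sym) : ∀ (o : List Sym) (c : ℕ),
    Exec (drain .inp fun a => if isHead a then .seq (.push .out a) (cmds [.incr .m, .incr .W])
      else .push .out a) (st l o (regs 0 c 0 0 0 0 c 0 0))
      (st [] (o ++ l) (regs 0 (c + l.countP isHead) 0 0 0 0 (c + l.countP isHead) 0 0))
      (4 * l.length + 1) := by
  induction l with
  | nil =>
    intro o c
    have := exec_drain_nil (k := .inp) (body := fun a => if isHead a then
      .seq (.push .out a) (cmds [.incr .m, .incr .W]) else .push .out a)
      (s := st [] o (regs 0 c 0 0 0 0 c 0 0)) rfl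
    simpa using this
  | cons a l ih =>
    intro o c
    by_cases ha : isHead a = true
    · have h₁ := exec_cmds (cs := [.emit a, .incr .m, .incr .W]) (by simp [Cmd.Valid]) l o
        (regs 0 c 0 0 0 0 c 0 0)
      simp only [cmdsWord, cmdsRegs, cmdsCost, Cmd.word, Cmd.regs, Cmd.cost, regs_m, regs_W,
        update_regs_m, update_regs_W, List.append_nil] at h₁
      have h := exec_drain_cons (k := .inp) (body := fun a => if isHead a then
        .seq (.push .out a) (cmds [.incr .m, .incr .W]) else .push .out a)
        (s := st (a :: l) o (regs 0 c 0 0 0 0 c 0 0)) rfl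
        (by rw [update_st_inp, if_pos ha]; exact h₁) (ih _ _)
      refine h.cast ?_ ?_
      · rw [List.countP_cons_of_pos ha]
        simp only [List.append_assoc, List.singleton_append]
        congr 2 <;> omega
      · simp only [List.length_cons]; omega
    · have h := exec_drain_cons (k := .inp) (body := fun a => if isHead a then
        .seq (.push .out a) (cmds [.incr .m, .incr .W]) else .push .out a)
        (s := st (a :: l) o (regs 0 c 0 0 0 0 c 0 0)) rfl
        (by rw [update_st_inp, if_neg ha]; exact exec_emit _ _ _ _) (ih _ _)
      refine h.cast ?_ ?_
      · rw [List.countP_cons_of_neg ha]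
        simp
      · simp only [List.length_cons]; omega

theorem exec_countProg_snd (R : Reg → ℕ) (l : List Sym) : ∀ i : List Sym,
    Exec (drain .out fun a => .push .inp a) (st i l.reverse R) (st (l.reverse ++ i) [] R)
      (2 * l.length + 1) := by
  induction l with
  | nil => intro i; exact exec_drain_nil rfl
  | cons a l ih =>
    intro i
    have h := exec_drain_cons (k := .out) (body := fun a => .push .inp a) (l := l) (a := a)
      (s := st i (a :: l).reverse R) (by simp [st])
      (Exec.push Stk.inp a _) (s' := st (l.reverse ++ (a :: i)) [] R) (t' := 2 * l.length + 1)
      (by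
        rw [update_st_out, update_st_inp]
        exact ih _)
    refine h.cast (by simp) (by simp only [List.length_cons]; omega)

/-- The stride W and the number of ancillas are needed before the first gate is written, but `m` is
only implicit in the input as the number of gate symbols. Hence the preliminary scan, with the
output stack as a buffer from which the input is restored. Register `W` starts as a second copy of
`m`. -/
theorem exec_countProg (l : List Sym) : Exec countProg (st l [] (regs 0 0 0 0 0 0 0 0 0))
    (st l [] (regs 0 (l.countP isHead) 0 0 0 0 (l.countP isHead) 0 0)) (6 * l.length + 2) := by
  have h₁ := exec_countProg_fst l [] 0
  have h₂ := exec_countProg_snd (regs 0 (l.countP isHead) 0 0 0 0 (l.countP isHead) 0 0)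
    l.reverse []
  simp only [List.reverse_reverse, List.append_nil, List.length_reverse] at h₂
  simp only [List.nil_append, Nat.zero_add] at h₁
  exact (h₁.seq h₂).mono (by omega)

theorem countP_encodeNum (a : ℕ) : (encodeNum a).countP isHead = 0 := by
  rw [List.countP_eq_zero]
  intro x hx
  simp only [encodeNum, List.mem_append, List.mem_replicate, List.mem_singleton] at hx
  rcases hx with ⟨-, rfl⟩ | rfl <;> simp [isHead]

theorem countP_encodeNums (l : List ℕ) : (encodeNums l).countP isHead = 0 := by
  rw [List.countP_eq_zero]
  intro x hx
  simp only [encodeNums, List.mem_append, List.mem_flatMap, List.mem_singleton] at hx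
  rcases hx with ⟨a, -, hx⟩ | rfl
  · exact List.countP_eq_zero.1 (countP_encodeNum a) x hx
  · simp [isHead]

/-- Numbers, bits and delimiters are written without gate symbols, so only the first symbol of a
gate is counted. -/
theorem countP_encode (g : BGate) : g.encode.countP isHead = 1 := by
  cases g <;> simp [BGate.encode, isHead, List.countP_cons, countP_encodeNum, countP_encodeNums]

theorem countP_flatMap_encode (gs : List BGate) :
    (gs.flatMap BGate.encode).countP isHead = gs.length := by
  induction gs with
  | nil => rfl
  | cons g gs ih => simp [countP_encode, ih, Nat.add_comm]

/-- Write the numbers of qubits and the output qubit. -/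
def headerProg : Prog Stk :=
  .seq (readInto [.n, .W]) <| .seq (readInto [.u]) <|
    .seq (cmds (num [.n] ++ [.add .m .cnt])) <|
      .seq (drain (.reg .cnt) fun _ => cmds [.put .W, .put .W]) <|
        cmds (num [.W, .m] ++ num [.u] ++ [.clear .u, .add .n .v, .add .W .off, .add .W .off])

/-- Reading `n` also increments `W`, which turns `m` into n + m. The number of ancillas is written
without multiplying: 2W ticks in each of `m` rounds, then W + m more. Afterwards `v` holds the
number of input wires still to be copied and `off` the address of block 2, from which the first gate
reads. -/
theorem exec_headerProg (n m b B : ℕ) (i : List Sym) (hB : n + m + b ≤ B) :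
    Exec headerProg (st (encodeNum n ++ (encodeNum b ++ i)) [] (regs 0 m 0 0 0 0 m 0 0))
      (st i (encodeNum n ++ encodeNum ((n + m) * (2 * m + 1) + m) ++ encodeNum b)
        (regs n (n + m) 0 (2 * (n + m)) 0 n m 0 0)) (100 * (B + 1) ^ 2) := by
  have h₁ := exec_readInto [.n, .W] (encodeNum b ++ i) [] n
    (fun k => regs k (k + m) 0 0 0 0 m 0 0) (fun k _ => by
      simp [cmdsRegs, Cmd.regs]; congr 1; omega)
  have h₂ := exec_readInto [.u] i [] b
    (fun k => regs n (n + m) 0 0 k 0 m 0 0) (fun k _ => by simp [cmdsRegs, Cmd.regs])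
  have h₃ := exec_cmds (cs := num [.n] ++ [.add .m .cnt]) (by simp [num, Cmd.Valid]) i []
    (regs n (n + m) 0 0 b 0 m 0 0)
  have h₄ := exec_drain_reg (r := .cnt) (i := i)
    (body := fun _ => cmds [.put .W, .put .W]) (N := m) (t := 10 * (n + m) + 4)
    (fun k => regs n (n + m) 0 0 b 0 m k 0)
    (fun k => encodeNum n ++ List.replicate (2 * (n + m) * (m - k)) .tick)
    (fun k _ => rfl) (fun k hk => by
      have h := exec_cmds (cs := [.put .W, .put .W]) (by simp [Cmd.Valid]) i
        (encodeNum n ++ List.replicate (2 * (n + m) * (m - (k + 1))) .tick)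
        (regs n (n + m) 0 0 b 0 m k 0)
      obtain ⟨l, hl⟩ : ∃ l, m - k = l + 1 := ⟨m - k - 1, by omega⟩
      have hl' : m - (k + 1) = l := by omega
      simp only [update_regs_cnt]
      simp only [cmdsWord, cmdsRegs, cmdsCost, Cmd.word, Cmd.regs, Cmd.cost, regs_W] at h
      refine h.cast ?_ (by omega)
      congr 1
      rw [List.append_nil, List.append_assoc, List.replicate_append_replicate,
        List.replicate_append_replicate, hl, hl']
      congr 2
      ring)
  have h₅ := exec_cmds (cs := num [.W, .m] ++ num [.u] ++
      [.clear .u, .add .n .v, .add .W .off, .add .W .off])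
    (by simp [num, Cmd.Valid]) i
    (encodeNum n ++ List.replicate (2 * (n + m) * m) .tick) (regs n (n + m) 0 0 b 0 m 0 0)
  simp only [cmdsWord, cmdsRegs, cmdsCost, Cmd.word, Cmd.regs, Cmd.cost, cmdsWord_append,
    cmdsRegs_append, cmdsCost_append, cmdsWord_num, cmdsRegs_num, cmdsCost_num, List.map_cons,
    List.map_nil, List.sum_cons, List.sum_nil, regs_n, regs_W, regs_m, regs_u, regs_v, regs_off,
    regs_cnt, update_regs_off, update_regs_u, update_regs_v, update_regs_cnt, Nat.add_zero,
    Nat.zero_add, List.append_nil, List.nil_append, List.length_cons, List.length_nil,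
    Nat.sub_self, Nat.sub_zero, Nat.mul_zero, List.replicate_zero] at h₁ h₂ h₃ h₄ h₅
  refine (h₁.seq (h₂.seq (h₃.seq (h₄.seq h₅)))).cast ?_ ?_
  · congr 1
    · have e : (n + m) * (2 * m + 1) + m = 2 * (n + m) * m + (n + m + m) := by ring
      rw [e, encodeNum_add _ (n + m + m)]
      simp
    · congr 1; omega
  · have : (10 * (n + m) + 4 + 1) * m ≤ (10 * B + 5) * B := Nat.mul_le_mul (by omega) (by omega)
    have e : 100 * (B + 1) ^ 2 = (10 * B + 5) * B + 90 * (B * B) + 195 * B + 100 := by ring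
    omega

theorem exec_inputs (n W off m B : ℕ) (i o : List Sym) (hW : n ≤ W)
    (hB : 3 * W + m + 2 * W * m ≤ B) :
    Exec (drain (.reg .v) fun _ => finish) (st i o (regs n W 0 off 0 n m 0 0))
      (st i (o ++ (List.range n).flatMap (finishWord W m)) (regs n W n off 0 0 m 0 0))
      ((120 * (B + 1) ^ 2 + 1) * n + 1) := by
  have h := exec_drain_reg (r := .v) (i := i) (body := fun _ => finish) (N := n)
    (t := 120 * (B + 1) ^ 2) (fun k => regs n W (n - k) off 0 k m 0 0)
    (fun k => o ++ (List.range (n - k)).flatMap (finishWord W m)) (fun k _ => rfl)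
    (fun k hk => by
      obtain ⟨l, hl⟩ : ∃ l, n - k = l + 1 := ⟨n - k - 1, by omega⟩
      have hl' : n - (k + 1) = l := by omega
      have h := exec_finish n W l off k m B i
        (o ++ (List.range l).flatMap (finishWord W m)) (by omega)
      simp only [update_regs_v, hl, hl', List.range_succ, List.flatMap_append,
        List.flatMap_singleton, ← List.append_assoc]
      exact h)
  simpa using h

/-- The description of the gates for a list of gates of a Boolean circuit. -/
def segmentsWord (W m : ℕ) : ℕ → ℕ → List BGate → List Sym
  | _, _, [] => []
  | off, w, g :: gs => gateWord W off w g ++ finishWord W m w ++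
      segmentsWord W m (off + W + W) (w + 1) gs

/-- Translate all gates. -/
def gatesProg : Prog Stk :=
  drain .inp fun a => .seq (gateProg a) (.seq finish (cmds [.add .W .off, .add .W .off]))

/-- Each gate uses up two blocks, so `off` grows by 2W; the bound `B` leaves room for its growth
over all remaining gates. -/
theorem exec_gatesProg (n W m B : ℕ) (gs : List BGate) : ∀ (w off : ℕ) (o : List Sym),
    w + gs.length ≤ W →
    3 * W + m + 2 * W * m + off + 2 * W * gs.length + (gs.flatMap BGate.encode).length ≤ B →
    Exec gatesProg (st (gs.flatMap BGate.encode) o (regs n W w off 0 0 m 0 0))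
      (st [] (o ++ segmentsWord W m off w gs)
        (regs n W (w + gs.length) (off + 2 * W * gs.length) 0 0 m 0 0))
      (1200 * (B + 1) ^ 2 * gs.length + 1) := by
  induction gs with
  | nil =>
    intro w off o _ _
    have := exec_drain_nil (k := .inp) (body := fun a => .seq (gateProg a)
      (.seq finish (cmds [.add .W .off, .add .W .off])))
      (s := st [] o (regs n W w off 0 0 m 0 0)) rfl
    simpa [segmentsWord, gatesProg] using this
  | cons g gs ih =>
    intro w off o hW hB
    simp only [List.length_cons, List.flatMap_cons, List.length_append] at hW hB
    have hm : 2 * W * (gs.length + 1) = 2 * W * gs.length + 2 * W := by ring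
    have h₁ := exec_gateProg g n W w off m B (gs.flatMap BGate.encode) o (by omega)
    have h₂ := exec_finish n W w off 0 m B (gs.flatMap BGate.encode)
      (o ++ gateWord W off w g) (by omega)
    have h₃ := exec_cmds (cs := [.add .W .off, .add .W .off]) (by simp [Cmd.Valid])
      (gs.flatMap BGate.encode) (o ++ gateWord W off w g ++ finishWord W m w)
      (regs n W (w + 1) off 0 0 m 0 0)
    simp only [cmdsWord, cmdsRegs, cmdsCost, Cmd.word, Cmd.regs, Cmd.cost, regs_W, regs_off,
      update_regs_off, List.append_nil] at h₃
    have h₄ := ih (w + 1) (off + W + W) (o ++ gateWord W off w g ++ finishWord W m w)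
      (by omega) (by omega)
    have h := exec_drain_cons (k := .inp) (body := fun a => .seq (gateProg a)
      (.seq finish (cmds [.add .W .off, .add .W .off])))
      (s := st ((g :: gs).flatMap BGate.encode) o (regs n W w off 0 0 m 0 0))
      (a := headSym g) (l := g.encode.tail ++ gs.flatMap BGate.encode)
      (by
        change (g :: gs).flatMap BGate.encode = _
        rw [List.flatMap_cons, encode_eq_headSym_cons]
        rfl)
      (by rw [update_st_inp]; exact h₁.seq (h₂.seq h₃)) h₄
    refine h.cast ?_ ?_
    · congr 1
      · simp [segmentsWord]
      · congr 1
        · simp only [List.length_cons]; omega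
        · simp only [List.length_cons]; omega
    · have e : 1200 * (B + 1) ^ 2 * (gs.length + 1) = 1200 * (B + 1) ^ 2 * gs.length +
        1000 * (B + 1) ^ 2 + 120 * (B + 1) ^ 2 + 80 * (B * B) + 160 * B + 80 := by ring
      simp only [List.length_cons]
      omega

/-- The translation of Boolean circuits to quantum circuits. -/
def translate : Prog Stk :=
  .seq countProg <| .seq headerProg <| .seq (drain (.reg .v) fun _ => finish) <|
    .seq gatesProg <| cmds [.clear .n, .clear .W, .clear .w, .clear .off, .clear .m]

/-- The description of the quantum circuit for a Boolean circuit. -/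
def translateWord (C : BCircuit) : List Sym :=
  let n := C.numInputs
  let m := C.gates.length
  let W := n + m
  encodeNum n ++ encodeNum (W * (2 * m + 1) + m) ++ encodeNum C.out ++
    (List.range n).flatMap (finishWord W m) ++ segmentsWord W m (2 * W) n C.gates

theorem update_nil_eq_st_inp (l : List Sym) :
    Function.update (fun _ => []) Stk.inp l = st l [] (regs 0 0 0 0 0 0 0 0 0) := by
  funext k
  rcases k with _ | _ | _ | r
  · rfl
  · rfl
  · rfl
  · cases r <;> rfl

theorem update_nil_eq_st_out (l : List Sym) :
    Function.update (fun _ => []) Stk.out l.reverse = st [] l (regs 0 0 0 0 0 0 0 0 0) := by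
  funext k
  rcases k with _ | _ | _ | r
  · rfl
  · rfl
  · rfl
  · cases r <;> rfl

theorem length_le_length_flatMap_encode (gs : List BGate) :
    gs.length ≤ (gs.flatMap BGate.encode).length := by
  induction gs with
  | nil => simp
  | cons g gs ih =>
    rw [List.flatMap_cons, encode_eq_headSym_cons]
    simp only [List.length_cons, List.length_append]
    omega

theorem exec_translate (C : BCircuit) :
    Exec translate (Function.update (fun _ => []) Stk.inp C.encode)
      (Function.update (fun _ => []) Stk.out (translateWord C).reverse)
      (2000 * (10 * (C.encode.length + 1) ^ 2 + 1) ^ 2 * (C.encode.length + 1)) := by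
  rw [update_nil_eq_st_inp, update_nil_eq_st_out]
  set L := C.encode.length with hL
  -- One bound for everything the subprograms handle: `n`, `m` and the output wire are at most `L`,
  -- and addresses are at most quadratic in `L` because (n + m) * m is at most L².
  set B := 10 * (L + 1) ^ 2 with hBdef
  obtain ⟨n, gs, b⟩ := C
  have hlen : n + 1 + (b + 1) + (gs.flatMap BGate.encode).length = L := by
    rw [hL]
    simp only [BCircuit.encode, List.length_append, length_encodeNum]
  have hgs := length_le_length_flatMap_encode gs
  have hcount : (BCircuit.encode ⟨n, gs, b⟩).countP isHead = gs.length := by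
    simp only [BCircuit.encode, List.countP_append, countP_encodeNum, countP_flatMap_encode,
      Nat.zero_add]
  have h₁ := exec_countProg (BCircuit.encode ⟨n, gs, b⟩)
  rw [hcount] at h₁
  generalize hm : gs.length = m at *
  generalize hz : (gs.flatMap BGate.encode).length = z at *
  have e₀ : BCircuit.encode ⟨n, gs, b⟩ = encodeNum n ++ (encodeNum b ++ gs.flatMap BGate.encode) := by
    simp [BCircuit.encode]
  have hB : B = 10 * (L * L) + 20 * L + 10 := by rw [hBdef]; ring
  have hLL : L ≤ L * L := Nat.le_mul_self L
  have hWm : (n + m) * m ≤ L * L := Nat.mul_le_mul (by omega) (by omega)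
  have h₂ := exec_headerProg n m b B (gs.flatMap BGate.encode) (by omega)
  have h₃ := exec_inputs n (n + m) (2 * (n + m)) m B (gs.flatMap BGate.encode)
    (encodeNum n ++ encodeNum ((n + m) * (2 * m + 1) + m) ++ encodeNum b) (by omega)
    (by rw [Nat.mul_assoc]; omega)
  have h₄ := exec_gatesProg n (n + m) m B gs n (2 * (n + m))
    (encodeNum n ++ encodeNum ((n + m) * (2 * m + 1) + m) ++ encodeNum b ++
      (List.range n).flatMap (finishWord (n + m) m)) (by omega)
    (by rw [hz, hm, Nat.mul_assoc]; omega)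
  rw [hm] at h₄
  -- The remaining registers are emptied because the machine may only halt with empty work stacks;
  -- `u`, `v`, `cnt` and `acc` are zero already.
  have h₅ := exec_cmds (cs := [.clear .n, .clear .W, .clear .w, .clear .off, .clear .m])
    (by simp [Cmd.Valid]) [] (translateWord ⟨n, gs, b⟩)
    (regs n (n + m) (n + m) (2 * (n + m) + 2 * (n + m) * m) 0 0 m 0 0)
  simp only [cmdsWord, cmdsRegs, cmdsCost, Cmd.word, Cmd.regs, Cmd.cost, regs_n, regs_W, regs_w,
    regs_off, regs_m, update_regs_n, update_regs_W, update_regs_w, update_regs_off,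
    update_regs_m, List.append_nil] at h₅
  have ew : translateWord ⟨n, gs, b⟩ =
      encodeNum n ++ encodeNum ((n + m) * (2 * m + 1) + m) ++ encodeNum b ++
      (List.range n).flatMap (finishWord (n + m) m) ++
      segmentsWord (n + m) m (2 * (n + m)) n gs := by
    simp [translateWord, hm]
  rw [← ew] at h₄
  rw [e₀] at h₁ ⊢
  refine (h₁.seq (h₂.seq (h₃.seq (h₄.seq h₅)))).mono ?_
  rw [← e₀, ← hL]
  have e : 2000 * (B + 1) ^ 2 * (L + 1) = 100 * (B + 1) ^ 2 + 120 * (B + 1) ^ 2 * L +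
      1200 * (B + 1) ^ 2 * L + 680 * ((B + 1) ^ 2 * L) + 1900 * (B + 1) ^ 2 := by ring
  have e₁ : (120 * (B + 1) ^ 2 + 1) * n ≤ 120 * (B + 1) ^ 2 * L + L := by
    calc (120 * (B + 1) ^ 2 + 1) * n ≤ (120 * (B + 1) ^ 2 + 1) * L :=
          Nat.mul_le_mul_left _ (by omega)
      _ = _ := by ring
  have e₂ : 1200 * (B + 1) ^ 2 * m ≤ 1200 * (B + 1) ^ 2 * L := Nat.mul_le_mul_left _ (by omega)
  have e₃ : 1900 * (B + 1) ^ 2 = 1900 * (B * B) + 3800 * B + 1900 := by ring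
  have e₄ : 2 * (n + m) * m = 2 * ((n + m) * m) := by ring
  omega

/-! ## The action of circuits on basis states -/

variable {N : ℕ}

/-- The basis state `|y⟩`. -/
def basis (y : Bits N) : QState N := Pi.single y 1

theorem basis_apply (y z : Bits N) : basis y z = if z = y then 1 else 0 := by
  simp [basis, Pi.single_apply]

/-- The linear map given by a gate. -/
noncomputable def QGate.linearMap (g : QGate N) : QState N →ₗ[ℂ] QState N where
  toFun := g.apply
  map_add' φ ψ := by
    cases g <;> funext y <;> simp only [QGate.apply, Pi.add_apply] <;> ring
  map_smul' c ψ := by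
    cases g <;> funext y <;>
      simp only [QGate.apply, Pi.smul_apply, smul_eq_mul, RingHom.id_apply] <;> ring

/-- The linear map given by a list of gates. -/
noncomputable def applyAll (gs : List (QGate N)) : QState N →ₗ[ℂ] QState N :=
  gs.foldl (fun L g => g.linearMap ∘ₗ L) LinearMap.id

theorem foldl_comp_apply (gs : List (QGate N)) (L : QState N →ₗ[ℂ] QState N) (ψ : QState N) :
    gs.foldl (fun L g => g.linearMap ∘ₗ L) L ψ = gs.foldl (fun φ g => g.apply φ) (L ψ) := by
  induction gs generalizing L with
  | nil => rfl
  | cons g gs ih => exact ih _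

theorem applyAll_apply (gs : List (QGate N)) (ψ : QState N) :
    applyAll gs ψ = gs.foldl (fun φ g => g.apply φ) ψ := foldl_comp_apply gs _ ψ

theorem applyAll_append (gs hs : List (QGate N)) (ψ : QState N) :
    applyAll (gs ++ hs) ψ = applyAll hs (applyAll gs ψ) := by
  simp only [applyAll_apply, List.foldl_append]

/-- The gates send `|y⟩` to `|z⟩`, up to a phase. -/
def Sends (gs : List (QGate N)) (y z : Bits N) : Prop :=
  ∃ c : ℂ, ‖c‖ = 1 ∧ applyAll gs (basis y) = c • basis z

theorem Sends.nil (y : Bits N) : Sends [] y y := ⟨1, by simp, by simp [applyAll]⟩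

theorem Sends.append {gs hs : List (QGate N)} {y z x : Bits N} (h : Sends gs y z)
    (h' : Sends hs z x) : Sends (gs ++ hs) y x := by
  obtain ⟨c, hc, h⟩ := h
  obtain ⟨d, hd, h'⟩ := h'
  refine ⟨c * d, by simp [hc, hd], ?_⟩
  rw [applyAll_append, h, map_smul, h', smul_smul]

theorem Sends.cons {g : QGate N} {hs : List (QGate N)} {y z x : Bits N} (h : Sends [g] y z)
    (h' : Sends hs z x) : Sends (g :: hs) y x := h.append h'

/-- Composition with π moves the basis state at `y` to the preimage of `y`, which is π y for an
involution. -/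
theorem sends_of_comp {g : QGate N} {π : Bits N → Bits N} (hπ : ∀ y, π (π y) = y)
    (hg : ∀ ψ, g.apply ψ = fun y => ψ (π y)) (y : Bits N) : Sends [g] y (π y) := by
  refine ⟨1, by simp, ?_⟩
  rw [applyAll_apply, one_smul]
  change g.apply (basis y) = _
  rw [hg]
  funext z
  simp only [basis_apply]
  have : π z = y ↔ z = π y := ⟨fun h => by rw [← h, hπ], fun h => by rw [h, hπ]⟩
  simp only [this]

theorem flip_flip (t : Fin N) (y : Bits N) : flip t (flip t y) = y := by
  simp [flip]

theorem flip_of_ne {c t : Fin N} (h : c ≠ t) (y : Bits N) : flip t y c = y c := by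
  simp [flip, h]

theorem sends_x (t : Fin N) (y : Bits N) :
    Sends [QGate.x t] y (Function.update y t (!(y t))) :=
  sends_of_comp (flip_flip t) (fun _ => rfl) y

theorem update_xor (t : Fin N) (y : Bits N) (b : Bool) :
    Function.update y t (xor (y t) b) = if b then flip t y else y := by
  cases b <;> simp [flip]

/-- As the target is not a control, the flip does not change the condition on the controls, and the
permutation is an involution. -/
theorem sends_toffoli {cs : List (Fin N)} {t : Fin N} (h : t ∉ cs) (y : Bits N) :
    Sends [QGate.toffoli cs t] y (Function.update y t (xor (y t) (cs.all y))) := by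
  rw [update_xor]
  refine sends_of_comp (π := fun y => if cs.all y then flip t y else y) ?_ (fun _ => rfl) y
  intro y
  have hall : cs.all (flip t y) = cs.all y := by
    rw [Bool.eq_iff_iff, List.all_eq_true, List.all_eq_true]
    refine forall₂_congr fun c hc => ?_
    rw [flip_of_ne (ne_of_mem_of_not_mem hc h)]
  by_cases hy : cs.all y = true
  · simp only [hy, if_true, hall, flip_flip]
  · simp only [hy, Bool.false_eq_true, if_false]

theorem sends_cnot {c t : Fin N} (h : c ≠ t) (y : Bits N) :
    Sends [QGate.cnot c t] y (Function.update y t (xor (y t) (y c))) := by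
  rw [update_xor]
  refine sends_of_comp (π := fun y => if y c then flip t y else y) ?_ (fun _ => rfl) y
  intro y
  by_cases hy : y c = true
  · simp only [hy, if_true, flip_of_ne h, flip_flip]
  · simp only [hy, Bool.false_eq_true, if_false]

theorem sends_fanout {c : Fin N} {ts : List (Fin N)} (h : c ∉ ts) (y : Bits N) :
    Sends [QGate.fanout c ts] y (fun q => if q ∈ ts then xor (y q) (y c) else y q) := by
  refine sends_of_comp (π := fun y q => if q ∈ ts then xor (y q) (y c) else y q) ?_
    (fun _ => rfl) y
  intro y
  funext q
  by_cases hq : q ∈ ts <;> simp [hq, h]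

/-! ### Conjunction of two bits -/

/-- A superposition of `|y⟩` and `|flip t y⟩`. -/
noncomputable def pair (t : Fin N) (y : Bits N) (α β : ℂ) : QState N :=
  α • basis y + β • basis (flip t y)

/-- The phase of a `T` gate. -/
noncomputable def phase : ℂ := Complex.exp (Complex.I * Real.pi / 4)

theorem norm_phase : ‖phase‖ = 1 := by
  have : Complex.I * Real.pi / 4 = ((Real.pi / 4 : ℝ) : ℂ) * Complex.I := by push_cast; ring
  rw [phase, this, Complex.norm_exp_ofReal_mul_I]

theorem phase_pow_four : phase ^ 4 = -1 := by
  rw [phase, ← Complex.exp_nat_mul]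
  have : ((4 : ℕ) : ℂ) * (Complex.I * Real.pi / 4) = Real.pi * Complex.I := by push_cast; ring
  rw [this, Complex.exp_pi_mul_I]

theorem flip_ne_self (t : Fin N) (y : Bits N) : flip t y ≠ y := by
  intro h
  have := congrFun h t
  simp [flip] at this

theorem pair_apply (t : Fin N) (y : Bits N) (α β : ℂ) (z : Bits N) :
    pair t y α β z = if z = y then α else if z = flip t y then β else 0 := by
  simp only [pair, Pi.add_apply, Pi.smul_apply, basis_apply, smul_eq_mul]
  by_cases h : z = y
  · subst h; simp [(flip_ne_self t z).symm]
  · simp [h]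

theorem apply_x_pair (t : Fin N) (y : Bits N) (α β : ℂ) :
    (QGate.x t).apply (pair t y α β) = pair t y β α := by
  funext z
  simp only [QGate.apply, pair_apply]
  have h₁ : flip t z = y ↔ z = flip t y :=
    ⟨fun h => by rw [← h, flip_flip], fun h => by rw [h, flip_flip]⟩
  have h₂ : flip t z = flip t y ↔ z = y :=
    ⟨fun h => by rw [← flip_flip t z, h, flip_flip], fun h => by rw [h]⟩
  simp only [h₁, h₂]
  by_cases h : z = y
  · subst h; simp [(flip_ne_self t z).symm]
  · simp [h]

/-- The control has the same value in both components of the pair, so the gate acts on it either as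
`X` or as the identity. -/
theorem apply_cnot_pair {c t : Fin N} (hc : c ≠ t) (y : Bits N) (α β : ℂ) :
    (QGate.cnot c t).apply (pair t y α β) = if y c then pair t y β α else pair t y α β := by
  have h₀ : ∀ z, (z c ≠ y c) → z ≠ y ∧ z ≠ flip t y := fun z hz =>
    ⟨fun h => hz (by rw [h]), fun h => hz (by rw [h, flip_of_ne hc])⟩
  have hx := apply_x_pair t y α β
  funext z
  have hxz := congrFun hx z
  simp only [QGate.apply] at hxz
  by_cases hz : z c = y c
  · simp only [QGate.apply, hz]
    split_ifs
    · exact hxz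
    · rfl
  · have h₁ := h₀ z hz
    have h₂ := h₀ (flip t z) (by rwa [flip_of_ne hc])
    have e : ∀ α β : ℂ, pair t y α β z = 0 := fun α β => by
      rw [pair_apply, if_neg h₁.1, if_neg h₁.2]
    have e' : pair t y α β (flip t z) = 0 := by rw [pair_apply, if_neg h₂.1, if_neg h₂.2]
    simp only [QGate.apply]
    split_ifs <;> simp only [e, e']

theorem apply_t_pair {t : Fin N} {y : Bits N} (hy : y t = false) (α β : ℂ) :
    (QGate.t t).apply (pair t y α β) = pair t y α (phase * β) := by
  funext z
  simp only [QGate.apply, pair_apply]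
  by_cases h : z = y
  · subst h; simp [hy]
  · by_cases h' : z = flip t y
    · subst h'; simp [flip, hy, phase]
    · simp [h, h']

theorem apply_h_pair {t : Fin N} {y : Bits N} (hy : y t = false) (α β : ℂ) :
    (QGate.h t).apply (pair t y α β) =
      pair t y ((α + β) / (Real.sqrt 2 : ℂ)) ((α - β) / (Real.sqrt 2 : ℂ)) := by
  have hf : flip t y = Function.update y t true := by simp [flip, hy]
  have hyf : Function.update y t false = y := by rw [← hy]; simp
  have hne := flip_ne_self t y
  rw [hf] at hne
  funext z
  simp only [QGate.apply, pair_apply, hf]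
  by_cases h : z = y
  · subst h; simp [hy, hyf, hne]
  · by_cases h' : z = Function.update y t true
    · subst h'; simp [hyf, hne]; ring
    · have key : ∀ b c, Function.update z t b ≠ Function.update y t c := by
        intro b c e
        have ez : ∀ i, i ≠ t → z i = y i := fun i hi => by
          simpa [hi] using congrFun e i
        cases hzt : z t
        · apply h
          funext i
          by_cases hi : i = t
          · rw [hi, hzt, hy]
          · exact ez i hi
        · apply h'
          funext i
          by_cases hi : i = t
          · rw [hi, hzt]; simp
          · simp [hi, ez i hi]
      have k₁ := key false false
      have k₂ := key true false
      rw [hyf] at k₁ k₂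
      simp [h, h', k₁, k₂, key]

/-- Gates that compute the conjunction of `u` and `v` on the qubit `t`, up to a phase. -/
def andBlock (u v t : Fin N) : List (QGate N) :=
  [.h t, .t t, .cnot v t, .x t, .t t, .cnot u t, .x t, .t t, .x t, .cnot v t, .t t, .h t]

/-- Between the two Hadamard gates the target is a pair of amplitudes, which `X` and `CNOT` may swap
and four `T` gates multiply by the phase ω = exp(iπ/4) on the second component. If both controls are
1, all four factors fall on the same component, and ω⁴ = -1 makes the last Hadamard gate return 1.
Otherwise two factors fall on each, leaving the common phase ω² and the bit 0. The phase thus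
depends on the controls, which `Sends` permits. -/
theorem sends_andBlock {u v t : Fin N} (hu : u ≠ t) (hv : v ≠ t) {y : Bits N}
    (hy : y t = false) :
    Sends (andBlock u v t) y (Function.update y t (y u && y v)) := by
  have hb : basis y = pair t y 1 0 := by simp [pair]
  have h2 : (Real.sqrt 2 : ℂ) * (Real.sqrt 2 : ℂ) = 2 := by
    rw [← Complex.ofReal_mul, Real.mul_self_sqrt (by norm_num)]; norm_num
  have h0 : (Real.sqrt 2 : ℂ) ≠ 0 := by
    intro h; rw [h] at h2; norm_num at h2
  have h4 := phase_pow_four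
  have hn := norm_phase
  have hf : flip t y = Function.update y t true := by simp [flip, hy]
  have hyf : Function.update y t false = y := by rw [← hy]; simp
  have hneg : ∀ c α β, α = c → β = 0 → pair t y α β = c • basis y := by
    rintro c α β rfl rfl; simp [pair]
  have hpos : ∀ c α β, α = 0 → β = c → pair t y α β = c • basis (Function.update y t true) := by
    rintro c α β rfl rfl; simp [pair, hf]
  rw [Sends, applyAll_apply, hb]
  cases hyu : y u <;> cases hyv : y v <;>
    simp only [andBlock, List.foldl_cons, List.foldl_nil, Bool.false_eq_true, if_false, if_true, Bool.and_false, Bool.and_true, hyf,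
      apply_t_pair hy, apply_x_pair, apply_cnot_pair hu, apply_cnot_pair hv, apply_h_pair hy,
      hyu, hyv]
  -- Up to the normalisation, the amplitudes before the last Hadamard gate are 1 and ω⁴.
  case true.true =>
    refine ⟨1, by simp, hpos _ _ _ ?_ ?_⟩
    · field_simp; linear_combination h4
    · field_simp; linear_combination (-1) * h4 - h2
  all_goals
    refine ⟨phase ^ 2, by simp [hn], hneg _ _ _ ?_ ?_⟩
    · field_simp; linear_combination (-phase ^ 2) * h2
    · field_simp; ring

/-! ## Values computed along a list of gates -/

theorem length_foldl_snoc {β γ : Type} (F : List β → γ → β) (init : List β) (gs : List γ) :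
    (gs.foldl (fun acc g => acc ++ [F acc g]) init).length = init.length + gs.length := by
  induction gs generalizing init with
  | nil => rfl
  | cons g gs ih => simp [ih]; omega

theorem getD_foldl_snoc_of_lt {β γ : Type} (F : List β → γ → β) (init : List β) (gs : List γ)
    (d : β) {i : ℕ} (hi : i < init.length) :
    (gs.foldl (fun acc g => acc ++ [F acc g]) init).getD i d = init.getD i d := by
  induction gs generalizing init with
  | nil => rfl
  | cons g gs ih =>
    rw [List.foldl_cons, ih _ (by simp; omega), List.getD_append _ _ _ _ hi]

/-- Appending never alters earlier entries and a gate reads only earlier ones, so it may as well be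
evaluated on the final list. The list therefore solves the system of gate equations. The abstract
`F` serves both for bit values and for levels. -/
theorem getD_foldl_snoc {β γ : Type} (F : (ℕ → β) → γ → β) (inputs : γ → List ℕ)
    (hF : ∀ g v v', (∀ i ∈ inputs g, v i = v' i) → F v g = F v' g) (d : β) (init : List β)
    (gs : List γ) (hwf : ∀ (j : ℕ) (h : j < gs.length), ∀ i ∈ inputs gs[j], i < init.length + j)
    (j : ℕ) (hj : j < gs.length) :
    (gs.foldl (fun acc g => acc ++ [F (fun i => acc.getD i d) g]) init).getD
        (init.length + j) d =
      F (fun i => (gs.foldl (fun acc g => acc ++ [F (fun i => acc.getD i d) g]) init).getD i d)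
        gs[j] := by
  induction gs using List.reverseRecOn with
  | nil => simp at hj
  | append_singleton gs g ih =>
    have hlen := length_foldl_snoc (fun acc g => F (fun i => acc.getD i d) g) init gs
    rw [List.foldl_append, List.foldl_cons, List.foldl_nil]
    set L := gs.foldl (fun acc g => acc ++ [F (fun i => acc.getD i d) g]) init with hL
    have hin := hwf j hj
    rw [List.length_append, List.length_singleton] at hj
    have key : ∀ g' : γ, (∀ i ∈ inputs g', i < init.length + j) →
        F (fun i => L.getD i d) g' =
          F (fun i => (L ++ [F (fun i => L.getD i d) g]).getD i d) g' := by
      intro g' hg'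
      refine hF _ _ _ fun i hi => ?_
      rw [List.getD_append _ _ _ _ (by have := hg' i hi; omega)]
    rw [← key _ hin]
    by_cases hj' : j < gs.length
    · have := ih (fun j' h i hi => hwf j' (by simp; omega) i (by
        rwa [List.getElem_append_left h])) hj'
      rw [List.getD_append _ _ _ _ (by omega), this, List.getElem_append_left hj']
    · have e : j = gs.length := by omega
      subst e
      rw [← hlen, List.getD_append_right _ _ _ _ le_rfl]
      simp

theorem BGate.eval_congr (g : BGate) (v v' : ℕ → Bool) (h : ∀ i ∈ g.inputs, v i = v' i) :
    g.eval v = g.eval v' := by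
  cases g with
  | not a => simp [BGate.eval, h a (by simp [BGate.inputs])]
  | bin f a b =>
    simp [BGate.eval, h a (by simp [BGate.inputs]), h b (by simp [BGate.inputs])]
  | and l =>
    simp only [BGate.eval]
    rw [Bool.eq_iff_iff, List.all_eq_true, List.all_eq_true]
    exact forall₂_congr fun i hi => by rw [h i hi]
  | or l =>
    simp only [BGate.eval]
    rw [Bool.eq_iff_iff, List.any_eq_true, List.any_eq_true]
    exact exists_congr fun i => and_congr_right fun hi => by rw [h i hi]

theorem BGate.level_congr (g : BGate) (v v' : ℕ → ℕ) (h : ∀ i ∈ g.inputs, v i = v' i) :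
    g.level v = g.level v' := by
  unfold BGate.level
  congr 1
  exact Finset.sup_congr rfl fun i hi => h i (List.mem_toFinset.1 hi)

namespace BCircuit

variable {C : BCircuit}

theorem WF.values_gate (h : C.WF) (x : Fin C.numInputs → Bool) (j : ℕ)
    (hj : j < C.gates.length) :
    (C.values x).getD (C.numInputs + j) false =
      C.gates[j].eval fun i => (C.values x).getD i false := by
  have := getD_foldl_snoc (fun v (g : BGate) => g.eval v) BGate.inputs BGate.eval_congr false
    (List.ofFn x) C.gates (by simpa using h.1) j hj
  rwa [List.length_ofFn] at this

theorem values_input (x : Fin C.numInputs → Bool) (i : Fin C.numInputs) :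
    (C.values x).getD i false = x i := by
  have := getD_foldl_snoc_of_lt (fun (vals : List Bool) (g : BGate) =>
    g.eval fun i => vals.getD i false) (List.ofFn x) C.gates false (i := i) (by simp)
  rw [values, this, List.getD_eq_getElem _ _ (by simp)]
  simp

theorem WF.levels_gate (h : C.WF) (j : ℕ) (hj : j < C.gates.length) :
    C.levels.getD (C.numInputs + j) 0 = C.gates[j].level fun i => C.levels.getD i 0 := by
  have := getD_foldl_snoc (fun v (g : BGate) => g.level v) BGate.inputs BGate.level_congr 0
    (List.replicate C.numInputs 0) C.gates (by simpa using h.1) j hj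
  rwa [List.length_replicate] at this

end BCircuit

/-! ## The quantum circuit for a Boolean circuit -/

/-- The numbering of qubits: the qubit `q k a` in block `k` belongs to the wire `a`. -/
structure Layout (W m N : ℕ) where
  /-- the qubits -/
  q : ℕ → ℕ → Fin N
  pos : 0 < W
  card : N = W * (2 * m + 2)
  q_val : ∀ k a, k < 2 * m + 2 → a < W → (q k a : ℕ) = a + W * k

namespace Layout

variable {W m N : ℕ}

/-- The block of a qubit. -/
def blk (_ : Layout W m N) (i : Fin N) : ℕ := i / W

/-- The wire to which a qubit belongs. -/
def wire (_ : Layout W m N) (i : Fin N) : ℕ := i % W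

variable (ℓ : Layout W m N)

theorem blk_lt (i : Fin N) : ℓ.blk i < 2 * m + 2 := by
  have := ℓ.card
  exact Nat.div_lt_of_lt_mul (this ▸ i.2)

theorem eq_q_iff {k a : ℕ} (hk : k < 2 * m + 2) (ha : a < W) (i : Fin N) :
    i = ℓ.q k a ↔ ℓ.blk i = k ∧ ℓ.wire i = a := by
  have hv := ℓ.q_val k a hk ha
  constructor
  · rintro rfl
    unfold blk wire
    rw [hv]
    exact ⟨by rw [Nat.add_mul_div_left _ _ ℓ.pos, Nat.div_eq_of_lt ha, Nat.zero_add],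
      by rw [Nat.add_mul_mod_self_left, Nat.mod_eq_of_lt ha]⟩
  · rintro ⟨h₁, h₂⟩
    apply Fin.ext
    rw [hv, ← h₁, ← h₂]
    exact (Nat.mod_add_div _ _).symm

theorem blk_q {k a : ℕ} (hk : k < 2 * m + 2) (ha : a < W) : ℓ.blk (ℓ.q k a) = k :=
  ((ℓ.eq_q_iff hk ha _).1 rfl).1

theorem wire_q {k a : ℕ} (hk : k < 2 * m + 2) (ha : a < W) : ℓ.wire (ℓ.q k a) = a :=
  ((ℓ.eq_q_iff hk ha _).1 rfl).2

theorem q_inj {k k' a a' : ℕ} (hk : k < 2 * m + 2) (ha : a < W) (hk' : k' < 2 * m + 2)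
    (ha' : a' < W) : ℓ.q k a = ℓ.q k' a' ↔ k = k' ∧ a = a' := by
  rw [ℓ.eq_q_iff hk' ha', ℓ.blk_q hk ha, ℓ.wire_q hk ha]

end Layout

/-- Gates for a gate of fan-in two; the qubit `v` holds the negation of the second input. -/
def binBlock {N : ℕ} (f : Bool → Bool → Bool) (u v t : Fin N) : List (QGate N) :=
  (if xor (xor (f false false) (f false true)) (xor (f true false) (f true true)) then
    andBlock u v t else []) ++
  (if xor (f true true) (f false true) then [.cnot u t] else []) ++
  (if xor (f false false) (f false true) then [.cnot v t] else []) ++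
  (if f false true then [.x t] else [])

/-- The gates that compute a gate of a Boolean circuit on the wire `w`, reading the copies of the
input wires in the blocks `k` and `k + 1`. -/
def gateBlock {N : ℕ} (q : ℕ → ℕ → Fin N) (k w : ℕ) : BGate → List (QGate N)
  | .not a => [.cnot (q (k + 1) a) (q 0 w)]
  | .bin f a b => binBlock f (q k a) (q (k + 1) b) (q 0 w)
  | .and l => [.toffoli (l.map (q k)) (q 0 w)]
  | .or l => [.toffoli (l.map (q (k + 1))) (q 0 w), .x (q 0 w)]

/-- The qubits that receive the copies of a wire (`p = 0`) or of its negation (`p = 1`). -/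
def copies {N : ℕ} (q : ℕ → ℕ → Fin N) (m p w : ℕ) : List (Fin N) :=
  (List.range m).map fun j => q (2 * (j + 1) + p) w

/-- The gates that negate a wire and copy the wire and its negation. -/
def finishBlock {N : ℕ} (q : ℕ → ℕ → Fin N) (m w : ℕ) : List (QGate N) :=
  [.cnot (q 0 w) (q 1 w), .x (q 1 w), .fanout (q 0 w) (copies q m 0 w),
    .fanout (q 1 w) (copies q m 1 w)]

/-- The gates for a list of gates of a Boolean circuit. -/
def segments {N : ℕ} (q : ℕ → ℕ → Fin N) (m : ℕ) : ℕ → ℕ → List BGate → List (QGate N)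
  | _, _, [] => []
  | k, w, g :: gs => gateBlock q k w g ++ finishBlock q m w ++ segments q m (k + 2) (w + 1) gs

/-! ### Description -/

section encode

variable {W m N : ℕ} (ℓ : Layout W m N)

theorem encode_andBlock (u v t : Fin N) :
    (andBlock u v t).flatMap QGate.encode = andWord u v t := by
  simp [andBlock, andWord, QGate.encode, xWord, hWord, tWord, cnotWord]

theorem encode_binBlock (f : Bool → Bool → Bool) (u v t : Fin N) :
    (binBlock f u v t).flatMap QGate.encode =
      binWord (f false false) (f false true) (f true false) (f true true) u v t := by
  have e {b : Bool} {x y : List (QGate N)} : (if b then x else y).flatMap QGate.encode =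
      if b then x.flatMap QGate.encode else y.flatMap QGate.encode := by cases b <;> rfl
  simp only [binBlock, binWord, List.flatMap_append, e, encode_andBlock, List.flatMap_singleton,
    List.flatMap_nil]
  rfl

theorem encode_gateBlock {k w : ℕ} (hk : k + 1 < 2 * m + 2) (hw : w < W) (g : BGate)
    (hg : ∀ a ∈ g.inputs, a < W) :
    (gateBlock ℓ.q k w g).flatMap QGate.encode = gateWord W (W * k) w g := by
  have h₀ : (ℓ.q 0 w : ℕ) = w := by rw [ℓ.q_val _ _ (by omega) hw, Nat.mul_zero, Nat.add_zero]
  have h₁ : ∀ a < W, (ℓ.q k a : ℕ) = a + W * k := fun a ha => ℓ.q_val _ _ (by omega) ha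
  have h₂ : ∀ a < W, (ℓ.q (k + 1) a : ℕ) = a + (W * k + W) := fun a ha => by
    rw [ℓ.q_val _ _ hk ha, Nat.mul_add, Nat.mul_one]
  cases g with
  | not a =>
    have ha := hg a (by simp [BGate.inputs])
    simp [gateBlock, gateWord, QGate.encode, cnotWord, h₀, h₂ a ha]
  | bin f a b =>
    have ha := hg a (by simp [BGate.inputs])
    have hb := hg b (by simp [BGate.inputs])
    simp only [gateBlock, encode_binBlock, gateWord, h₀, h₁ a ha, h₂ b hb, Nat.add_assoc]
  | and l =>
    have : (l.map (ℓ.q k)).map Fin.val = l.map fun a => a + W * k := by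
      rw [List.map_map]
      exact List.map_congr_left fun a ha => h₁ a (hg a ha)
    simp only [gateBlock, List.flatMap_singleton, QGate.encode, this, h₀, gateWord]
  | or l =>
    have : (l.map (ℓ.q (k + 1))).map Fin.val = l.map fun a => a + (W * k + W) := by
      rw [List.map_map]
      exact List.map_congr_left fun a ha => h₂ a (hg a ha)
    simp only [gateBlock, List.flatMap_cons, List.flatMap_nil, List.append_nil, QGate.encode,
      this, h₀, gateWord, xWord]

theorem encode_finishBlock {w : ℕ} (hw : w < W) :
    (finishBlock ℓ.q m w).flatMap QGate.encode = finishWord W m w := by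
  have h₀ : (ℓ.q 0 w : ℕ) = w := by rw [ℓ.q_val _ _ (by omega) hw, Nat.mul_zero, Nat.add_zero]
  have h₁ : (ℓ.q 1 w : ℕ) = w + W := by rw [ℓ.q_val _ _ (by omega) hw, Nat.mul_one]
  have e : ∀ p < 2, (copies ℓ.q m p w).map Fin.val =
      (List.range m).map fun j => w + W * p + 2 * W * (j + 1) := by
    intro p hp
    rw [copies, List.map_map]
    refine List.map_congr_left fun j hj => ?_
    rw [Function.comp_apply, ℓ.q_val _ _ (by have := List.mem_range.1 hj; omega) hw]
    ring
  have e₀ := e 0 (by omega)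
  have e₁ := e 1 (by omega)
  rw [Nat.mul_zero, Nat.add_zero] at e₀
  rw [Nat.mul_one] at e₁
  simp [finishBlock, finishWord, QGate.encode, cnotWord, xWord, fanWord, h₀, h₁, e₀, e₁]

theorem encode_segments (gs : List BGate) : ∀ k w : ℕ, k + 2 * gs.length ≤ 2 * m + 2 →
    w + gs.length ≤ W → (∀ g ∈ gs, ∀ a ∈ g.inputs, a < W) →
    (segments ℓ.q m k w gs).flatMap QGate.encode = segmentsWord W m (W * k) w gs := by
  induction gs with
  | nil => intros; rfl
  | cons g gs ih =>
    intro k w hk hw hg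
    rw [List.length_cons] at hk hw
    have e : W * k + W + W = W * (k + 2) := by ring
    rw [segments, segmentsWord, List.flatMap_append, List.flatMap_append,
      encode_gateBlock ℓ (by omega) (by omega) g (hg g (by simp)),
      encode_finishBlock ℓ (by omega), e,
      ih _ _ (by omega) (by omega) fun g' hg' => hg g' (by simp [hg'])]

end encode

/-! ### Action on basis states -/

section sends

variable {N : ℕ}

theorem Sends.congr {gs : List (QGate N)} {y z z' : Bits N} (h : Sends gs y z) (e : z = z') :
    Sends gs y z' := e ▸ h

theorem sends_ite_cnot {c t : Fin N} (h : c ≠ t) (b : Bool) (y : Bits N) :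
    Sends (if b then [QGate.cnot c t] else []) y
      (Function.update y t (xor (y t) (b && y c))) := by
  cases b
  · simpa using Sends.nil y
  · simpa using sends_cnot h y

theorem sends_ite_x (t : Fin N) (b : Bool) (y : Bits N) :
    Sends (if b then [QGate.x t] else []) y (Function.update y t (xor (y t) b)) := by
  cases b
  · simpa using Sends.nil y
  · simpa using sends_x t y

/-- This is the algebraic normal form over F₂ of `f` as a function of u and v, where v is the
negated second input: the constant term is f(0,1), the coefficients of u and v are f(1,1) + f(0,1)
and f(0,0) + f(0,1), and that of uv is the sum of all four values. The product comes first because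
it needs a target equal to 0. -/
theorem sends_binBlock (f : Bool → Bool → Bool) {u v t : Fin N} (hu : u ≠ t) (hv : v ≠ t)
    {y : Bits N} (hy : y t = false) :
    Sends (binBlock f u v t) y (Function.update y t (f (y u) (!(y v)))) := by
  have h₁ : ∀ b : Bool, Sends (if b then andBlock u v t else []) y
      (Function.update y t (b && (y u && y v))) := by
    intro b
    cases b
    · refine (Sends.nil y).congr ?_
      rw [Bool.false_and, ← hy, Function.update_eq_self]
    · simpa using sends_andBlock hu hv hy
  refine ((((h₁ _).append (sends_ite_cnot hu _ _)).append (sends_ite_cnot hv _ _)).append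
    (sends_ite_x t _ _)).congr ?_
  simp only [Function.update_self, Function.update_idem, Function.update_of_ne hu,
    Function.update_of_ne hv]
  congr 1
  cases y u <;> cases y v <;> simp only [Bool.not_true, Bool.not_false] <;>
    generalize f false false = a <;> generalize f false true = b <;>
    generalize f true false = c <;> generalize f true true = d <;>
    revert a b c d <;> decide

variable {W m : ℕ} (ℓ : Layout W m N)

/-- Negation is a `CNOT` from the negated copy, and OR is the negated conjunction of the negated
copies. Since k is at least 2, no copy coincides with the target in block 0. -/
theorem sends_gateBlock {k w : ℕ} (hk : 2 ≤ k) (hk' : k + 1 < 2 * m + 2) (hw : w < W)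
    (g : BGate) (hg : ∀ a ∈ g.inputs, a < W) (y : Bits N) (v : ℕ → Bool)
    (h₀ : y (ℓ.q 0 w) = false) (h₁ : ∀ a ∈ g.inputs, y (ℓ.q k a) = v a)
    (h₂ : ∀ a ∈ g.inputs, y (ℓ.q (k + 1) a) = !(v a)) :
    Sends (gateBlock ℓ.q k w g) y (Function.update y (ℓ.q 0 w) (g.eval v)) := by
  have n₁ : ∀ a ∈ g.inputs, ℓ.q k a ≠ ℓ.q 0 w := fun a ha h => by
    have := (ℓ.q_inj (by omega) (hg a ha) (by omega) hw).1 h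
    omega
  have n₂ : ∀ a ∈ g.inputs, ℓ.q (k + 1) a ≠ ℓ.q 0 w := fun a ha h => by
    have := (ℓ.q_inj (by omega) (hg a ha) (by omega) hw).1 h
    omega
  cases g with
  | not a =>
    have ha : a ∈ (BGate.not a).inputs := by simp [BGate.inputs]
    refine (sends_cnot (n₂ a ha) y).congr ?_
    simp [h₀, h₂ a ha, BGate.eval]
  | bin f a b =>
    have ha : a ∈ (BGate.bin f a b).inputs := by simp [BGate.inputs]
    have hb : b ∈ (BGate.bin f a b).inputs := by simp [BGate.inputs]
    refine (sends_binBlock f (n₁ a ha) (n₂ b hb) h₀).congr ?_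
    simp [h₁ a ha, h₂ b hb, BGate.eval]
  | and l =>
    refine (sends_toffoli (fun h => ?_) y).congr ?_
    · obtain ⟨a, ha, h⟩ := List.mem_map.1 h
      exact n₁ a ha h
    · rw [h₀, Bool.false_xor, List.all_map]
      congr 1
      simp only [BGate.eval]
      rw [Bool.eq_iff_iff, List.all_eq_true, List.all_eq_true]
      exact forall₂_congr fun a ha => by rw [Function.comp_apply, h₁ a ha]
  | or l =>
    refine ((sends_toffoli (fun h => ?_) y).cons (sends_x _ _)).congr ?_
    · obtain ⟨a, ha, h⟩ := List.mem_map.1 h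
      exact n₂ a ha h
    · rw [Function.update_self, Function.update_idem, h₀, Bool.false_xor, List.all_map]
      congr 1
      simp only [BGate.eval]
      have e : l.all (y ∘ ℓ.q (k + 1)) = l.all fun a => !(v a) := by
        rw [Bool.eq_iff_iff, List.all_eq_true, List.all_eq_true]
        exact forall₂_congr fun a ha => by rw [Function.comp_apply, h₂ a ha]
      rw [e, List.not_all_eq_any_not]
      simp

/-- The basis state when the wires below `w` have been completed. -/
def stateAt (n : ℕ) (v : ℕ → Bool) (w : ℕ) : Bits N := fun i =>
  if ℓ.wire i < w then xor (v (ℓ.wire i)) (decide (ℓ.blk i % 2 = 1))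
  else decide (ℓ.blk i = 0 ∧ ℓ.wire i < n) && v (ℓ.wire i)

theorem mem_copies {p w : ℕ} (hp : p < 2) (hw : w < W) (i : Fin N) :
    i ∈ copies ℓ.q m p w ↔ ℓ.wire i = w ∧ ℓ.blk i % 2 = p ∧ 2 ≤ ℓ.blk i := by
  have hb := ℓ.blk_lt i
  simp only [copies, List.mem_map, List.mem_range]
  constructor
  · rintro ⟨j, hj, h⟩
    have := (ℓ.eq_q_iff (by omega) hw i).1 h.symm
    omega
  · rintro ⟨h₁, h₂, h₃⟩
    refine ⟨ℓ.blk i / 2 - 1, by omega, ?_⟩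
    exact ((ℓ.eq_q_iff (by omega) hw i).2 ⟨by omega, h₁⟩).symm

/-- On wire `w` every qubit outside block 0 is still 0, so adding the control by `CNOT` or fanout
amounts to copying. Block 1 receives the negation, the even blocks from 2 on the value and the odd
ones the negation; other wires are not touched. -/
theorem sends_finishBlock (n : ℕ) (v : ℕ → Bool) {w : ℕ} (hw : w < W) :
    Sends (finishBlock ℓ.q m w)
      (Function.update (stateAt ℓ n v w) (ℓ.q 0 w) (v w)) (stateAt ℓ n v (w + 1)) := by
  have n₀ : ℓ.q 0 w ≠ ℓ.q 1 w := fun h => by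
    have := (ℓ.q_inj (by omega) hw (by omega) hw).1 h
    omega
  have m₀ : ℓ.q 0 w ∉ copies ℓ.q m 0 w := fun h => by
    have := (mem_copies ℓ (by omega) hw _).1 h
    rw [ℓ.blk_q (by omega) hw] at this
    omega
  have m₁ : ℓ.q 1 w ∉ copies ℓ.q m 1 w := fun h => by
    have := (mem_copies ℓ (by omega) hw _).1 h
    rw [ℓ.blk_q (by omega) hw] at this
    omega
  have m₂ : ℓ.q 1 w ∉ copies ℓ.q m 0 w := fun h => by
    have := (mem_copies ℓ (by omega) hw _).1 h
    rw [ℓ.blk_q (by omega) hw] at this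
    omega
  have s₁ : stateAt ℓ n v w (ℓ.q 1 w) = false := by
    simp [stateAt, ℓ.blk_q (show 1 < 2 * m + 2 by omega) hw,
      ℓ.wire_q (show 1 < 2 * m + 2 by omega) hw]
  refine ((sends_cnot n₀ _).cons <| (sends_x _ _).cons <|
    (sends_fanout m₀ _).cons (sends_fanout m₁ _)).congr ?_
  funext i
  simp only [Function.update_self, Function.update_idem, Function.update_of_ne n₀,
    Function.update_of_ne n₀.symm, s₁, if_neg m₂, Bool.false_xor]
  have c₀ := mem_copies ℓ (p := 0) (by omega) hw i
  have c₁ := mem_copies ℓ (p := 1) (by omega) hw i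
  have e₀ := ℓ.eq_q_iff (k := 0) (by omega) hw i
  have e₁ := ℓ.eq_q_iff (k := 1) (by omega) hw i
  by_cases hi : ℓ.wire i = w
  · simp only [hi, true_and, and_true] at c₀ c₁ e₀ e₁
    have hs : stateAt ℓ n v (w + 1) i = xor (v w) (decide (ℓ.blk i % 2 = 1)) := by
      simp [stateAt, hi]
    have hs' : 0 < ℓ.blk i → stateAt ℓ n v w i = false := by
      intro h
      simp [stateAt, hi]
      omega
    rw [hs]
    rcases Nat.lt_or_ge (ℓ.blk i) 2 with hb | hb
    · have k₀ : i ∉ copies ℓ.q m 0 w := by rw [c₀]; omega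
      have k₁ : i ∉ copies ℓ.q m 1 w := by rw [c₁]; omega
      simp only [k₀, k₁, if_false]
      rcases Nat.eq_zero_or_pos (ℓ.blk i) with hb' | hb'
      · rw [e₀.2 hb', Function.update_of_ne n₀, Function.update_self]
        simp [← e₀.2 hb', hb']
      · have hb'' : ℓ.blk i = 1 := by omega
        rw [e₁.2 hb'', Function.update_self]
        simp [← e₁.2 hb'', hb'']
    · have n₁ : i ≠ ℓ.q 0 w := fun h => by have := e₀.1 h; omega
      have n₂ : i ≠ ℓ.q 1 w := fun h => by have := e₁.1 h; omega
      rw [Function.update_of_ne n₂, Function.update_of_ne n₁, hs' (by omega)]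
      rcases Nat.mod_two_eq_zero_or_one (ℓ.blk i) with hp | hp
      · have k₀ : i ∈ copies ℓ.q m 0 w := c₀.2 ⟨hp, hb⟩
        have k₁ : i ∉ copies ℓ.q m 1 w := by rw [c₁]; omega
        simp [k₀, k₁, hp]
      · have k₀ : i ∉ copies ℓ.q m 0 w := by rw [c₀]; omega
        have k₁ : i ∈ copies ℓ.q m 1 w := c₁.2 ⟨hp, hb⟩
        simp [k₀, k₁, hp]
  · have k₀ : i ∉ copies ℓ.q m 0 w := by rw [c₀]; tauto
    have k₁ : i ∉ copies ℓ.q m 1 w := by rw [c₁]; tauto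
    have n₁ : i ≠ ℓ.q 0 w := fun h => hi (e₀.1 h).2
    have n₂ : i ≠ ℓ.q 1 w := fun h => hi (e₁.1 h).2
    simp only [k₀, k₁, if_false, Function.update_of_ne n₂, Function.update_of_ne n₁, stateAt]
    have : ℓ.wire i < w + 1 ↔ ℓ.wire i < w := by omega
    simp only [this]

theorem sends_inputs (n : ℕ) (v : ℕ → Bool) (hn : n ≤ W) :
    Sends ((List.range n).flatMap (finishBlock ℓ.q m)) (stateAt ℓ n v 0) (stateAt ℓ n v n) := by
  have : ∀ w ≤ n, Sends ((List.range w).flatMap (finishBlock ℓ.q m)) (stateAt ℓ n v 0)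
      (stateAt ℓ n v w) := by
    intro w
    induction w with
    | zero => intro _; exact Sends.nil _
    | succ w ih =>
      intro hw
      rw [List.range_succ, List.flatMap_append, List.flatMap_singleton]
      refine (ih (by omega)).append ?_
      have h := sends_finishBlock ℓ n v (w := w) (by omega)
      -- An input wire holds its value in block 0 from the start, so the update in
      -- `sends_finishBlock` is vacuous here.
      have e : stateAt ℓ n v w (ℓ.q 0 w) = v w := by
        have hw' : w < W := by omega
        simp [stateAt, ℓ.blk_q (show 0 < 2 * m + 2 by omega) hw',
          ℓ.wire_q (show 0 < 2 * m + 2 by omega) hw']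
        intro; omega
      rwa [← e, Function.update_eq_self] at h
  exact this n le_rfl

/-- The values `v` of all wires are fixed beforehand and only required to solve the gate equations,
so that nothing has to be recomputed in the induction. Evenness of `k` identifies blocks `k` and `k
+ 1` as plain and negated copies. -/
theorem sends_segments (n : ℕ) (v : ℕ → Bool) (gs : List BGate) : ∀ k w : ℕ, 2 ≤ k →
    k % 2 = 0 → k + 2 * gs.length ≤ 2 * m + 2 → n ≤ w → w + gs.length ≤ W →
    (∀ (j : ℕ) (h : j < gs.length), ∀ a ∈ gs[j].inputs, a < w + j) →
    (∀ (j : ℕ) (h : j < gs.length), v (w + j) = gs[j].eval v) →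
    Sends (segments ℓ.q m k w gs) (stateAt ℓ n v w) (stateAt ℓ n v (w + gs.length)) := by
  induction gs with
  | nil => intros; exact Sends.nil _
  | cons g gs ih =>
    intro k w hk hk₂ hk' hn hw hin hv
    rw [List.length_cons] at hk' hw
    have hg : ∀ a ∈ g.inputs, a < w := hin 0 (by simp)
    have hvw : v w = g.eval v := hv 0 (by simp)
    have s₁ := sends_gateBlock ℓ (k := k) (w := w) hk (by omega) (by omega) g
      (fun a ha => by have := hg a ha; omega) (stateAt ℓ n v w) v
      (by
        have hw' : w < W := by omega
        simp [stateAt, ℓ.blk_q (show 0 < 2 * m + 2 by omega) hw',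
          ℓ.wire_q (show 0 < 2 * m + 2 by omega) hw']
        intro; omega)
      (fun a ha => by
        have ha' := hg a ha
        have haW : a < W := by omega
        simp [stateAt, ℓ.blk_q (show k < 2 * m + 2 by omega) haW,
          ℓ.wire_q (show k < 2 * m + 2 by omega) haW, ha', hk₂])
      (fun a ha => by
        have ha' := hg a ha
        have haW : a < W := by omega
        have : (k + 1) % 2 = 1 := by omega
        simp [stateAt, ℓ.blk_q (show k + 1 < 2 * m + 2 by omega) haW,
          ℓ.wire_q (show k + 1 < 2 * m + 2 by omega) haW, ha', this])
    rw [← hvw] at s₁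
    have s₂ := sends_finishBlock ℓ n v (w := w) (by omega)
    have s₃ := ih (k + 2) (w + 1) (by omega) (by omega) (by omega) (by omega) (by omega)
      (fun j hj a ha => by
        have := hin (j + 1) (by simpa using hj) a (by simpa using ha)
        omega)
      (fun j hj => by
        have := hv (j + 1) (by simpa using hj)
        rw [show w + 1 + j = w + (j + 1) by omega, this]
        simp)
    rw [List.length_cons, show w + (gs.length + 1) = w + 1 + gs.length by omega]
    exact (s₁.append s₂).append s₃

end sends

/-! ### Well-formedness -/

section wellFormed

variable {N : ℕ}

/-- The ancillas that a fanout gate initialises. -/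
def fanTargets : QGate N → List (Fin N)
  | .fanout _ ts => ts
  | _ => []

theorem fanTargets_subset (g : QGate N) : fanTargets g ⊆ g.targets := by
  cases g <;> simp [fanTargets, QGate.targets]

/-- The gate `g'` may follow the gate `g`. -/
def MayFollow (g g' : QGate N) : Prop :=
  (∀ i ∈ fanTargets g', i ∉ g.qubits) ∧ ∀ i ∈ fanTargets g, i ∉ g'.targets

/-- Classical fanout speaks of all splittings of the gate list; the pairwise form is compatible with
concatenation and can be proved block by block. -/
theorem classicalFanout_of_pairwise (Q : QCircuit) (h : Q.gates.Pairwise MayFollow)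
    (h' : ∀ g ∈ Q.gates, ∀ i ∈ fanTargets g, Q.numInputs ≤ i.val) : Q.ClassicalFanout := by
  intro pre post c ts e q hq
  have hmem : QGate.fanout c ts ∈ Q.gates := by rw [e]; simp
  rw [e, List.pairwise_append, List.pairwise_cons] at h
  exact ⟨h' _ hmem q hq, fun g hg => (h.2.2 g hg (.fanout c ts) (by simp)).1 q hq,
    fun g hg => (h.2.1.1 g hg).2 q hq⟩

variable {W m : ℕ} (ℓ : Layout W m N)

/-- A gate that acts on the wire `w` and otherwise uses earlier wires. -/
def ActsOn (w : ℕ) (g : QGate N) : Prop :=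
  (∀ i ∈ g.targets, ℓ.wire i = w) ∧ ∀ i ∈ g.qubits, ℓ.wire i ≤ w

variable {ℓ}

/-- A gate for wire `w` touches no higher wire, hence no fanout target of a later one; a gate for
`w'` has all its targets on `w'`, hence none among earlier fanout targets. -/
theorem ActsOn.mayFollow {w w' : ℕ} (hw : w < w') {g g' : QGate N} (h : ActsOn ℓ w g)
    (h' : ActsOn ℓ w' g') : MayFollow g g' := by
  refine ⟨fun i hi hi' => ?_, fun i hi hi' => ?_⟩
  · have := h'.1 i (fanTargets_subset g' hi)
    have := h.2 i hi'
    omega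
  · have := h.1 i (fanTargets_subset g hi)
    have := h'.1 i hi'
    omega

variable (ℓ)

theorem mem_andBlock {u v t : Fin N} {g : QGate N} (h : g ∈ andBlock u v t) :
    g.targets = [t] ∧ (∀ i ∈ g.controls, i = u ∨ i = v) ∧ fanTargets g = [] ∧
      g.isToffoli = false ∧ g.controls.Nodup := by
  simp only [andBlock, List.mem_cons, List.not_mem_nil, or_false] at h
  rcases h with rfl | rfl | rfl | rfl | rfl | rfl | rfl | rfl | rfl | rfl | rfl | rfl <;>
    simp [QGate.targets, QGate.controls, fanTargets, QGate.isToffoli]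

theorem mem_binBlock {f : Bool → Bool → Bool} {u v t : Fin N} {g : QGate N}
    (h : g ∈ binBlock f u v t) :
    g.targets = [t] ∧ (∀ i ∈ g.controls, i = u ∨ i = v) ∧ fanTargets g = [] ∧
      g.isToffoli = false ∧ g.controls.Nodup := by
  simp only [binBlock, List.mem_append] at h
  rcases h with ((h | h) | h) | h <;> split_ifs at h
  · exact mem_andBlock h
  · simp at h
  all_goals
    first
    | (simp only [List.mem_singleton] at h; subst h
       simp [QGate.targets, QGate.controls, fanTargets, QGate.isToffoli])
    | simp at h

/-- A Toffoli gate needs distinct controls: here the condition that a large gate reads each wire at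
most once is used, together with injectivity of the numbering within a block. -/
theorem mem_gateBlock {k w : ℕ} (hk : k + 1 < 2 * m + 2) {g : BGate}
    (hg : ∀ a ∈ g.inputs, a < W) (hnd : g.isLarge = true → g.inputs.Nodup) {h : QGate N}
    (hh : h ∈ gateBlock ℓ.q k w g) :
    h.targets = [ℓ.q 0 w] ∧
      (∀ i ∈ h.controls, ∃ a ∈ g.inputs, i = ℓ.q k a ∨ i = ℓ.q (k + 1) a) ∧
      fanTargets h = [] ∧ h.controls.Nodup := by
  have key : ∀ l : List ℕ, (∀ a ∈ l, a < W) → l.Nodup → ∀ k' < 2 * m + 2,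
      (l.map (ℓ.q k')).Nodup := fun l hl hnd k' hk' =>
    List.Nodup.map_on (fun a ha b hb e =>
      ((ℓ.q_inj hk' (hl a ha) hk' (hl b hb)).1 e).2) hnd
  cases g with
  | not a =>
    simp only [gateBlock, List.mem_singleton] at hh
    subst hh
    simp [QGate.targets, QGate.controls, fanTargets, BGate.inputs]
  | bin f a b =>
    obtain ⟨h₁, h₂, h₃, -, h₄⟩ := mem_binBlock hh
    refine ⟨h₁, fun i hi => ?_, h₃, h₄⟩
    rcases h₂ i hi with h | h
    · exact ⟨a, by simp [BGate.inputs], Or.inl h⟩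
    · exact ⟨b, by simp [BGate.inputs], Or.inr h⟩
  | and l =>
    simp only [gateBlock, List.mem_singleton] at hh
    subst hh
    refine ⟨rfl, fun i hi => ?_, rfl, key l hg (hnd rfl) k (by omega)⟩
    obtain ⟨a, ha, rfl⟩ := List.mem_map.1 hi
    exact ⟨a, ha, Or.inl rfl⟩
  | or l =>
    simp only [gateBlock, List.mem_cons, List.not_mem_nil, or_false] at hh
    rcases hh with rfl | rfl
    · refine ⟨rfl, fun i hi => ?_, rfl, key l hg (hnd rfl) (k + 1) (by omega)⟩
      obtain ⟨a, ha, rfl⟩ := List.mem_map.1 hi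
      exact ⟨a, ha, Or.inr rfl⟩
    · simp [QGate.targets, QGate.controls, fanTargets]

theorem nodup_copies {p w : ℕ} (hp : p < 2) (hw : w < W) : (copies ℓ.q m p w).Nodup := by
  refine List.Nodup.map_on (fun i hi j hj e => ?_) List.nodup_range
  have hi := List.mem_range.1 hi
  have hj := List.mem_range.1 hj
  have := (ℓ.q_inj (by omega) hw (by omega) hw).1 e
  omega

/-- All four gates stay on one wire and are told apart by blocks: the first two use blocks 0 and 1,
while the fanout targets lie in blocks from 2 on, with different parities. -/
theorem pairwise_finishBlock {w : ℕ} (hw : w < W) :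
    (∀ g ∈ finishBlock ℓ.q m w, g.WF ∧ ActsOn ℓ w g ∧ (∀ i ∈ g.qubits, ℓ.wire i = w) ∧
      g.isToffoli = false ∧ ∀ i ∈ fanTargets g, 2 ≤ ℓ.blk i) ∧
    (finishBlock ℓ.q m w).Pairwise MayFollow := by
  have b₀ := ℓ.blk_q (show 0 < 2 * m + 2 by omega) hw
  have b₁ := ℓ.blk_q (show 1 < 2 * m + 2 by omega) hw
  have w₀ := ℓ.wire_q (show 0 < 2 * m + 2 by omega) hw
  have w₁ := ℓ.wire_q (show 1 < 2 * m + 2 by omega) hw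
  have n₀ : ℓ.q 0 w ≠ ℓ.q 1 w := fun h => by rw [h, b₁] at b₀; omega
  have c₀ := fun i => (mem_copies ℓ (p := 0) (by omega) hw i).1
  have c₁ := fun i => (mem_copies ℓ (p := 1) (by omega) hw i).1
  have m₀ : ℓ.q 0 w ∉ copies ℓ.q m 0 w := fun h => by have := c₀ _ h; omega
  have m₁ : ℓ.q 1 w ∉ copies ℓ.q m 1 w := fun h => by have := c₁ _ h; omega
  have m₂ : ℓ.q 1 w ∉ copies ℓ.q m 0 w := fun h => by have := c₀ _ h; omega
  have m₃ : ℓ.q 0 w ∉ copies ℓ.q m 1 w := fun h => by have := c₁ _ h; omega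
  have d₀ := nodup_copies ℓ (p := 0) (by omega) hw
  have d₁ := nodup_copies ℓ (p := 1) (by omega) hw
  constructor
  · intro g hg
    have hwire : ∀ i ∈ g.qubits, ℓ.wire i = w := by
      simp only [finishBlock, List.mem_cons, List.not_mem_nil, or_false] at hg
      rcases hg with rfl | rfl | rfl | rfl <;>
        simp only [QGate.qubits, QGate.controls, QGate.targets, List.cons_append,
          List.nil_append, List.mem_cons, List.not_mem_nil, or_false]
      · rintro i (rfl | rfl) <;> assumption
      · rintro i rfl; assumption
      · rintro i (rfl | h)
        · assumption
        · exact (c₀ i h).1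
      · rintro i (rfl | h)
        · assumption
        · exact (c₁ i h).1
    refine ⟨?_, ⟨fun i hi => hwire i (List.mem_append_right _ hi),
      fun i hi => (hwire i hi).le⟩, hwire, ?_, ?_⟩
    · simp only [finishBlock, List.mem_cons, List.not_mem_nil, or_false] at hg
      rcases hg with rfl | rfl | rfl | rfl <;>
        simp [QGate.WF, QGate.qubits, QGate.controls, QGate.targets, n₀, m₀, m₁, d₀, d₁]
    · simp only [finishBlock, List.mem_cons, List.not_mem_nil, or_false] at hg
      rcases hg with rfl | rfl | rfl | rfl <;> rfl
    · simp only [finishBlock, List.mem_cons, List.not_mem_nil, or_false] at hg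
      rcases hg with rfl | rfl | rfl | rfl <;> simp only [fanTargets, List.not_mem_nil,
        false_imp_iff, implies_true]
      · exact fun i hi => (c₀ i hi).2.2
      · exact fun i hi => (c₁ i hi).2.2
  · have e₀ : ∀ i ∈ copies ℓ.q m 0 w, i ≠ ℓ.q 0 w ∧ i ≠ ℓ.q 1 w := fun i hi =>
      ⟨fun h => m₀ (h ▸ hi), fun h => m₂ (h ▸ hi)⟩
    have e₁ : ∀ i ∈ copies ℓ.q m 1 w, i ≠ ℓ.q 0 w ∧ i ≠ ℓ.q 1 w ∧ i ∉ copies ℓ.q m 0 w :=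
      fun i hi => ⟨fun h => m₃ (h ▸ hi), fun h => m₁ (h ▸ hi), fun h => by
        have := c₀ i h
        have := c₁ i hi
        omega⟩
    have e₂ : ∀ i ∈ copies ℓ.q m 0 w, i ∉ copies ℓ.q m 1 w := fun i hi h => (e₁ i h).2.2 hi
    simp only [finishBlock, List.pairwise_cons, List.mem_cons, List.not_mem_nil, or_false,
      forall_eq_or_imp, forall_eq, MayFollow, fanTargets, QGate.qubits, QGate.controls,
      QGate.targets, List.cons_append, List.nil_append, false_imp_iff, implies_true, and_true,
      true_and, List.Pairwise.nil, not_or]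
    exact ⟨⟨e₀, fun i hi => ⟨(e₁ i hi).1, (e₁ i hi).2.1⟩⟩,
      ⟨fun i hi => (e₀ i hi).2, fun i hi => (e₁ i hi).2.1⟩,
      fun i hi => ⟨(e₁ i hi).1, (e₁ i hi).2.2⟩, e₂⟩

/-- What the list of all gates has to satisfy, the gates acting on the wires from `w` on. -/
def GoodFrom (w : ℕ) (gs : List (QGate N)) : Prop :=
  (∀ g ∈ gs, g.WF ∧ (∃ w' ≥ w, ActsOn ℓ w' g) ∧ ∀ i ∈ fanTargets g, 2 ≤ ℓ.blk i) ∧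
    gs.Pairwise MayFollow

variable {ℓ}

theorem GoodFrom.append {w : ℕ} {gs hs : List (QGate N)} (h : GoodFrom ℓ (w + 1) hs)
    (hg : ∀ g ∈ gs, g.WF ∧ ActsOn ℓ w g ∧ ∀ i ∈ fanTargets g, 2 ≤ ℓ.blk i)
    (hp : gs.Pairwise MayFollow) : GoodFrom ℓ w (gs ++ hs) := by
  refine ⟨fun g hgm => ?_, List.pairwise_append.2 ⟨hp, h.2, fun g hgm g' hg' => ?_⟩⟩
  · rcases List.mem_append.1 hgm with hgm | hgm
    · exact ⟨(hg g hgm).1, ⟨w, le_rfl, (hg g hgm).2.1⟩, (hg g hgm).2.2⟩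
    · obtain ⟨h₁, ⟨w', hw', h₂⟩, h₃⟩ := h.1 g hgm
      exact ⟨h₁, ⟨w', by omega, h₂⟩, h₃⟩
  · obtain ⟨-, ⟨w', hw', h₂⟩, -⟩ := h.1 g' hg'
    exact (hg g hgm).2.1.mayFollow (by omega) h₂

variable (ℓ)

theorem goodFrom_segments (gs : List BGate) : ∀ k w : ℕ, 2 ≤ k →
    k + 2 * gs.length ≤ 2 * m + 2 → w + gs.length ≤ W →
    (∀ (j : ℕ) (h : j < gs.length), ∀ a ∈ gs[j].inputs, a < w + j) →
    (∀ g ∈ gs, g.isLarge = true → g.inputs.Nodup) →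
    GoodFrom ℓ w (segments ℓ.q m k w gs) := by
  induction gs with
  | nil => intros; exact ⟨by simp [segments], by simp [segments]⟩
  | cons g gs ih =>
    intro k w hk hk' hw hin hnd
    rw [List.length_cons] at hk' hw
    have hg : ∀ a ∈ g.inputs, a < w := hin 0 (by simp)
    have hwW : w < W := by omega
    have hrest := ih (k + 2) (w + 1) (by omega) (by omega) (by omega)
      (fun j hj a ha => by
        have := hin (j + 1) (by simpa using hj) a (by simpa using ha)
        omega) (fun g' hg' => hnd g' (by simp [hg']))
    obtain ⟨hf, hfp⟩ := pairwise_finishBlock ℓ hwW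
    have hb := fun (h : QGate N) => mem_gateBlock ℓ (k := k) (w := w) (h := h) (by omega)
      (fun a ha => (hg a ha).trans hwW) (hnd g (by simp))
    have hctl : ∀ h ∈ gateBlock ℓ.q k w g, ∀ i ∈ h.controls, ℓ.wire i < w := by
      intro h hh i hi
      obtain ⟨a, ha, rfl | rfl⟩ := (hb h hh).2.1 i hi
      · rw [ℓ.wire_q (by omega) ((hg a ha).trans hwW)]; exact hg a ha
      · rw [ℓ.wire_q (by omega) ((hg a ha).trans hwW)]; exact hg a ha
    have w₀ := ℓ.wire_q (show 0 < 2 * m + 2 by omega) hwW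
    have b₀ := ℓ.blk_q (show 0 < 2 * m + 2 by omega) hwW
    refine hrest.append (fun h hh => ?_) (List.pairwise_append.2 ⟨?_, hfp, ?_⟩)
    · rcases List.mem_append.1 hh with hh | hh
      · obtain ⟨h₁, h₂, h₃, h₄⟩ := hb h hh
        refine ⟨?_, ⟨?_, ?_⟩, ?_⟩
        · rw [QGate.WF, QGate.qubits, h₁]
          refine h₄.append (by simp) ?_
          intro i hi hi'
          have := hctl h hh i hi
          rw [List.mem_singleton] at hi'
          rw [hi', w₀] at this
          omega
        · rw [h₁]
          intro i hi
          rw [List.mem_singleton.1 hi, w₀]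
        · intro i hi
          rw [QGate.qubits, h₁, List.mem_append] at hi
          rcases hi with hi | hi
          · exact (hctl h hh i hi).le
          · rw [List.mem_singleton.1 hi, w₀]
        · rw [h₃]; simp
      · exact ⟨(hf h hh).1, (hf h hh).2.1, (hf h hh).2.2.2.2⟩
    · refine List.pairwise_of_forall_mem_list fun h hh h' hh' => ?_
      rw [MayFollow, (hb h hh).2.2.1, (hb h' hh').2.2.1]
      simp
    -- The fanout targets lie on wire `w` in blocks from 2 on, whereas the gates before them touch
    -- this wire only in block 0 and otherwise earlier wires.
    · intro h hh h' hh'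
      rw [MayFollow, (hb h hh).2.2.1]
      refine ⟨fun i hi hi' => ?_, by simp⟩
      have h₂ := (hf h' hh').2.2.2.2 i hi
      have h₃ := (hf h' hh').2.1.1 i (fanTargets_subset h' hi)
      rw [QGate.qubits, (hb h hh).1, List.mem_append] at hi'
      rcases hi' with hi' | hi'
      · have := hctl h hh i hi'
        omega
      · rw [List.mem_singleton.1 hi', b₀] at h₂
        omega

theorem goodFrom_inputs {n : ℕ} (hn : n ≤ W) {hs : List (QGate N)} (h : GoodFrom ℓ n hs) :
    GoodFrom ℓ 0 ((List.range n).flatMap (finishBlock ℓ.q m) ++ hs) := by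
  induction n generalizing hs with
  | zero => simpa using h
  | succ n ih =>
    rw [List.range_succ, List.flatMap_append, List.flatMap_singleton, List.append_assoc]
    obtain ⟨hf, hfp⟩ := pairwise_finishBlock ℓ (w := n) (by omega)
    exact ih (by omega) (h.append (fun g hg => ⟨(hf g hg).1, (hf g hg).2.1,
      (hf g hg).2.2.2.2⟩) hfp)

end wellFormed

/-! ### Weft -/

section weft

variable {N : ℕ}

/-- The maximal numbers of Toffoli gates on paths through a list of gates. -/
def levelAll (gs : List (QGate N)) (d : Fin N → ℕ) : Fin N → ℕ :=
  gs.foldl (fun d g => g.level d) d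

theorem levelAll_append (gs hs : List (QGate N)) (d : Fin N → ℕ) :
    levelAll (gs ++ hs) d = levelAll hs (levelAll gs d) := List.foldl_append

theorem levelAll_of_notMem (gs : List (QGate N)) (d : Fin N → ℕ) (i : Fin N)
    (h : ∀ g ∈ gs, i ∉ g.qubits) : levelAll gs d i = d i := by
  induction gs generalizing d with
  | nil => rfl
  | cons g gs ih =>
    change levelAll gs (g.level d) i = d i
    rw [ih _ fun g' hg' => h g' (by simp [hg'])]
    exact if_neg (h g (by simp))

/-- All gates stay inside `S`, so each of them takes a maximum of levels over `S` and adds at most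
one, and only Toffoli gates add anything. -/
theorem levelAll_le (S : Fin N → Prop) (gs : List (QGate N)) (d : Fin N → ℕ) (B : ℕ)
    (hS : ∀ g ∈ gs, ∀ i ∈ g.qubits, S i) (hd : ∀ i, S i → d i ≤ B) :
    ∀ i, S i → levelAll gs d i ≤ B + gs.countP QGate.isToffoli := by
  induction gs generalizing d B with
  | nil => exact hd
  | cons g gs ih =>
    intro i hi
    change levelAll gs (g.level d) i ≤ _
    refine (ih (g.level d) (B + if g.isToffoli then 1 else 0)
      (fun g' hg' => hS g' (by simp [hg'])) (fun j hj => ?_) i hi).trans ?_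
    · unfold QGate.level
      split_ifs with h₁ h₂ h₂
      · refine Nat.add_le_add_right (Finset.sup_le fun j' hj' => hd j' ?_) _
        exact hS g (by simp) j' (List.mem_toFinset.1 hj')
      · refine Nat.add_le_add_right (Finset.sup_le fun j' hj' => hd j' ?_) _
        exact hS g (by simp) j' (List.mem_toFinset.1 hj')
      · exact (hd j hj).trans (by omega)
      · exact hd j hj
    · rw [List.countP_cons]; omega

variable {W m : ℕ} (ℓ : Layout W m N)

theorem countP_gateBlock (k w : ℕ) (g : BGate) :
    (gateBlock ℓ.q k w g).countP QGate.isToffoli = if g.isLarge then 1 else 0 := by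
  cases g with
  | not a => rfl
  | bin f a b =>
    rw [gateBlock, BGate.isLarge, if_neg (by simp), List.countP_eq_zero]
    intro h hh
    rw [(mem_binBlock hh).2.2.2.1]
    simp
  | and l => rfl
  | or l => rfl

/-- The levels `d` are bounded by those of the wires, as far as qubits are still needed when the
next wire is `w` and the next unused copies are in block `k`. -/
def LevelBound (lev : ℕ → ℕ) (k w : ℕ) (d : Fin N → ℕ) : Prop :=
  ∀ i, (w ≤ ℓ.wire i → d i = 0) ∧
    (ℓ.wire i < w → ℓ.blk i < 2 ∨ k ≤ ℓ.blk i → d i ≤ lev (ℓ.wire i))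

theorem levelAll_finishBlock {w B : ℕ} (hw : w < W) (d : Fin N → ℕ)
    (hd : ∀ i, ℓ.wire i = w → d i ≤ B) :
    (∀ i, ℓ.wire i = w → levelAll (finishBlock ℓ.q m w) d i ≤ B) ∧
      ∀ i, ℓ.wire i ≠ w → levelAll (finishBlock ℓ.q m w) d i = d i := by
  obtain ⟨hf, -⟩ := pairwise_finishBlock ℓ hw
  constructor
  · intro i hi
    have h := levelAll_le (fun i => ℓ.wire i = w) (finishBlock ℓ.q m w) d B
      (fun g hg => (hf g hg).2.2.1) hd i hi
    rwa [List.countP_eq_zero.2 fun g hg => by simp [(hf g hg).2.2.2.1], Nat.add_zero] at h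
  · intro i hi
    exact levelAll_of_notMem _ _ _ fun g hg h => hi ((hf g hg).2.2.1 i h)

theorem levelBound_inputs (lev : ℕ → ℕ) {n : ℕ} (hn : n ≤ W) :
    LevelBound ℓ lev 2 n (levelAll ((List.range n).flatMap (finishBlock ℓ.q m)) fun _ => 0) := by
  induction n with
  | zero => intro i; exact ⟨fun _ => rfl, fun h => by omega⟩
  | succ n ih =>
    have ih := ih (by omega)
    rw [List.range_succ, List.flatMap_append, List.flatMap_singleton, levelAll_append]
    set d := levelAll ((List.range n).flatMap (finishBlock ℓ.q m)) fun _ => 0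
    obtain ⟨h₁, h₂⟩ := levelAll_finishBlock ℓ (w := n) (B := 0) (by omega) d
      (fun i hi => ((ih i).1 hi.ge).le)
    intro i
    by_cases hi : ℓ.wire i = n
    · exact ⟨fun h => by omega, fun _ _ => (h₁ i hi).trans (Nat.zero_le _)⟩
    · rw [h₂ i hi]
      exact ⟨fun h => (ih i).1 (by omega), fun h => (ih i).2 (by omega)⟩

/-- This is where private copies pay off. A Toffoli gate raises the levels of its controls too, but
these are copies in blocks `k` and `k + 1`, which are never used again and drop out of the invariant
when `k` becomes `k + 2`. The target gets the Boolean level of wire `w`, and the fanouts pass it on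
to the copies unchanged. -/
theorem levelBound_segments (lev : ℕ → ℕ) (gs : List BGate) : ∀ (k w : ℕ) (d : Fin N → ℕ),
    2 ≤ k → k + 2 * gs.length ≤ 2 * m + 2 → w + gs.length ≤ W →
    (∀ (j : ℕ) (h : j < gs.length), ∀ a ∈ gs[j].inputs, a < w + j) →
    (∀ g ∈ gs, g.isLarge = true → g.inputs.Nodup) →
    (∀ (j : ℕ) (h : j < gs.length), lev (w + j) = gs[j].level lev) →
    LevelBound ℓ lev k w d →
    LevelBound ℓ lev (k + 2 * gs.length) (w + gs.length)
      (levelAll (segments ℓ.q m k w gs) d) := by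
  induction gs with
  | nil => intro k w d _ _ _ _ _ _ h; exact h
  | cons g gs ih =>
    intro k w d hk hk' hw hin hnd hlev hd
    rw [List.length_cons] at hk' hw
    have hg : ∀ a ∈ g.inputs, a < w := hin 0 (by simp)
    have hlw : lev w = g.level lev := hlev 0 (by simp)
    have hwW : w < W := by omega
    have w₀ := ℓ.wire_q (show 0 < 2 * m + 2 by omega) hwW
    have hb := fun (h : QGate N) => mem_gateBlock ℓ (k := k) (w := w) (h := h) (by omega)
      (fun a ha => (hg a ha).trans hwW) (hnd g (by simp))
    -- These are the only qubits that the gates for `g` touch. Before these gates, their levels are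
    -- at most the maximum over the inputs of `g`, the target being still at level 0.
    set S : Fin N → Prop := fun i =>
      i = ℓ.q 0 w ∨ ∃ a ∈ g.inputs, i = ℓ.q k a ∨ i = ℓ.q (k + 1) a with hSdef
    have hS : ∀ h ∈ gateBlock ℓ.q k w g, ∀ i ∈ h.qubits, S i := by
      intro h hh i hi
      rw [QGate.qubits, (hb h hh).1, List.mem_append] at hi
      rcases hi with hi | hi
      · exact Or.inr ((hb h hh).2.1 i hi)
      · exact Or.inl (List.mem_singleton.1 hi)
    have hdS : ∀ i, S i → d i ≤ g.inputs.toFinset.sup lev := by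
      rintro i (rfl | ⟨a, ha, h⟩)
      · rw [(hd _).1 w₀.ge]; exact Nat.zero_le _
      · have haW := (hg a ha).trans hwW
        have hle : lev a ≤ g.inputs.toFinset.sup lev :=
          Finset.le_sup (f := lev) (List.mem_toFinset.2 ha)
        have h₁ : ℓ.wire i = a ∧ k ≤ ℓ.blk i := by
          rcases h with rfl | rfl
          · exact ⟨ℓ.wire_q (by omega) haW, (ℓ.blk_q (by omega) haW).ge⟩
          · refine ⟨ℓ.wire_q (by omega) haW, ?_⟩
            rw [ℓ.blk_q (by omega) haW]; omega
        have := (hd i).2 (by rw [h₁.1]; exact hg a ha) (Or.inr h₁.2)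
        rw [h₁.1] at this
        exact this.trans hle
    have k₁ := levelAll_le S (gateBlock ℓ.q k w g) d _ hS hdS
    rw [countP_gateBlock] at k₁
    have k₂ : ∀ i, ¬ S i → levelAll (gateBlock ℓ.q k w g) d i = d i := fun i hi =>
      levelAll_of_notMem _ _ _ fun h hh h' => hi (hS h hh i h')
    set d₁ := levelAll (gateBlock ℓ.q k w g) d
    have hlw' : lev w = g.inputs.toFinset.sup lev + if g.isLarge then 1 else 0 := hlw
    rw [← hlw'] at k₁
    obtain ⟨f₁, f₂⟩ := levelAll_finishBlock ℓ (B := lev w) hwW d₁ (fun i hi => by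
      by_cases hSi : S i
      · exact k₁ i hSi
      · rw [k₂ i hSi, (hd i).1 hi.ge]; exact Nat.zero_le _)
    rw [segments, levelAll_append, levelAll_append]
    set d₂ := levelAll (finishBlock ℓ.q m w) d₁
    have hd₂ : LevelBound ℓ lev (k + 2) (w + 1) d₂ := by
      intro i
      by_cases hi : ℓ.wire i = w
      · exact ⟨fun h => by omega, fun _ _ => by rw [hi]; exact f₁ i hi⟩
      · rw [f₂ i hi]
        refine ⟨fun h => ?_, fun h hblk => ?_⟩
        · rw [k₂ i, (hd i).1 (by omega)]
          rintro (rfl | ⟨a, ha, rfl | rfl⟩)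
          · exact hi w₀
          · have := hg a ha
            rw [ℓ.wire_q (by omega) (this.trans hwW)] at h; omega
          · have := hg a ha
            rw [ℓ.wire_q (by omega) (this.trans hwW)] at h; omega
        -- A qubit of another wire still covered by the invariant lies outside blocks `k` and `k +
        -- 1`, so the gates for `g` have not changed its level.
        · rw [k₂ i]
          · exact (hd i).2 (by omega) (by omega)
          · rintro (rfl | ⟨a, ha, rfl | rfl⟩)
            · exact hi w₀
            · have := hg a ha
              rw [ℓ.blk_q (by omega) (this.trans hwW)] at hblk; omega
            · have := hg a ha
              rw [ℓ.blk_q (by omega) (this.trans hwW)] at hblk; omega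
    have := ih (k + 2) (w + 1) d₂ (by omega) (by omega) (by omega)
      (fun j hj a ha => by
        have := hin (j + 1) (by simpa using hj) a (by simpa using ha)
        omega) (fun g' hg' => hnd g' (by simp [hg']))
      (fun j hj => by
        have := hlev (j + 1) (by simpa using hj)
        rw [show w + 1 + j = w + (j + 1) by omega, this]
        simp) hd₂
    rwa [show k + 2 + 2 * gs.length = k + 2 * (gs.length + 1) by ring,
      show w + 1 + gs.length = w + (gs.length + 1) by ring] at this

end weft

/-! ### Acceptance -/

namespace QCircuit

variable (Q : QCircuit)

theorem initState_eq_sum (ψ : QState Q.numInputs) :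
    Q.initState ψ = ∑ x, ψ x • basis (Fin.append x fun _ : Fin Q.numAncilla => false) := by
  funext y
  simp only [Finset.sum_apply, Pi.smul_apply, basis_apply, smul_eq_mul, mul_ite, mul_one,
    mul_zero, initState]
  have key : ∀ x, y = Fin.append x (fun _ : Fin Q.numAncilla => false) ↔
      (∀ i : Fin Q.numAncilla, y (Fin.natAdd Q.numInputs i) = false) ∧
        (fun i => y (Fin.castAdd Q.numAncilla i)) = x := by
    intro x
    constructor
    · rintro rfl
      simp
    · rintro ⟨h, rfl⟩
      funext i
      refine Fin.addCases (fun i => ?_) (fun i => ?_) i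
      · simp
      · simp [h]
  simp only [key]
  by_cases h : ∀ i : Fin Q.numAncilla, y (Fin.natAdd Q.numInputs i) = false
  · simp [h]
  · simp [h]

theorem finalState_eq (ψ : QState Q.numInputs) :
    Q.finalState ψ = applyAll Q.gates (Q.initState ψ) := (applyAll_apply _ _).symm

variable {Q} {E : (Fin Q.numInputs → Bool) → Bits (Q.numInputs + Q.numAncilla)}

/-- By linearity the final state is a combination of the rejecting basis states `E x`, so accepting
amplitudes vanish term by term. Neither unitarity nor injectivity of `E` is needed, and the phases
play no role. -/
theorem acceptProb_eq_zero (hE : ∀ x, Sends Q.gates (Fin.append x fun _ => false) (E x))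
    (h : ∀ x, E x Q.out = false) (ψ : QState Q.numInputs) : Q.acceptProb ψ = 0 := by
  refine Finset.sum_eq_zero fun y _ => ?_
  split_ifs with hy
  · rw [finalState_eq, initState_eq_sum, map_sum, Finset.sum_apply, Finset.sum_eq_zero]
    · simp
    · intro x _
      obtain ⟨c, -, hc⟩ := hE x
      rw [map_smul, hc, Pi.smul_apply, Pi.smul_apply, basis_apply, if_neg]
      · simp
      · rintro rfl
        rw [h x] at hy
        exact Bool.false_ne_true hy
  · rfl

theorem isUnitState_basis {M : ℕ} (x : Bits M) : IsUnitState (basis x) := by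
  unfold IsUnitState
  rw [Finset.sum_eq_single x]
  · simp [basis_apply]
  · intro y _ hy
    simp [basis_apply, hy]
  · simp

theorem acceptProb_basis {x : Fin Q.numInputs → Bool} {z : Bits (Q.numInputs + Q.numAncilla)}
    (hz : Sends Q.gates (Fin.append x fun _ => false) z) (h : z Q.out = true) :
    Q.acceptProb (basis x) = 1 := by
  obtain ⟨c, hc, hs⟩ := hz
  have hf : Q.finalState (basis x) = c • basis z := by
    rw [finalState_eq, initState_eq_sum, Finset.sum_eq_single x, ← hs]
    · simp [basis_apply]
    · intro y _ hy
      simp [basis_apply, hy]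
    · simp
  unfold acceptProb
  rw [hf, Finset.sum_eq_single z]
  · simp [h, basis_apply, hc]
  · intro y _ hy
    simp [basis_apply, hy]
  · simp

end QCircuit

/-! ### The reduction -/

/-- The standard numbering of qubits. -/
def layout (n m : ℕ) (h : 0 < n + m) : Layout (n + m) m (n + ((n + m) * (2 * m + 1) + m)) where
  -- Reduction modulo the number of qubits only makes the numbering total; it has no effect for the
  -- blocks and wires in use. Since n + ((n + m)(2m + 1) + m) = (n + m)(2m + 2), the qubits fill
  -- exactly 2m + 2 blocks, and the witness comes first in block 0.
  q k a := ⟨(a + (n + m) * k) % (n + ((n + m) * (2 * m + 1) + m)), Nat.mod_lt _ (by omega)⟩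
  pos := h
  card := by ring
  q_val k a hk ha := by
    refine Nat.mod_eq_of_lt ?_
    calc a + (n + m) * k < (n + m) + (n + m) * k := by omega
      _ = (n + m) * (k + 1) := by ring
      _ ≤ (n + m) * (2 * m + 2) := Nat.mul_le_mul_left _ (by omega)
      _ = _ := by ring

namespace BCircuit

/-- The quantum circuit for a Boolean circuit. -/
def toQ (C : BCircuit) (h : 0 < C.numInputs + C.gates.length) : QCircuit where
  numInputs := C.numInputs
  numAncilla := (C.numInputs + C.gates.length) * (2 * C.gates.length + 1) + C.gates.length
  gates := (List.range C.numInputs).flatMap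
      (finishBlock (layout C.numInputs C.gates.length h).q C.gates.length) ++
    segments (layout C.numInputs C.gates.length h).q C.gates.length 2 C.numInputs C.gates
  out := (layout C.numInputs C.gates.length h).q 0 C.out

variable {C : BCircuit} (h : 0 < C.numInputs + C.gates.length)

theorem WF.pos (hC : C.WF) : 0 < C.numInputs + C.gates.length := by
  have := hC.2.2
  omega

theorem WF.inputs_lt (hC : C.WF) : ∀ g ∈ C.gates, ∀ a ∈ g.inputs,
    a < C.numInputs + C.gates.length := by
  intro g hg a ha
  obtain ⟨j, hj, rfl⟩ := List.mem_iff_getElem.1 hg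
  have := hC.1 j hj a ha
  omega

theorem encode_toQ (hC : C.WF) : (C.toQ h).encode = translateWord C := by
  have h₁ := encode_segments (layout C.numInputs C.gates.length h) C.gates 2 C.numInputs
    (by omega) le_rfl hC.inputs_lt
  have h₂ : ((List.range C.numInputs).flatMap
      (finishBlock (layout C.numInputs C.gates.length h).q C.gates.length)).flatMap QGate.encode =
      (List.range C.numInputs).flatMap
        (finishWord (C.numInputs + C.gates.length) C.gates.length) := by
    rw [List.flatMap_assoc]
    refine List.flatMap_congr fun w hw => ?_
    exact encode_finishBlock _ (by have := List.mem_range.1 hw; omega)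
  have h₃ := ((layout C.numInputs C.gates.length h).q_val 0 C.out (by omega) hC.2.2).trans
    (by rw [Nat.mul_zero, Nat.add_zero] :
      C.out + (C.numInputs + C.gates.length) * 0 = C.out)
  unfold QCircuit.encode translateWord
  simp only [toQ, List.flatMap_append]
  rw [h₁, h₂, h₃]
  simp [Nat.mul_comm]

theorem WF.goodFrom (hC : C.WF) :
    GoodFrom (layout C.numInputs C.gates.length h) 0 (C.toQ h).gates :=
  goodFrom_inputs _ (by omega) <| goodFrom_segments _ _ _ _ le_rfl (by omega) le_rfl hC.1 hC.2.1

theorem WF.toQ (hC : C.WF) : (C.toQ h).WF := by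
  have hg := hC.goodFrom h
  refine ⟨fun g hgm => (hg.1 g hgm).1, classicalFanout_of_pairwise _ hg.2 fun g hgm i hi => ?_⟩
  -- A fanout target has block at least 2, hence number at least 2(n + m), beyond the witness
  -- qubits.
  have hb := (hg.1 g hgm).2.2 i hi
  unfold Layout.blk at hb
  have h₁ := (Nat.le_div_iff_mul_le h).1 hb
  change C.numInputs ≤ i.val
  omega

/-- The output qubit is in block 0, which the invariant `LevelBound` covers to the end. -/
theorem weft_toQ_le (hC : C.WF) : (C.toQ h).weft ≤ C.weft := by
  set ℓ := layout C.numInputs C.gates.length h with hℓ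
  have h₁ := levelBound_inputs ℓ (fun i => C.levels.getD i 0) (n := C.numInputs) (by omega)
  have h₂ := levelBound_segments ℓ (fun i => C.levels.getD i 0) C.gates 2 C.numInputs _ le_rfl
    (by omega) le_rfl hC.1 hC.2.1 hC.levels_gate h₁
  have b₀ := ℓ.blk_q (show 0 < 2 * C.gates.length + 2 by omega) hC.2.2
  have w₀ := ℓ.wire_q (show 0 < 2 * C.gates.length + 2 by omega) hC.2.2
  rw [← levelAll_append] at h₂
  have h₃ := (h₂ (ℓ.q 0 C.out)).2 (by rw [w₀]; exact hC.2.2) (Or.inl (by omega))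
  rw [w₀] at h₃
  exact h₃

theorem stateAt_zero (x : Fin C.numInputs → Bool) :
    stateAt (layout C.numInputs C.gates.length h) C.numInputs
      (fun i => (C.values x).getD i false) 0 = Fin.append x fun _ => false := by
  funext i
  refine Fin.addCases (fun i => ?_) (fun i => ?_) i
  · rw [Fin.append_left]
    have hlt : (i : ℕ) < C.numInputs + C.gates.length := by omega
    simp only [stateAt, Layout.blk, Layout.wire, Fin.val_castAdd, Nat.div_eq_of_lt hlt,
      Nat.mod_eq_of_lt hlt]
    simpa using values_input x i
  · rw [Fin.append_right]
    simp only [stateAt, Nat.not_lt_zero, if_false]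
    rw [decide_eq_false, Bool.false_and]
    rintro ⟨h₁, h₂⟩
    unfold Layout.blk at h₁
    unfold Layout.wire at h₂
    rw [Nat.div_eq_zero_iff_lt h] at h₁
    rw [Nat.mod_eq_of_lt h₁, Fin.val_natAdd] at h₂
    omega

theorem WF.sends_toQ (hC : C.WF) (x : Fin C.numInputs → Bool) :
    ∃ z, Sends (C.toQ h).gates (Fin.append x fun _ => false) z ∧
      z (C.toQ h).out = C.eval x := by
  set ℓ := layout C.numInputs C.gates.length h with hℓ
  have h₁ := sends_inputs ℓ C.numInputs (fun i => (C.values x).getD i false) (by omega)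
  have h₂ := sends_segments ℓ C.numInputs (fun i => (C.values x).getD i false) C.gates 2
    C.numInputs le_rfl rfl (by omega) le_rfl le_rfl hC.1 (hC.values_gate x)
  rw [stateAt_zero h x] at h₁
  refine ⟨_, h₁.append h₂, ?_⟩
  have b₀ := ℓ.blk_q (show 0 < 2 * C.gates.length + 2 by omega) hC.2.2
  have w₀ := ℓ.wire_q (show 0 < 2 * C.gates.length + 2 by omega) hC.2.2
  change stateAt ℓ _ _ _ (ℓ.q 0 C.out) = _
  simp only [stateAt, w₀, b₀, hC.2.2, if_true]
  simp [eval]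

theorem WF.acceptProb_toQ_of_satisfiable (hC : C.WF) (hs : C.Satisfiable) :
    ∃ ψ, IsUnitState ψ ∧ (C.toQ h).acceptProb ψ = 1 := by
  obtain ⟨x, hx⟩ := hs
  obtain ⟨z, hz, hzx⟩ := hC.sends_toQ h x
  exact ⟨basis x, QCircuit.isUnitState_basis x,
    QCircuit.acceptProb_basis (Q := C.toQ h) hz (hzx.trans hx)⟩

theorem WF.acceptProb_toQ_of_not_satisfiable (hC : C.WF) (hs : ¬ C.Satisfiable)
    (ψ : QState C.numInputs) : (C.toQ h).acceptProb ψ = 0 := by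
  choose E hE hE' using hC.sends_toQ h
  refine QCircuit.acceptProb_eq_zero (Q := C.toQ h) hE (fun x => ?_) ψ
  rw [hE' x]
  by_contra hx
  exact hs ⟨x, by simpa using hx⟩

/-! ### Sizes -/

theorem length_finishInputs {N : ℕ} (q : ℕ → ℕ → Fin N) (m n : ℕ) :
    ((List.range n).flatMap (finishBlock q m)).length = 4 * n := by
  induction n with
  | zero => rfl
  | succ n ih =>
    rw [List.range_succ, List.flatMap_append, List.length_append, ih]
    simp [finishBlock]
    ring

theorem length_gateBlock_le {N : ℕ} (q : ℕ → ℕ → Fin N) (k w : ℕ) (g : BGate) :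
    (gateBlock q k w g).length ≤ 15 := by
  cases g with
  | bin f a b =>
    simp only [gateBlock, binBlock, List.length_append]
    split_ifs <;> simp [andBlock]
  | _ => simp [gateBlock]

theorem length_segments {N : ℕ} (q : ℕ → ℕ → Fin N) (m : ℕ) (gs : List BGate) : ∀ k w : ℕ,
    4 * gs.length ≤ (segments q m k w gs).length ∧
      (segments q m k w gs).length ≤ 19 * gs.length := by
  induction gs with
  | nil => intro k w; simp [segments]
  | cons g gs ih =>
    intro k w
    have h₁ := ih (k + 2) (w + 1)
    have h₂ := length_gateBlock_le q k w g
    have h₃ : (finishBlock q m w).length = 4 := rfl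
    simp only [segments, List.length_append, List.length_cons]
    omega

/-- Each wire needs four gates for its copies and each Boolean gate at most fifteen more. The lower
bound serves to estimate the ancillas by the size of the quantum circuit. -/
theorem length_gates_toQ :
    4 * (C.numInputs + C.gates.length) ≤ (C.toQ h).gates.length ∧
      (C.toQ h).gates.length ≤ 19 * (C.numInputs + C.gates.length) := by
  have h₁ := length_segments (layout C.numInputs C.gates.length h).q C.gates.length C.gates 2
    C.numInputs
  have h₂ := length_finishInputs (layout C.numInputs C.gates.length h).q C.gates.length
    C.numInputs
  have h₃ : (C.toQ h).gates.length = 4 * C.numInputs + (segments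
      (layout C.numInputs C.gates.length h).q C.gates.length 2 C.numInputs C.gates).length :=
    List.length_append.trans (congrArg (· + _) h₂)
  rw [h₃]
  omega

/-- Inputs and gates are each at most the size of C, whence 38 = 19 · 2. -/
theorem size_toQ_le : (C.toQ h).size ≤ 38 * C.size := by
  have h₁ := (length_gates_toQ h).2
  have h₂ : C.numInputs ≤ C.size := le_max_left _ _
  have h₃ : C.gates.length ≤ C.size := le_max_right _ _
  refine max_le (h₂.trans (by omega)) (by omega)

theorem numAncilla_toQ_le :
    (C.toQ h).numAncilla ≤ 2 * (C.toQ h).size ^ 2 + 2 * (C.toQ h).size := by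
  have h₁ := (length_gates_toQ h).1
  have h₂ : (C.toQ h).gates.length ≤ (C.toQ h).size := le_max_right _ _
  set s := (C.toQ h).size
  change (C.numInputs + C.gates.length) * (2 * C.gates.length + 1) + C.gates.length ≤ _
  calc _ ≤ s * (2 * s + 1) + s := by
        gcongr
        · omega
        · omega
        · omega
    _ = _ := by ring

theorem length_encodeNums_le (l : List ℕ) (s : ℕ) (hl : ∀ a ∈ l, a < s) :
    (encodeNums l).length ≤ s * l.length + 1 := by
  simp only [encodeNums, List.length_append, List.length_singleton, Nat.add_le_add_iff_right]
  induction l with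
  | nil => simp
  | cons a l ih =>
    have := ih fun b hb => hl b (by simp [hb])
    have := hl a (by simp)
    have e : s * (l.length + 1) = s * l.length + s := by ring
    simp only [List.flatMap_cons, List.length_append, length_encodeNum, List.length_cons]
    omega

/-- Distinctness of the wires read by a large gate bounds its fan-in by the number of wires;
otherwise its description could be arbitrarily long. -/
theorem length_encode_gate_le (g : BGate) (s : ℕ) (hg : ∀ a ∈ g.inputs, a < s)
    (hnd : g.isLarge = true → g.inputs.Nodup) : g.encode.length ≤ s * s + 2 * s + 10 := by
  have key : ∀ l : List ℕ, l.Nodup → (∀ a ∈ l, a < s) → l.length ≤ s := by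
    intro l hl hs
    have : l.toFinset ⊆ Finset.range s := fun a ha =>
      Finset.mem_range.2 (hs a (List.mem_toFinset.1 ha))
    have := Finset.card_le_card this
    rwa [List.toFinset_card_of_nodup hl, Finset.card_range] at this
  cases g with
  | not a =>
    have := hg a (by simp [BGate.inputs])
    simp only [BGate.encode, List.length_cons, length_encodeNum]
    omega
  | bin f a b =>
    have := hg a (by simp [BGate.inputs])
    have := hg b (by simp [BGate.inputs])
    simp only [BGate.encode, List.length_append, List.length_cons, List.length_nil,
      length_encodeNum]
    omega
  | and l =>
    have h₁ := length_encodeNums_le l s hg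
    have h₂ := Nat.mul_le_mul_left s (key l (hnd rfl) hg)
    simp only [BGate.encode, List.length_cons]
    omega
  | or l =>
    have h₁ := length_encodeNums_le l s hg
    have h₂ := Nat.mul_le_mul_left s (key l (hnd rfl) hg)
    simp only [BGate.encode, List.length_cons]
    omega

theorem length_flatMap_le {α β : Type} (f : α → List β) (l : List α) (B : ℕ)
    (h : ∀ a ∈ l, (f a).length ≤ B) : (l.flatMap f).length ≤ B * l.length := by
  induction l with
  | nil => simp
  | cons a l ih =>
    have h₁ := ih fun b hb => h b (by simp [hb])
    have h₂ := h a (by simp)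
    have e : B * (l.length + 1) = B * l.length + B := by ring
    simp only [List.flatMap_cons, List.length_append, List.length_cons]
    omega

theorem WF.length_encode_le (hC : C.WF) : C.encode.length ≤ 100 * (C.size + 1) ^ 3 := by
  have h₂ : C.numInputs ≤ C.size := le_max_left _ _
  have h₃ : C.gates.length ≤ C.size := le_max_right _ _
  have h₄ := hC.2.2
  set s := C.size
  have h₁ := length_flatMap_le BGate.encode C.gates ((2 * s) * (2 * s) + 2 * (2 * s) + 10)
    fun g hg => length_encode_gate_le g (2 * s)
      (fun a ha => (hC.inputs_lt g hg a ha).trans_le (by omega)) (hC.2.1 g hg)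
  have h₅ : ((2 * s) * (2 * s) + 2 * (2 * s) + 10) * C.gates.length ≤
      ((2 * s) * (2 * s) + 2 * (2 * s) + 10) * s := Nat.mul_le_mul_left _ h₃
  have e : ((2 * s) * (2 * s) + 2 * (2 * s) + 10) * s = 4 * s ^ 3 + 4 * s ^ 2 + 10 * s := by ring
  have e' : 100 * (s + 1) ^ 3 = 100 * s ^ 3 + 300 * s ^ 2 + 300 * s + 100 := by ring
  simp only [encode, List.length_append, length_encodeNum]
  omega

end BCircuit

/-! ## Constant functions are computable in polynomial time -/

section Const

open Turing Computability

/-- The machine that empties its stack and then writes `w`. -/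
def constMachine (w : List Bool) : FinTM2 where
  K := Unit
  k₀ := ()
  k₁ := ()
  Γ _ := Bool
  Λ := Unit
  main := ()
  σ := Option Bool
  initialState := none
  m _ := .pop () (fun _ o => o) <| .branch Option.isSome (.goto fun _ => ())
    (w.foldl (fun q a => .push () (fun _ => a) q) .halt)

theorem stepAux_foldl_push (w : List Bool) : ∀ (q : TM2.Stmt (fun _ : Unit => Bool) Unit
    (Option Bool)) (v : Option Bool) (S : Unit → List Bool),
    TM2.stepAux (w.foldl (fun q a => .push () (fun _ => a) q) q) v S =
      TM2.stepAux q v (fun _ => w ++ S ()) := by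
  induction w with
  | nil => intro q v S; rfl
  | cons a w ih =>
    intro q v S
    rw [List.foldl_cons, ih, TM2.stepAux]
    congr 1

/-- One step is spent on each symbol popped. The step that finds the stack empty writes the whole
word at once, and its pop has restored the initial state `none`. -/
theorem stepsTo_constMachine (w u : List Bool) : ∀ v : Option Bool,
    StepsTo (constMachine w) (u.length + 1) ⟨some (), v, fun _ => u⟩
      ⟨none, none, fun _ => w⟩ := by
  induction u with
  | nil =>
    intro v
    refine StepsTo.head ?_ (StepsTo.refl _)
    refine congrArg some ((stepAux_foldl_push w .halt none fun _ => []).trans ?_)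
    exact congrArg (fun z => TM2.Cfg.mk none none fun _ => z) (List.append_nil w)
  | cons a u ih =>
    intro v
    refine StepsTo.head ?_ (ih (some a))
    change some (TM2.Cfg.mk _ _ (Function.update (fun _ : Unit => a :: u) () u)) = _
    congr 2

theorem nonempty_polyTime_const (n : ℕ) :
    Nonempty (TM2ComputableInPolyTime unaryEncodeNat encodeNat fun _ => n) :=
  ⟨{ tm := constMachine (encodeNat n)
     inputAlphabet := Equiv.refl Bool
     outputAlphabet := Equiv.refl Bool
     time := Polynomial.X + 1
     outputsFun := fun a =>
      { steps := (unaryEncodeNat a).length + 1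
        evals_in_steps := by
          have h := stepsTo_constMachine (encodeNat n) (unaryEncodeNat a) none
          have e₁ := List.map_id (unaryEncodeNat a)
          have e₂ := List.map_id (encodeNat n)
          refine Eq.trans ?_ (Eq.trans h ?_)
          · exact congrArg _ (congrArg (fun z => some (initList (constMachine _) z)) e₁)
          · exact (congrArg (fun z => some (haltList (constMachine _) z)) e₂).symm
        steps_le_m := by simp } }⟩

theorem polyTimeFun_natCast (n : ℕ) : PolyTimeFun fun _ => n :=
  ⟨fun _ => n, fun _ => 1, nonempty_polyTime_const n, nonempty_polyTime_const 1, by simp⟩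

end Const

/-! ## Subexponential functions -/

section Subexponential

open Filter Asymptotics

theorem Subexponential.isBigO {T : ℕ → ℕ} (hT : Subexponential T) {b : ℝ} (hb : 1 < b) :
    (fun n => (T n : ℝ)) =O[atTop] fun n => b ^ n := by
  obtain ⟨f, hf, hTf⟩ := hT
  have hb₀ : 0 < b := zero_lt_one.trans hb
  refine IsBigO.of_bound 1 ?_
  filter_upwards [(isLittleO_iff.1 hf) (Real.logb_pos one_lt_two hb)] with n hn
  rw [Real.norm_of_nonneg (Nat.cast_nonneg _), Real.norm_of_nonneg (by positivity), one_mul]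
  rw [Real.norm_eq_abs, Real.norm_of_nonneg (Nat.cast_nonneg _)] at hn
  calc (T n : ℝ) ≤ (2 : ℝ) ^ f n := hTf n
    _ ≤ (2 : ℝ) ^ (Real.logb 2 b * n) :=
      Real.rpow_le_rpow_of_exponent_le one_le_two ((le_abs_self _).trans hn)
    _ = b ^ n := by
      rw [Real.rpow_mul zero_le_two, Real.rpow_logb zero_lt_two (by norm_num) hb₀,
        Real.rpow_natCast]

/-- Together with `Subexponential.isBigO` this replaces the exponent o(n) by growth below every
exponential, a condition with simple closure properties. -/
theorem subexponential_of_isBigO {T : ℕ → ℕ}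
    (hT : ∀ b : ℝ, 1 < b → (fun n => (T n : ℝ)) =O[atTop] fun n => b ^ n) :
    Subexponential T := by
  -- The maximum with 1 keeps the logarithm meaningful and nonnegative where `T n` is 0.
  have hpos : ∀ n, 0 < max 1 (T n : ℝ) := fun n => zero_lt_one.trans_le (le_max_left _ _)
  refine ⟨fun n => Real.logb 2 (max 1 (T n)), isLittleO_iff.2 fun ε hε => ?_, fun n => ?_⟩
  · have hb : (1 : ℝ) < 2 ^ (ε / 2) := Real.one_lt_rpow one_lt_two (by positivity)
    obtain ⟨A, hA⟩ := (hT _ hb).bound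
    set B := max 1 A
    have hB : 1 ≤ B := le_max_left _ _
    filter_upwards [hA, eventually_ge_atTop ⌈2 * Real.logb 2 B / ε⌉₊] with n hn hnB
    have hn' : 2 * Real.logb 2 B ≤ n * ε := (div_le_iff₀ hε).1 (Nat.ceil_le.1 hnB)
    have hle : max 1 (T n : ℝ) ≤ B * ((2 : ℝ) ^ (ε / 2)) ^ n := by
      rw [Real.norm_of_nonneg (Nat.cast_nonneg _), Real.norm_of_nonneg (by positivity)] at hn
      have h₁ : 1 ≤ ((2 : ℝ) ^ (ε / 2)) ^ n := one_le_pow₀ hb.le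
      refine max_le (one_le_mul_of_one_le_of_one_le hB h₁) (hn.trans ?_)
      gcongr
      exact le_max_right _ _
    rw [Real.norm_of_nonneg (Real.logb_nonneg one_lt_two (le_max_left _ _)),
      Real.norm_of_nonneg (Nat.cast_nonneg _)]
    calc Real.logb 2 (max 1 (T n)) ≤ Real.logb 2 (B * ((2 : ℝ) ^ (ε / 2)) ^ n) :=
          Real.logb_le_logb_of_le one_lt_two (hpos n) hle
      _ = Real.logb 2 B + n * (ε / 2) := by
          rw [Real.logb_mul (by positivity) (by positivity), Real.logb_pow,
            Real.logb_rpow zero_lt_two (by norm_num)]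
      _ ≤ ε * n := by linarith
  · rw [Real.rpow_logb zero_lt_two (by norm_num) (hpos n)]
    exact le_max_right _ _

theorem subexponential_eval (P : Polynomial ℕ) : Subexponential fun n => P.eval n := by
  refine subexponential_of_isBigO fun b hb => ?_
  induction P using Polynomial.induction_on' with
  | add P Q hP hQ => simpa using hP.add hQ
  | monomial k a =>
    simpa using (isLittleO_pow_const_const_pow_of_one_lt k hb).isBigO.const_mul_left (a : ℝ)

theorem Subexponential.add {S T : ℕ → ℕ} (hS : Subexponential S) (hT : Subexponential T) :
    Subexponential fun n => S n + T n :=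
  subexponential_of_isBigO fun b hb => by simpa using (hS.isBigO hb).add (hT.isBigO hb)

/-- The time bound `T` need not be monotone, so its maximum over all possible sizes of the
translated circuit is taken. -/
theorem Subexponential.sup_range {T : ℕ → ℕ} (hT : Subexponential T) (k : ℕ) :
    Subexponential fun n => (Finset.range (k * n + 1)).sup T := by
  refine subexponential_of_isBigO fun b hb => ?_
  have hb₀ : 0 < b := zero_lt_one.trans hb
  have hk : (0 : ℝ) < ((k + 1 : ℕ) : ℝ)⁻¹ := by positivity
  -- A root of `b` compensates for the factor in the argument; k + 1 in place of k avoids the zeroth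
  -- root.
  set d : ℝ := b ^ ((k + 1 : ℕ) : ℝ)⁻¹
  have hd : 1 < d := Real.one_lt_rpow hb hk
  have hdk : d ^ (k + 1) = b := Real.rpow_inv_natCast_pow hb₀.le (by omega)
  obtain ⟨A, hA, h⟩ := bound_of_isBigO_nat_atTop (hT.isBigO hd)
  refine IsBigO.of_bound A (Eventually.of_forall fun n => ?_)
  rw [Real.norm_of_nonneg (Nat.cast_nonneg _), Real.norm_of_nonneg (by positivity)]
  obtain ⟨j, hj, e⟩ := Finset.exists_mem_eq_sup (Finset.range (k * n + 1)) (by simp) T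
  rw [e]
  have hj' : j ≤ (k + 1) * n := by
    have := Finset.mem_range.1 hj
    rw [Nat.add_mul]
    omega
  have := h (x := j) (by positivity)
  rw [Real.norm_of_nonneg (Nat.cast_nonneg _), Real.norm_of_nonneg (by positivity)] at this
  calc (T j : ℝ) ≤ A * d ^ j := this
    _ ≤ A * d ^ ((k + 1) * n) := by
      gcongr
      exact hd.le
    _ = A * b ^ n := by rw [pow_mul, hdk]

end Subexponential

/-! ## The reduction -/

theorem OutputsIn.mono {M : Turing.TM2ComputableAux Sym Sym} {u v : List Sym} {t t' : ℕ}
    (h : OutputsIn M u v t) (ht : t ≤ t') : OutputsIn M u v t' := by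
  obtain ⟨⟨k, hk⟩⟩ := h
  exact ⟨⟨k, hk.trans ht⟩⟩

/-- A step pushes at most one symbol, so the time bound of the translation also bounds the length of
its output. -/
theorem Exec.length_le {K : Type} [DecidableEq K] {p : Prog K} {s s' : Stacks K} {t : ℕ}
    (h : Exec p s s' t) (k : K) : (s' k).length ≤ (s k).length + t := by
  have tail : ∀ (s : Stacks K) (j : K),
      (Function.update s j (s j).tail k).length ≤ (s k).length := by
    intro s j
    by_cases h : k = j
    · subst h; simp
    · simp [h]
  induction h with
  | skip => simp
  | push j a s =>
    by_cases h : k = j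
    · subst h; simp
    · simp [h]
  | seq _ _ ih₁ ih₂ => omega
  | @done j _ _ s _ _ _ _ ih => have := tail s j; omega
  | @again j _ _ s _ _ _ _ _ _ _ ih₁ ih₂ => have := tail s j; omega
  | mono _ _ ih => omega

/-- A bound for the time that it takes to translate a circuit of size `n`. -/
noncomputable def translateTime : Polynomial ℕ :=
  let l : Polynomial ℕ := Polynomial.C 100 * (Polynomial.X + 1) ^ 3 + 1
  Polynomial.C 2000 * (Polynomial.C 10 * l ^ 2 + 1) ^ 2 * l

theorem exec_translate_of_wf {C : BCircuit} (hC : C.WF) :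
    Exec translate (Function.update (fun _ => []) Stk.inp C.encode)
      (Function.update (fun _ => []) Stk.out (translateWord C).reverse)
      (translateTime.eval C.size) := by
  refine (exec_translate C).mono ?_
  have := hC.length_encode_le
  simp only [translateTime, Polynomial.eval_mul, Polynomial.eval_add, Polynomial.eval_pow,
    Polynomial.eval_C, Polynomial.eval_X, Polynomial.eval_one]
  gcongr

theorem length_translateWord_le {C : BCircuit} (hC : C.WF) :
    (translateWord C).length ≤ translateTime.eval C.size := by
  simpa using (exec_translate_of_wf hC).length_le Stk.out

end WeftETH

/-! ### The implication between the hypotheses -/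

open WeftETH in
theorem mainTheorem5 (h : WeftETH.QCETH) : WeftETH.QETH := by
  -- Completeness 1 and soundness 0 have gap 1 > 1/2, and the ancilla bound 2X² + 2X is that of
  -- `numAncilla_toQ_le`.
  refine ⟨fun _ => (1 : ℕ), fun _ => (0 : ℕ), polyTimeFun_natCast 1, polyTimeFun_natCast 0,
    fun n => by simp, ⟨Polynomial.C 2, fun n => by norm_num⟩,
    Polynomial.C 2 * Polynomial.X ^ 2 + Polynomial.C 2 * Polynomial.X, ?_⟩
  rintro ⟨M, T, hT, hM⟩
  refine h ⟨prependAux translate Stk.inp Stk.out M,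
    -- The polynomial is counted once for the translation and once for handing its output over, with
    -- one more step to start `M`.
    fun n => (translateTime + translateTime + 1).eval n + (Finset.range (38 * n + 1)).sup T,
    (subexponential_eval _).add (hT.sup_range 38), fun C hC => ?_⟩
  have hpos := hC.1.pos
  obtain ⟨D, hD, hD₀, hDe, hout, hyes, hno⟩ := hM (C.toQ hpos)
    ⟨hC.1.toQ hpos, (BCircuit.weft_toQ_le hpos hC.1).trans hC.2, by simpa using BCircuit.numAncilla_toQ_le hpos⟩
  refine ⟨D, hD, hD₀, hDe, ?_, fun hs => hyes ?_, fun hs => hno fun ψ _ => ?_⟩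
  · rw [BCircuit.encode_toQ hpos hC.1] at hout
    refine (outputsIn_prepend translate Stk.inp Stk.out M (exec_translate_of_wf hC.1) hout).mono ?_
    have h₁ := length_translateWord_le hC.1
    have h₂ : T (C.toQ hpos).size ≤ (Finset.range (38 * C.size + 1)).sup T :=
      Finset.le_sup (Finset.mem_range.2 (Nat.lt_succ_of_le (BCircuit.size_toQ_le hpos)))
    simp only [Polynomial.eval_add, Polynomial.eval_one]
    omega
  · obtain ⟨ψ, hψ, e⟩ := hC.1.acceptProb_toQ_of_satisfiable hpos hs
    exact ⟨ψ, hψ, by simp [e]⟩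
  · exact (hC.1.acceptProb_toQ_of_not_satisfiable hpos hs ψ).le.trans (by simp)
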